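/- **Setting.** Let $P_\alpha$ ($1\le\alpha\le a$) be distinct non-identity $N$-qubit Pauli strings (no phase), let $Q_\beta$ ($1\le\beta\le b$) be distinct non-identity $N$-qubit Pauli strings, and let $T\ge 1$, $a\ge1$, $b\ge0$. Unknown coherent signals $\theta_\alpha(t)\in\mathbb R$ and incoherent signals $\gamma_\beta(t)\ge 0$ ($1\le t\le T$) are given; $K_c=aT$ and $K_{ic}=bT$ are the numbers of coherent and incoherent signals. A circuit is a sequence $C_1,\dots,C_T$ of $N$-qubit Cliffords. Starting from $|0\rangle^{\otimes N}$, step $t$ applies $C_t$, then $e^{-i\sum_\alpha\theta_\alpha(t)P_\alpha}$, then the channels $\rho\mapsto(1-\gamma_\beta(t))\rho+\gamma_\beta(t)Q_\beta\rho Q_\beta$ for all $\beta$; after step $T$ one applies $(C_T\cdots C_1)^\dagger$ and measures either in the computational basis (z-basis; distribution $p_{\mathrm z}$) or in the computational basis after Hadamards $\mathrm H^{\otimes N}$ (x-basis; distribution $p_{\mathrm x}$). Draw $n_c$ circuits whose $n_cT$ Cliffords are independent and uniform in the Clifford group modulo phase. Measure each circuit independently $M/n_c$ times in the x-basis and $M/n_c$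 times in the z-basis. With $\tilde P=C_1^\dagger\cdots C_t^\dagger PC_t\cdots C_1$ put $$\delta p_{\alpha,t}(z)=2\,\mathrm{Im}\big[\langle z|\mathrm H^{\otimes N}\tilde P_\alpha|0\rangle\langle0|\mathrm H^{\otimes N}|z\rangle\big],\qquad k_{\beta,t}(z)=|\langle z|\tilde Q_\beta|0\rangle|^2 .$$ Let $V_{\mathrm x}$ be the matrix with rows indexed by pairs (circuit $n$, bitstring $z$), with column $0$ equal to $2^{-N}$ and columns $(\alpha,t)$ equal to $\delta p^{(n)}_{\alpha,t}(z)$; let $V_{\mathrm z}$ be the matrix with the same rows, column $0$ equal to $\delta_{z,0}$ and columns $(\beta,t)$ equal to $k^{(n)}_{\beta,t}(z)$. For a vector $y$ over the rows write $V^+y=(V^TV)^{-1}V^Ty$. Let $\hat f_{\mathrm x},\hat f_{\mathrm z}$ be the vectors of empirical frequencies, for each circuit, of the bitstrings in the two bases. The estimators are $$\hat A=(V_{\mathrm z}^+\hat f_{\mathrm z})_0,\qquad \hat\theta_\alpha(t)=\frac{(V_{\mathrm x}^+\hat f_{\mathrm x})_{\alpha t}}{\hat A}.$$ For given circuits let $\bar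 A=(V_{\mathrm z}^+p_{\mathrm z})_0$ be the mean of $\hat A$, and define the bias $$b_\alpha(t)=\frac{(V_{\mathrm x}^+p_{\mathrm x})_{\alpha t}}{\bar A}-\theta_\alpha(t),$$ i.e. the ratio of the means of the numerator and denominator of the estimator, minus the true signal. **Theorem.** There are universal constants $c,C_0,C>0$ such that the following holds for all data as above in the perturbative regime $\sum_{\beta,t}\gamma_\beta(t)+\sum_{\alpha,t}\theta_\alpha(t)^2\le c$, all $0<\delta\le\frac12$ and $\epsilon>0$, and all $N\ge C\log\frac{K_c+K_{ic}}{\delta}$. Use $n_c=\lceil C_0\log(K_c/\delta)\rceil$ circuits, and let $M$ be any multiple of $n_c$ with $$M\ \ge\ C\max\Big\{\frac{\log(K_c/\delta)}{\epsilon^2},\ \frac{\log(K_c/\delta)}{\epsilon},\ \log\frac{K_c}{\delta}\,\log\frac1\delta\Big\}.$$ Then, with probability at least $1-\delta$ over the random circuits and the measurement outcomes, $V_{\mathrm x}^TV_{\mathrm x}$ and $V_{\mathrm z}^TV_{\mathrm z}$ are invertible, $\bar A>0$, $\hat A>0$, and for all $\alpha,t$ $$|\hat\theta_\alpha(t)-\theta_\alpha(t)|\le\epsilon+|b_\alpha(t)|,\qquad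 |b_\alpha(t)|\le C\Big(\sum_{\alpha',t'}|\theta_{\alpha'}(t')|+\sum_{\beta,t'}\gamma_\beta(t')\Big)^2 .$$ In particular, if the bias, which is of second order in the signals, is neglected, then $\max_{\alpha,t}|\hat\theta_\alpha(t)-\theta_\alpha(t)|\le\epsilon$ with probability at least $1-\delta$. Moreover the first term of the maximum is the dominant one for small $\epsilon$: the maximum equals $\log(K_c/\delta)/\epsilon^2$ whenever $\epsilon\le1$ and $\epsilon^2\log(1/\delta)\le1$. -/

import Mathlib

open scoped Matrix

/-! ## Qubits, Pauli strings, Hadamard layer -/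

/-- Bitstrings of length `N`, indexing the computational basis of `N` qubits. -/
abbrev Bits (N : ℕ) : Type := Fin N → Fin 2

/-- Operators on `N` qubits, as matrices in the computational basis. -/
abbrev QOp (N : ℕ) : Type := Matrix (Bits N) (Bits N) ℂ

/-- The single-qubit Pauli matrices `I, X, Y, Z`, numbered `0, 1, 2, 3`. -/
def pauli1 : Fin 4 → Matrix (Fin 2) (Fin 2) ℂ :=
  ![1, !![0, 1; 1, 0], !![0, -Complex.I; Complex.I, 0], !![1, 0; 0, -1]]

/-- Labels of Pauli strings (without phase); the constant label `0` is the identity. -/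
abbrev PauliString (N : ℕ) : Type := Fin N → Fin 4

/-- The tensor product `⊗ᵢ σ_{P i}`. -/
def pauliOp {N : ℕ} (P : PauliString N) : QOp N :=
  Matrix.of fun x y => ∏ i, pauli1 (P i) (x i) (y i)

/-- The single-qubit Hadamard gate. -/
noncomputable def hadamard1 : Matrix (Fin 2) (Fin 2) ℂ :=
  ((Real.sqrt 2 : ℝ) : ℂ)⁻¹ • !![1, 1; 1, -1]

/-- The Hadamard layer `H^{⊗N}`. -/
noncomputable def hadamardOp (N : ℕ) : QOp N :=
  Matrix.of fun x y => ∏ i, hadamard1 (x i) (y i)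

/-- The projector `|0⟩⟨0|` on the all-zero basis state. -/
def zeroState (N : ℕ) : QOp N := Matrix.single 0 0 1

/-! ## The Clifford group modulo global phase -/

/-- `U` is a unitary that maps, by conjugation, each Pauli string `P` to the signed Pauli string
`(f P).1 • (f P).2`. -/
def Implements {N : ℕ} (U : QOp N) (f : PauliString N → ℤˣ × PauliString N) : Prop :=
  U ∈ Matrix.unitaryGroup (Bits N) ℂ ∧
    ∀ P, U * pauliOp P * Uᴴ = (((f P).1 : ℤ) : ℂ) • pauliOp (f P).2

/-- The Clifford group on `N` qubits modulo global phase.  A Clifford unitary is a unitary that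
sends Pauli strings to signed Pauli strings under conjugation.  As the Pauli strings span all
operators, it is determined up to a global phase by this action, which therefore represents it. -/
def Clifford (N : ℕ) : Type :=
  {f : PauliString N → ℤˣ × PauliString N // ∃ U : QOp N, Implements U f}

noncomputable instance (N : ℕ) : Fintype (Clifford N) :=
  @Fintype.ofFinite _ (inferInstanceAs (Finite (Subtype _)))

/-- A unitary matrix of a Clifford element.  Its global phase is immaterial: everything below
uses it only through conjugation. -/
noncomputable def Clifford.mat {N : ℕ} (C : Clifford N) : QOp N := Classical.choose C.2

/-- A circuit: one Clifford for each of the `T` time steps. -/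
abbrev Circuit (N T : ℕ) : Type := Fin T → Clifford N

/-- The product `C_k ⋯ C_1` of the first `k` Cliffords of a circuit. -/
noncomputable def circuitPrefix {N T : ℕ} (C : Circuit N T) : ℕ → QOp N
  | 0 => 1
  | k + 1 => if h : k < T then (C ⟨k, h⟩).mat * circuitPrefix C k else circuitPrefix C k

/-- The signal generator `P`, acting after the Clifford of time step `t`, pulled back to the
beginning of the circuit: `C_1† ⋯ C_t† P C_t ⋯ C_1`. -/
noncomputable def pulledBack {N T : ℕ} (C : Circuit N T) (P : PauliString N) (t : Fin T) : QOp N :=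
  (circuitPrefix C (t + 1))ᴴ * pauliOp P * circuitPrefix C (t + 1)

/-! ## Exact outcome distributions

`P`, `θ`: generators and strengths of the coherent signals; `Q`, `γ`: generators and rates of the
incoherent signals. -/

/-- The coherent signal `exp (-i ∑_α θ_α P_α)` of one time step. -/
noncomputable def coherentSignal {N a : ℕ} (P : Fin a → PauliString N) (θ : Fin a → ℝ) : QOp N :=
  NormedSpace.exp ((-Complex.I) • ∑ α, (θ α : ℂ) • pauliOp (P α))

/-- The incoherent signal `ρ ↦ (1 - γ) ρ + γ Q ρ Q`. -/
noncomputable def pauliChannel {N : ℕ} (Q : PauliString N) (γ : ℝ) (ρ : QOp N) : QOp N :=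
  ((1 - γ : ℝ) : ℂ) • ρ + (γ : ℂ) • (pauliOp Q * ρ * pauliOp Q)

/-- All incoherent signals of one time step, one after the other (Pauli channels commute). -/
noncomputable def incoherentSignal {N b : ℕ} (Q : Fin b → PauliString N) (γ : Fin b → ℝ)
    (ρ : QOp N) : QOp N :=
  (List.finRange b).foldl (fun σ β => pauliChannel (Q β) (γ β) σ) ρ

/-- The state after the first `k` time steps, each of which applies its Clifford and then
accumulates signal, starting from `|0⟩⟨0|`. -/
noncomputable def stateAfter {N T a b : ℕ} (P : Fin a → PauliString N) (θ : Fin a → Fin T → ℝ)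
    (Q : Fin b → PauliString N) (γ : Fin b → Fin T → ℝ) (C : Circuit N T) : ℕ → QOp N
  | 0 => zeroState N
  | k + 1 =>
    if h : k < T then
      incoherentSignal Q (fun β => γ β ⟨k, h⟩)
        (coherentSignal P (fun α => θ α ⟨k, h⟩) *
          ((C ⟨k, h⟩).mat * stateAfter P θ Q γ C k * (C ⟨k, h⟩).matᴴ) *
          (coherentSignal P (fun α => θ α ⟨k, h⟩))ᴴ)
    else stateAfter P θ Q γ C k

/-- The state before the measurement, after the final layer `(C_T ⋯ C_1)†`. -/
noncomputable def finalState {N T a b : ℕ} (P : Fin a → PauliString N) (θ : Fin a → Fin T → ℝ)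
    (Q : Fin b → PauliString N) (γ : Fin b → Fin T → ℝ) (C : Circuit N T) : QOp N :=
  (circuitPrefix C T)ᴴ * stateAfter P θ Q γ C T * circuitPrefix C T

/-- Probability of the bitstring `z` in the incoherent protocol (z-basis measurement). -/
noncomputable def probZ {N T a b : ℕ} (P : Fin a → PauliString N) (θ : Fin a → Fin T → ℝ)
    (Q : Fin b → PauliString N) (γ : Fin b → Fin T → ℝ) (C : Circuit N T) (z : Bits N) : ℝ :=
  (finalState P θ Q γ C z z).re

/-- Probability of the bitstring `z` in the coherent protocol (x-basis measurement: Hadamard gates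
before the measurement in the computational basis). -/
noncomputable def probX {N T a b : ℕ} (P : Fin a → PauliString N) (θ : Fin a → Fin T → ℝ)
    (Q : Fin b → PauliString N) (γ : Fin b → Fin T → ℝ) (C : Circuit N T) (z : Bits N) : ℝ :=
  ((hadamardOp N * finalState P θ Q γ C * hadamardOp N) z z).re

/-! ## Least-squares estimators -/

/-- The first-order response of the x-basis distribution to the coherent signal `(P, t)`,
`δp(z) = 2 Im [⟨z| H^{⊗N} C_1† ⋯ C_t† P C_t ⋯ C_1 |0⟩ ⟨0| H^{⊗N} |z⟩]`. -/
noncomputable def deltaP {N T : ℕ} (C : Circuit N T) (P : PauliString N) (t : Fin T)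
    (z : Bits N) : ℝ :=
  2 * ((hadamardOp N * pulledBack C P t) z 0 * hadamardOp N 0 z).im

/-- The response of the z-basis distribution to the incoherent signal `(Q, t)`,
`k(z) = |⟨z| C_1† ⋯ C_t† Q C_t ⋯ C_1 |0⟩|²`. -/
noncomputable def kernelK {N T : ℕ} (C : Circuit N T) (Q : PauliString N) (t : Fin T)
    (z : Bits N) : ℝ :=
  ‖pulledBack C Q t z 0‖ ^ 2

/-- Design matrix of the coherent protocol with `n` circuits.  Rows: a circuit and a bitstring.
Columns: `none` for the uniform signal-free distribution, `some (α, t)` for the coherent signals. -/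
noncomputable def designX {N T a n : ℕ} (P : Fin a → PauliString N) (C : Fin n → Circuit N T) :
    Matrix (Fin n × Bits N) (Option (Fin a × Fin T)) ℝ :=
  Matrix.of fun r col => match col with
    | none => 1 / 2 ^ N
    | some (α, t) => deltaP (C r.1) (P α) t r.2

/-- Design matrix of the incoherent protocol with `n` circuits.  Columns: `none` for the signal-free
distribution, concentrated on the bitstring `0`, and `some (β, t)` for the incoherent signals. -/
noncomputable def designZ {N T b n : ℕ} (Q : Fin b → PauliString N) (C : Fin n → Circuit N T) :
    Matrix (Fin n × Bits N) (Option (Fin b × Fin T)) ℝ :=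
  Matrix.of fun r col => match col with
    | none => if r.2 = 0 then 1 else 0
    | some (β, t) => kernelK (C r.1) (Q β) t r.2

/-- Least-squares regression coefficients `(VᵀV)⁻¹ Vᵀ y`. -/
noncomputable def leastSquares {R K : Type} [Fintype R] [Fintype K] [DecidableEq K]
    (V : Matrix R K ℝ) (y : R → ℝ) : K → ℝ :=
  ((Vᵀ * V)⁻¹ * Vᵀ) *ᵥ y

/-- Measured bitstrings of `n` circuits with `m` shots each. -/
abbrev Shots (N n m : ℕ) : Type := Fin n → Fin m → Bits N

/-- Empirical frequency of the bitstring `r.2` in the shots of the circuit `r.1`. -/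
noncomputable def empirical {N n m : ℕ} (s : Shots N n m) (r : Fin n × Bits N) : ℝ :=
  ((Finset.univ.filter fun j => s r.1 j = r.2).card : ℝ) / m

/-- The estimator `Â` of the signal fidelity, from the z-basis shots. -/
noncomputable def fidelityEst {N T b n m : ℕ} (Q : Fin b → PauliString N)
    (C : Fin n → Circuit N T) (sz : Shots N n m) : ℝ :=
  leastSquares (designZ Q C) (empirical sz) none

/-- The estimator of `θ_α(t)`: the regression coefficient of the x-basis shots, divided by `Â`. -/
noncomputable def thetaEst {N T a b n m : ℕ} (P : Fin a → PauliString N) (Q : Fin b → PauliString N)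
    (C : Fin n → Circuit N T) (sx sz : Shots N n m) (α : Fin a) (t : Fin T) : ℝ :=
  leastSquares (designX P C) (empirical sx) (some (α, t)) / fidelityEst Q C sz

/-- The mean of `Â` over the measurement outcomes, for given circuits. -/
noncomputable def fidelityMean {N T a b n : ℕ} (P : Fin a → PauliString N) (θ : Fin a → Fin T → ℝ)
    (Q : Fin b → PauliString N) (γ : Fin b → Fin T → ℝ) (C : Fin n → Circuit N T) : ℝ :=
  leastSquares (designZ Q C) (fun r => probZ P θ Q γ (C r.1) r.2) none

/-- The bias for given circuits: the ratio of the means of the numerator and the denominator of the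
estimator (its value for infinitely many shots), minus the true signal. -/
noncomputable def thetaBias {N T a b n : ℕ} (P : Fin a → PauliString N) (θ : Fin a → Fin T → ℝ)
    (Q : Fin b → PauliString N) (γ : Fin b → Fin T → ℝ) (C : Fin n → Circuit N T)
    (α : Fin a) (t : Fin T) : ℝ :=
  leastSquares (designX P C) (fun r => probX P θ Q γ (C r.1) r.2) (some (α, t)) /
    fidelityMean P θ Q γ C - θ α t

/-! ## The random experiment -/

open Classical in
/-- Probability of the event `E` when the `n` circuits consist of independent, uniformly random
Cliffords, and each circuit is measured, independently, `m` times in the x-basis (outcomes `sx`)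
and `m` times in the z-basis (outcomes `sz`). -/
noncomputable def experimentProb {N T a b : ℕ} (P : Fin a → PauliString N) (θ : Fin a → Fin T → ℝ)
    (Q : Fin b → PauliString N) (γ : Fin b → Fin T → ℝ) (n m : ℕ)
    (E : (Fin n → Circuit N T) → Shots N n m → Shots N n m → Prop) : ℝ :=
  ∑ C : Fin n → Circuit N T, ∑ sx : Shots N n m, ∑ sz : Shots N n m,
    (Fintype.card (Fin n → Circuit N T) : ℝ)⁻¹ *
      (∏ i, ∏ j, probX P θ Q γ (C i) (sx i j)) *
      (∏ i, ∏ j, probZ P θ Q γ (C i) (sz i j)) *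
      (if E C sx sz then 1 else 0)

/-- The sample-complexity scale
`max {log (K/δ) / ε², log (K/δ) / ε, log (K/δ) log (1/δ)}`. -/
noncomputable def sampleScale (K δ ε : ℝ) : ℝ :=
  max (Real.log (K / δ) / ε ^ 2)
    (max (Real.log (K / δ) / ε) (Real.log (K / δ) * Real.log (1 / δ)))

/-! ## Tensor products of single-qubit operators -/

/-! Conjugating by the Clifford prefixes removes the Clifford layers: seen from the initial state,
step `t` applies only its signal, with generators pulled back by `(C_t ⋯ C_1)⁻¹` (`finalState_eq`).
Circuits are in bijection with families of pull-backs (`pullbackEquiv`), so the pull-backs are again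
independent and uniform. A pulled-back generator is a signed Pauli string and sends `|0⟩` to a phase
times one basis state, labelled by `flips`. A z-basis signal column is therefore the indicator of
one bitstring per circuit, and an x-basis signal column is, in each circuit, a multiple of a
character that is nonzero exactly when the string has an odd number of `Y`s (`kernelK_eq`,
`deltaP_eq`). When the flipped bitstrings are nonzero and pairwise distinct, the columns are
orthogonal, and the regressions become explicit averages.

Random circuits are typical (`pr_not_typical_le`) for three reasons. The Clifford group is
transitive on non-identity Pauli strings, so an image is a uniform non-identity string
(`Clifford.sum_label`); collisions of flipped bitstrings then have probability of order `2 ^ (-N)`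
per pair, which the bound on `N` absorbs. An image has an odd number of `Y`s with probability at
least `1/3`. Finally the mean return probability is at least `1 - ∑ γ - ∑ θ²`: twirling the coherent
unitary leaves only its normalised trace, whose deviation from `1` is quadratic in `θ`
(`sum_expUnitary_conj_ge`). Chernoff's bound over the circuits makes the last two statements hold
for the empirical averages.

For typical circuits the bias is of second order (`abs_thetaBias_le`). In trace norm the final state
is its first-order expansion up to `3 S²`, where `S` is the sum of all signal strengths; in the
x-basis the incoherent first-order terms vanish, the regression is exact on the coherent ones and
bounded on the remainder. The fidelity differs from `1` by at most `2 S`, and it multiplies a signal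
that is itself at most `S`.

Shot noise is controlled by Chernoff's bound over all shots of all circuits, with a union bound over
the coherent signals only (`pr_abs_deviation_ge_le`). The ratio is stable because its denominator
stays away from zero (`abs_thetaEst_sub_le`). -/

/-- The tensor product of single-qubit operators. -/
def tens {N : ℕ} (A : Fin N → Matrix (Fin 2) (Fin 2) ℂ) : QOp N :=
  Matrix.of fun x y => ∏ i, A i (x i) (y i)

theorem tens_apply {N : ℕ} (A : Fin N → Matrix (Fin 2) (Fin 2) ℂ) (x y : Bits N) :
    tens A x y = ∏ i, A i (x i) (y i) := rfl

theorem pauliOp_eq_tens {N : ℕ} (P : PauliString N) : pauliOp P = tens fun i => pauli1 (P i) := rfl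

theorem hadamardOp_eq_tens (N : ℕ) : hadamardOp N = tens fun _ => hadamard1 := rfl

theorem sum_bits_prod {R : Type*} [CommSemiring R] {N : ℕ} (f : Fin N → Fin 2 → R) :
    ∑ y : Bits N, ∏ i, f i (y i) = ∏ i, (f i 0 + f i 1) := by
  have h := (Finset.prod_univ_sum (fun _ : Fin N => (Finset.univ : Finset (Fin 2))) f).symm
  rw [Fintype.piFinset_univ] at h
  rw [h]
  simp [Fin.sum_univ_two]

theorem sum_pauliString_prod {R : Type*} [CommSemiring R] {N : ℕ} (f : Fin N → Fin 4 → R) :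
    ∑ y : PauliString N, ∏ i, f i (y i) = ∏ i, ∑ p, f i p := by
  have h := (Finset.prod_univ_sum (fun _ : Fin N => (Finset.univ : Finset (Fin 4))) f).symm
  rw [Fintype.piFinset_univ] at h
  exact h

theorem tens_mul {N : ℕ} (A B : Fin N → Matrix (Fin 2) (Fin 2) ℂ) :
    tens A * tens B = tens fun i => A i * B i := by
  ext x z
  simp only [Matrix.mul_apply, tens_apply, ← Finset.prod_mul_distrib]
  rw [sum_bits_prod fun i y => A i (x i) y * B i y (z i)]
  simp [Fin.sum_univ_two]

theorem tens_conjTranspose {N : ℕ} (A : Fin N → Matrix (Fin 2) (Fin 2) ℂ) :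
    (tens A)ᴴ = tens fun i => (A i)ᴴ := by
  ext x z
  simp [tens_apply, Matrix.conjTranspose_apply]

theorem tens_one (N : ℕ) : tens (fun _ : Fin N => (1 : Matrix (Fin 2) (Fin 2) ℂ)) = 1 := by
  ext x z
  simp only [tens_apply, Matrix.one_apply]
  by_cases h : x = z
  · simp [h]
  · rw [if_neg h]
    obtain ⟨i, hi⟩ := Function.ne_iff.1 h
    exact Finset.prod_eq_zero (Finset.mem_univ i) (if_neg hi)

theorem tens_smul {N : ℕ} (c : Fin N → ℂ) (A : Fin N → Matrix (Fin 2) (Fin 2) ℂ) :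
    tens (fun i => c i • A i) = (∏ i, c i) • tens A := by
  ext x z
  simp [tens_apply, Finset.prod_mul_distrib]

theorem trace_tens {N : ℕ} (A : Fin N → Matrix (Fin 2) (Fin 2) ℂ) :
    (tens A).trace = ∏ i, (A i).trace := by
  simp only [Matrix.trace, Matrix.diag, tens_apply]
  rw [sum_bits_prod fun i y => A i y y]
  simp [Fin.sum_univ_two]

/-! ## Pauli algebra -/

/-- The label of the product of two single-qubit Pauli matrices. -/
def pmul1 : Fin 4 → Fin 4 → Fin 4 :=
  ![![0, 1, 2, 3], ![1, 0, 3, 2], ![2, 3, 0, 1], ![3, 2, 1, 0]]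

/-- The phase of the product of two single-qubit Pauli matrices. -/
noncomputable def pphase1 : Fin 4 → Fin 4 → ℂ :=
  ![![1, 1, 1, 1], ![1, 1, Complex.I, -Complex.I], ![1, -Complex.I, 1, Complex.I],
    ![1, Complex.I, -Complex.I, 1]]

/-- The commutation sign of two single-qubit Pauli matrices. -/
def csgn1 : Fin 4 → Fin 4 → ℤˣ :=
  ![![1, 1, 1, 1], ![1, 1, -1, -1], ![1, -1, 1, -1], ![1, -1, -1, 1]]

theorem pauli1_mul (p q : Fin 4) : pauli1 p * pauli1 q = pphase1 p q • pauli1 (pmul1 p q) := by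
  fin_cases p <;> fin_cases q <;> ext i j <;> fin_cases i <;> fin_cases j <;>
    simp [pauli1, pphase1, pmul1, Matrix.mul_apply, Fin.sum_univ_two]

theorem pauli1_conjTranspose (p : Fin 4) : (pauli1 p)ᴴ = pauli1 p := by
  fin_cases p <;> ext i j <;> fin_cases i <;> fin_cases j <;>
    simp [pauli1, Matrix.conjTranspose_apply]

theorem pphase1_comm (p q : Fin 4) : pphase1 p q = ((csgn1 p q : ℤ) : ℂ) * pphase1 q p := by
  fin_cases p <;> fin_cases q <;> simp [pphase1, csgn1]

theorem pphase1_ne_zero (p q : Fin 4) : pphase1 p q ≠ 0 := by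
  fin_cases p <;> fin_cases q <;> simp [pphase1]

theorem pmul1_comm (p q : Fin 4) : pmul1 p q = pmul1 q p := by revert p q; decide

theorem pmul1_eq_zero {p q : Fin 4} (h : pmul1 p q = 0) : p = q := by revert p q; decide

theorem csgn1_pmul1 (p q r : Fin 4) : csgn1 (pmul1 p q) r = csgn1 p r * csgn1 q r := by
  revert p q r; decide

theorem csgn1_comm (p q : Fin 4) : csgn1 p q = csgn1 q p := by revert p q; decide

theorem exists_csgn1 {p : Fin 4} (h : p ≠ 0) : ∃ q, csgn1 q p = -1 := by revert p; decide

theorem trace_pauli1 (p : Fin 4) : (pauli1 p).trace = if p = 0 then 2 else 0 := by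
  fin_cases p <;> simp [pauli1, Matrix.trace, Fin.sum_univ_two]

/-- The label of the product of two Pauli strings. -/
def pmul {N : ℕ} (P Q : PauliString N) : PauliString N := fun i => pmul1 (P i) (Q i)

/-- The phase of the product of two Pauli strings. -/
noncomputable def pphase {N : ℕ} (P Q : PauliString N) : ℂ := ∏ i, pphase1 (P i) (Q i)

/-- The commutation sign of two Pauli strings. -/
def csgn {N : ℕ} (P Q : PauliString N) : ℤˣ := ∏ i, csgn1 (P i) (Q i)

theorem pauliOp_mul {N : ℕ} (P Q : PauliString N) :
    pauliOp P * pauliOp Q = pphase P Q • pauliOp (pmul P Q) := by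
  simp only [pauliOp_eq_tens, tens_mul, pauli1_mul, tens_smul, pphase, pmul]

theorem pphase_ne_zero {N : ℕ} (P Q : PauliString N) : pphase P Q ≠ 0 :=
  Finset.prod_ne_zero_iff.2 fun _ _ => pphase1_ne_zero _ _

theorem pmul_comm {N : ℕ} (P Q : PauliString N) : pmul P Q = pmul Q P :=
  funext fun _ => pmul1_comm _ _

theorem eq_of_pmul_eq_zero {N : ℕ} {P Q : PauliString N} (h : pmul P Q = 0) : P = Q :=
  funext fun i => pmul1_eq_zero (congrFun h i)

theorem csgn_pmul {N : ℕ} (P Q R : PauliString N) :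
    csgn (pmul P Q) R = csgn P R * csgn Q R := by
  simp only [csgn, pmul, csgn1_pmul1, Finset.prod_mul_distrib]

theorem csgn_comm {N : ℕ} (P Q : PauliString N) : csgn P Q = csgn Q P :=
  Finset.prod_congr rfl fun _ _ => csgn1_comm _ _

theorem pauliOp_comm {N : ℕ} (P Q : PauliString N) :
    pauliOp P * pauliOp Q = ((csgn P Q : ℤ) : ℂ) • (pauliOp Q * pauliOp P) := by
  rw [pauliOp_mul, pauliOp_mul, pmul_comm, smul_smul]
  congr 1
  simp only [pphase, csgn, Units.coe_prod, Int.cast_prod, ← Finset.prod_mul_distrib]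
  exact Finset.prod_congr rfl fun _ _ => pphase1_comm _ _

theorem pauliOp_conjTranspose {N : ℕ} (P : PauliString N) : (pauliOp P)ᴴ = pauliOp P := by
  simp only [pauliOp_eq_tens, tens_conjTranspose, pauli1_conjTranspose]

theorem pauliOp_zero (N : ℕ) : pauliOp (0 : PauliString N) = 1 := by
  rw [pauliOp_eq_tens, ← tens_one]; rfl

theorem pauliOp_mul_self {N : ℕ} (P : PauliString N) : pauliOp P * pauliOp P = 1 := by
  have h : ∀ p, pauli1 p * pauli1 p = 1 := fun p => by
    fin_cases p <;> ext i j <;> fin_cases i <;> fin_cases j <;>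
      simp [pauli1, Matrix.mul_apply, Fin.sum_univ_two]
  simp only [pauliOp_eq_tens, tens_mul, h, tens_one]

theorem trace_pauliOp {N : ℕ} (P : PauliString N) :
    (pauliOp P).trace = if P = 0 then 2 ^ N else 0 := by
  rw [pauliOp_eq_tens, trace_tens]
  simp only [trace_pauli1]
  by_cases h : P = 0
  · simp [h]
  · rw [if_neg h]
    obtain ⟨i, hi⟩ := Function.ne_iff.1 h
    exact Finset.prod_eq_zero (Finset.mem_univ i) (if_neg hi)

theorem trace_pauliOp_mul {N : ℕ} (P Q : PauliString N) :
    (pauliOp P * pauliOp Q).trace = if P = Q then 2 ^ N else 0 := by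
  by_cases h : P = Q
  · subst h
    rw [pauliOp_mul_self, if_pos rfl, ← pauliOp_zero, trace_pauliOp, if_pos rfl]
  · rw [pauliOp_mul, Matrix.trace_smul, trace_pauliOp, if_neg h,
      if_neg fun h' => h (eq_of_pmul_eq_zero h'), smul_zero]

/-- Trace against `pauliOp P`: distinct Pauli strings are trace-orthogonal. This is how labels and
signs are read off from operator identities throughout. -/
theorem smul_pauliOp_inj {N : ℕ} {a b : ℂ} {P Q : PauliString N} (ha : a ≠ 0)
    (h : a • pauliOp P = b • pauliOp Q) : P = Q ∧ a = b := by
  have h2 := congrArg (fun M => (M * pauliOp P).trace) h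
  simp only [Matrix.smul_mul, Matrix.trace_smul, trace_pauliOp_mul, if_true, smul_eq_mul] at h2
  have h3 : (2 : ℂ) ^ N ≠ 0 := pow_ne_zero _ two_ne_zero
  by_cases hPQ : P = Q
  · subst hPQ
    exact ⟨rfl, mul_right_cancel₀ h3 (by simpa using h2)⟩
  · rw [if_neg (Ne.symm hPQ), mul_zero] at h2
    exact absurd h2 (mul_ne_zero ha h3)

theorem linearIndependent_pauliOp (N : ℕ) :
    LinearIndependent ℂ (pauliOp : PauliString N → QOp N) := by
  rw [Fintype.linearIndependent_iff]
  intro g hg Q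
  have h2 := congrArg (fun M => (M * pauliOp Q).trace) hg
  simp only [Finset.sum_mul, Matrix.trace_sum, Matrix.smul_mul, Matrix.trace_smul,
    trace_pauliOp_mul, Matrix.zero_mul, Matrix.trace_zero] at h2
  simpa using h2

/-- The `4 ^ N` independent strings exhaust the dimension `(2 ^ N)²`. It extends the Clifford twirl
from Pauli strings to all operators. -/
theorem span_pauliOp (N : ℕ) : Submodule.span ℂ (Set.range (pauliOp : PauliString N → QOp N)) = ⊤ := by
  apply (linearIndependent_pauliOp N).span_eq_top_of_card_eq_finrank'
  rw [Module.finrank_matrix]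
  simp [← mul_pow]

theorem exists_anticommuting {N : ℕ} {P : PauliString N} (h : P ≠ 0) : ∃ R, csgn R P = -1 := by
  obtain ⟨i, hi⟩ := Function.ne_iff.1 h
  obtain ⟨q, hq⟩ := exists_csgn1 hi
  refine ⟨Function.update 0 i q, ?_⟩
  rw [csgn, Finset.prod_eq_single i]
  · simpa using hq
  · intro j _ hj
    rw [Function.update_of_ne hj]
    have : ∀ r, csgn1 0 r = 1 := by decide
    exact this (P j)
  · simp

/-- If a string anticommuting with `P` commutes with `Q`, and vice versa, their product does both.
It supplies the intermediate string for transitivity. -/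
theorem exists_anticommuting_both {N : ℕ} {P Q : PauliString N} (hP : P ≠ 0) (hQ : Q ≠ 0) :
    ∃ R, csgn R P = -1 ∧ csgn R Q = -1 := by
  obtain ⟨R, hR⟩ := exists_anticommuting hP
  obtain ⟨S, hS⟩ := exists_anticommuting hQ
  rcases Int.units_eq_one_or (csgn R Q) with h1 | h1
  · rcases Int.units_eq_one_or (csgn S P) with h2 | h2
    · exact ⟨pmul R S, by simp [csgn_pmul, *], by simp [csgn_pmul, *]⟩
    · exact ⟨S, h2, hS⟩
  · exact ⟨R, hR, h1⟩

/-! ## The Clifford group -/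

theorem units_cast_ne_zero (u : ℤˣ) : ((u : ℤ) : ℂ) ≠ 0 := by
  rcases Int.units_eq_one_or u with h | h <;> simp [h]

theorem units_cast_mul_self (u : ℤˣ) : ((u : ℤ) : ℂ) * ((u : ℤ) : ℂ) = 1 := by
  rcases Int.units_eq_one_or u with h | h <;> simp [h]

namespace Implements

/-- Pauli operators determine their label and sign, so identities between Cliffords can be checked
on unitaries without fixing phases. -/
theorem unique {N : ℕ} {U : QOp N} {f g : PauliString N → ℤˣ × PauliString N}
    (hf : Implements U f) (hg : Implements U g) : f = g := by
  funext P
  obtain ⟨h1, h2⟩ := smul_pauliOp_inj (units_cast_ne_zero _) ((hf.2 P).symm.trans (hg.2 P))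
  refine Prod.ext (Units.ext ?_) h1
  exact_mod_cast h2

theorem one {N : ℕ} : Implements (1 : QOp N) fun P => (1, P) :=
  ⟨one_mem _, fun P => by simp⟩

theorem mul {N : ℕ} {U V : QOp N} {f g : PauliString N → ℤˣ × PauliString N}
    (hf : Implements U f) (hg : Implements V g) :
    Implements (U * V) fun P => ((g P).1 * (f (g P).2).1, (f (g P).2).2) := by
  refine ⟨mul_mem hf.1 hg.1, fun P => ?_⟩
  have : U * V * pauliOp P * (U * V)ᴴ = U * (V * pauliOp P * Vᴴ) * Uᴴ := by
    rw [Matrix.conjTranspose_mul]; noncomm_ring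
  rw [this, hg.2, Matrix.mul_smul, Matrix.smul_mul, hf.2, smul_smul]
  push_cast
  rfl

theorem conjTranspose_mul_self {N : ℕ} {U : QOp N} {f : PauliString N → ℤˣ × PauliString N}
    (hf : Implements U f) : Uᴴ * U = 1 := Matrix.mem_unitaryGroup_iff'.1 hf.1

theorem mul_conjTranspose_self {N : ℕ} {U : QOp N} {f : PauliString N → ℤˣ × PauliString N}
    (hf : Implements U f) : U * Uᴴ = 1 := Matrix.mem_unitaryGroup_iff.1 hf.1

theorem pauliOp_eq {N : ℕ} {U : QOp N} {f : PauliString N → ℤˣ × PauliString N}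
    (hf : Implements U f) (P : PauliString N) :
    Uᴴ * pauliOp (f P).2 * U = (((f P).1 : ℤ) : ℂ) • pauliOp P := by
  have h : pauliOp (f P).2 = (((f P).1 : ℤ) : ℂ) • (U * pauliOp P * Uᴴ) := by
    rw [hf.2, smul_smul, units_cast_mul_self, one_smul]
  rw [h, Matrix.mul_smul, Matrix.smul_mul]
  congr 1
  calc Uᴴ * (U * pauliOp P * Uᴴ) * U = (Uᴴ * U) * pauliOp P * (Uᴴ * U) := by noncomm_ring
    _ = pauliOp P := by rw [hf.conjTranspose_mul_self, one_mul, mul_one]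

theorem bijective {N : ℕ} {U : QOp N} {f : PauliString N → ℤˣ × PauliString N}
    (hf : Implements U f) : Function.Bijective fun P => (f P).2 := by
  refine Finite.injective_iff_bijective.1 fun P Q h => ?_
  have h1 := hf.pauliOp_eq P
  have h2 := hf.pauliOp_eq Q
  rw [h, h2] at h1
  exact (smul_pauliOp_inj (units_cast_ne_zero _) h1).1.symm

theorem exists_conjTranspose {N : ℕ} {U : QOp N} {f : PauliString N → ℤˣ × PauliString N}
    (hf : Implements U f) : ∃ g, Implements Uᴴ g := by
  choose g hg using hf.bijective.2
  refine ⟨fun P => ((f (g P)).1, g P), ?_, fun P => ?_⟩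
  · rw [Matrix.mem_unitaryGroup_iff, Matrix.star_eq_conjTranspose, Matrix.conjTranspose_conjTranspose]
    exact hf.conjTranspose_mul_self
  · have h := hf.pauliOp_eq (g P)
    rw [Matrix.conjTranspose_conjTranspose]
    exact (congrArg (fun Q => Uᴴ * pauliOp Q * U) (hg P)).symm.trans h

end Implements

namespace Clifford

theorem implements {N : ℕ} (C : Clifford N) : Implements C.mat C.1 := Classical.choose_spec C.2

theorem ext {N : ℕ} {C D : Clifford N} (h : ∀ P, C.1 P = D.1 P) : C = D := Subtype.ext (funext h)

noncomputable instance (N : ℕ) : Mul (Clifford N) :=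
  ⟨fun C D => ⟨fun P => ((D.1 P).1 * (C.1 (D.1 P).2).1, (C.1 (D.1 P).2).2),
    _, C.implements.mul D.implements⟩⟩

noncomputable instance (N : ℕ) : One (Clifford N) := ⟨⟨fun P => (1, P), _, Implements.one⟩⟩

noncomputable instance (N : ℕ) : Inv (Clifford N) :=
  ⟨fun C => ⟨_, _, C.implements.exists_conjTranspose.choose_spec⟩⟩

theorem mul_val {N : ℕ} (C D : Clifford N) (P : PauliString N) :
    (C * D).1 P = ((D.1 P).1 * (C.1 (D.1 P).2).1, (C.1 (D.1 P).2).2) := rfl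

theorem one_val {N : ℕ} (P : PauliString N) : (1 : Clifford N).1 P = (1, P) := rfl

theorem implements_inv {N : ℕ} (C : Clifford N) : Implements C.matᴴ (C⁻¹).1 :=
  C.implements.exists_conjTranspose.choose_spec

/-- Associativity and the unit law are identities of actions; the inverse law holds because `Uᴴ * U`
and `1` are the same unitary and hence implement the same action. -/
noncomputable instance (N : ℕ) : Group (Clifford N) :=
  Group.ofLeftAxioms
    (fun A B C => ext fun P => by simp [mul_val, mul_assoc])
    (fun A => ext fun P => by simp [mul_val, one_val])
    (fun A => Subtype.ext <| by
      have h := A.implements_inv.mul A.implements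
      rw [A.implements.conjTranspose_mul_self] at h
      exact h.unique Implements.one)

/-- The signed Pauli string onto which a Clifford maps a Pauli string, as an operator. -/
theorem conj_pauliOp {N : ℕ} (C : Clifford N) (P : PauliString N) :
    C.mat * pauliOp P * C.matᴴ = (((C.1 P).1 : ℤ) : ℂ) • pauliOp (C.1 P).2 := C.implements.2 P

theorem label_injective {N : ℕ} (C : Clifford N) : Function.Injective fun P => (C.1 P).2 :=
  C.implements.bijective.1

theorem label_zero {N : ℕ} (C : Clifford N) : (C.1 0).2 = 0 := by
  have h := C.conj_pauliOp 0
  rw [pauliOp_zero, mul_one, C.implements.mul_conjTranspose_self, ← pauliOp_zero, ← one_smul ℂ (pauliOp 0)] at h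
  exact (smul_pauliOp_inj one_ne_zero h).1.symm

/-- Conjugation is multiplicative, and the phases drop out of the labels. This turns a collision of
two generators at the same time step into an event about their product. -/
theorem label_pmul {N : ℕ} (C : Clifford N) (P Q : PauliString N) :
    (C.1 (pmul P Q)).2 = pmul (C.1 P).2 (C.1 Q).2 := by
  have h : C.mat * (pauliOp P * pauliOp Q) * C.matᴴ
      = (C.mat * pauliOp P * C.matᴴ) * (C.mat * pauliOp Q * C.matᴴ) := by
    calc _ = C.mat * pauliOp P * 1 * pauliOp Q * C.matᴴ := by noncomm_ring
      _ = _ := by rw [← C.implements.conjTranspose_mul_self]; noncomm_ring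
  rw [pauliOp_mul, Matrix.mul_smul, Matrix.smul_mul, conj_pauliOp, conj_pauliOp, conj_pauliOp,
    smul_smul, Matrix.smul_mul, Matrix.mul_smul, pauliOp_mul, smul_smul, smul_smul] at h
  exact (smul_pauliOp_inj (mul_ne_zero (pphase_ne_zero _ _) (units_cast_ne_zero _)) h).1

/-- A unitary whose conjugation maps Pauli strings to multiples of Pauli strings is Clifford. -/
theorem exists_of_unitary {N : ℕ} {U : QOp N} (hU : U * Uᴴ = 1)
    (h : ∀ P, ∃ (c : ℂ) (Q : PauliString N), U * pauliOp P * Uᴴ = c • pauliOp Q) :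
    ∃ C : Clifford N, ∀ P (c : ℂ) Q, c ≠ 0 → U * pauliOp P * Uᴴ = c • pauliOp Q → (C.1 P).2 = Q ∧
      (((C.1 P).1 : ℤ) : ℂ) = c := by
  have hU' : Uᴴ * U = 1 := mul_eq_one_comm.1 hU
  have h2 : ∀ P, ∃ sQ : ℤˣ × PauliString N, U * pauliOp P * Uᴴ = ((sQ.1 : ℤ) : ℂ) • pauliOp sQ.2 := by
    intro P
    obtain ⟨c, Q, hc⟩ := h P
    -- Pauli strings are involutions, so the multiple squares to one and is a sign.
    have h3 : (U * pauliOp P * Uᴴ) * (U * pauliOp P * Uᴴ) = 1 := by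
      calc _ = U * pauliOp P * (Uᴴ * U) * pauliOp P * Uᴴ := by noncomm_ring
        _ = U * (pauliOp P * pauliOp P) * Uᴴ := by rw [hU']; noncomm_ring
        _ = 1 := by rw [pauliOp_mul_self, mul_one, hU]
    rw [hc, Matrix.smul_mul, Matrix.mul_smul, pauliOp_mul_self, smul_smul] at h3
    have h4 : c * c = 1 := by simpa using congrFun (congrFun h3 0) 0
    rcases mul_self_eq_one_iff.1 h4 with h5 | h5
    · exact ⟨(1, Q), by simpa [h5] using hc⟩
    · exact ⟨(-1, Q), by simpa [h5] using hc⟩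
  choose f hf using h2
  refine ⟨⟨f, U, Matrix.mem_unitaryGroup_iff.2 hU, hf⟩, fun P c Q hc hQ => ?_⟩
  obtain ⟨h6, h7⟩ := smul_pauliOp_inj hc (hQ.symm.trans (hf P))
  exact ⟨h6.symm, h7.symm⟩

theorem exists_pauli {N : ℕ} (R : PauliString N) :
    ∃ C : Clifford N, ∀ P, C.1 P = (csgn R P, P) := by
  have h1 : ∀ P, pauliOp R * pauliOp P * (pauliOp R)ᴴ = ((csgn R P : ℤ) : ℂ) • pauliOp P := by
    intro P
    rw [pauliOp_comm, pauliOp_conjTranspose, Matrix.smul_mul, mul_assoc, pauliOp_mul_self, mul_one]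
  obtain ⟨C, hC⟩ := exists_of_unitary (U := pauliOp R)
    (by rw [pauliOp_conjTranspose, pauliOp_mul_self]) fun P => ⟨_, _, h1 P⟩
  refine ⟨C, fun P => ?_⟩
  obtain ⟨h2, h3⟩ := hC P _ _ (units_cast_ne_zero _) (h1 P)
  exact Prod.ext (Units.ext (by exact_mod_cast h3)) h2

/-- For anticommuting `A`, `B` the operator `(A + B) / √2` is a Hermitian unitary that exchanges
them by conjugation. -/
theorem exists_map_of_anticommuting {N : ℕ} {A B : PauliString N} (h : csgn A B = -1) :
    ∃ C : Clifford N, (C.1 A).2 = B := by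
  set a := pauliOp A with ha
  set b := pauliOp B with hb
  have haa : a * a = 1 := pauliOp_mul_self A
  have hbb : b * b = 1 := pauliOp_mul_self B
  have hab : a * b = -(b * a) := by rw [ha, hb, pauliOp_comm, h]; simp
  set s : ℂ := ((Real.sqrt 2 : ℝ) : ℂ)⁻¹ with hs
  have hss : s * s = 2⁻¹ := by
    rw [hs, ← mul_inv, ← Complex.ofReal_mul, Real.mul_self_sqrt (by norm_num)]; norm_num
  have hst : star s = s := by
    rw [hs, star_inv₀]; congr 1; exact Complex.conj_ofReal _
  have hUh : (s • (a + b))ᴴ = s • (a + b) := by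
    rw [Matrix.conjTranspose_smul, Matrix.conjTranspose_add, pauliOp_conjTranspose,
      pauliOp_conjTranspose, hst]
  have key : ∀ r : QOp N, (s • (a + b)) * r * (s • (a + b))
      = (2 : ℂ)⁻¹ • (a * r * a + a * r * b + b * r * a + b * r * b) := by
    intro r
    rw [Matrix.smul_mul, Matrix.smul_mul, Matrix.mul_smul, smul_smul, hss]
    congr 1; noncomm_ring
  have two : ∀ M : QOp N, (2 : ℂ)⁻¹ • (M + M) = M := fun M => by
    rw [← two_smul ℂ M, smul_smul]; norm_num
  have hmain : ∀ P, ∃ (c : ℂ) (Q : PauliString N),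
      (s • (a + b)) * pauliOp P * (s • (a + b))ᴴ = c • pauliOp Q := by
    intro P
    set r := pauliOp P with hr
    have hA : a * r = ((csgn A P : ℤ) : ℂ) • (r * a) := pauliOp_comm A P
    have hB : b * r = ((csgn B P : ℤ) : ℂ) • (r * b) := pauliOp_comm B P
    have hrab : r * a * b = (pphase P A * pphase (pmul P A) B) • pauliOp (pmul (pmul P A) B) := by
      rw [hr, ha, hb, pauliOp_mul, Matrix.smul_mul, pauliOp_mul, smul_smul]
    have e1 : r * a * a = r := by rw [mul_assoc, haa, mul_one]
    have e2 : r * b * b = r := by rw [mul_assoc, hbb, mul_one]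
    have e3 : r * b * a = -(r * a * b) := by rw [mul_assoc, mul_assoc, hab, mul_neg, neg_neg]
    rw [hUh, key, hA, hB]
    simp only [Matrix.smul_mul, e1, e2, e3]
    -- A string commuting with both `A` and `B` is fixed, one anticommuting with both changes sign,
    -- and in the two mixed cases the image is proportional to the product of `P`, `A` and `B`.
    rcases Int.units_eq_one_or (csgn A P) with h1 | h1 <;>
      rcases Int.units_eq_one_or (csgn B P) with h2 | h2 <;> rw [h1, h2]
    · refine ⟨1, P, ?_⟩
      rw [one_smul, ← hr]
      conv_rhs => rw [← two r]
      congr 1; push_cast; module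
    · refine ⟨_, _, Eq.trans ?_ hrab⟩
      conv_rhs => rw [← two (r * a * b)]
      congr 1; push_cast; module
    · refine ⟨-(pphase P A * pphase (pmul P A) B), _, Eq.trans ?_ ((congrArg Neg.neg hrab).trans (neg_smul _ _).symm)⟩
      conv_rhs => rw [← two (-(r * a * b))]
      congr 1; push_cast; module
    · refine ⟨-1, P, ?_⟩
      rw [neg_smul, one_smul, ← hr]
      conv_rhs => rw [← two (-r)]
      congr 1; push_cast; module
  obtain ⟨C, hC⟩ := exists_of_unitary (U := s • (a + b)) (by
    have h1 := key 1
    rw [mul_one] at h1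
    rw [hUh, h1]
    simp only [mul_one, haa, hbb, hab]
    conv_rhs => rw [← two 1]
    congr 1; abel) hmain
  refine ⟨C, (hC A 1 B one_ne_zero ?_).1⟩
  rw [hUh, key, one_smul, ← ha, ← hb]
  have e : b * a * b = -a := by rw [mul_assoc, hab, mul_neg, ← mul_assoc, hbb, one_mul]
  rw [e, mul_assoc b a a, haa, one_mul, one_mul, mul_one]
  conv_rhs => rw [← two b]
  congr 1; abel

/-- Pass through a string that anticommutes with both. -/
theorem exists_map {N : ℕ} {A B : PauliString N} (hA : A ≠ 0) (hB : B ≠ 0) :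
    ∃ C : Clifford N, (C.1 A).2 = B := by
  obtain ⟨R, hRA, hRB⟩ := exists_anticommuting_both hA hB
  obtain ⟨C, hC⟩ := exists_map_of_anticommuting ((csgn_comm A R).trans hRA)
  obtain ⟨D, hD⟩ := exists_map_of_anticommuting hRB
  exact ⟨D * C, by rw [mul_val, hC, hD]⟩

/-! ### Averages over the Clifford group -/

/-- By transitivity and translation invariance the sum over the group does not depend on the
non-identity string `P`. Summing over all such strings, each group element merely permutes them; so
the image of `P` is uniform. -/
theorem sum_label {N : ℕ} {P : PauliString N} (hP : P ≠ 0) (F : PauliString N → ℝ) :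
    ((4 : ℝ) ^ N - 1) * ∑ g : Clifford N, F (g.1 P).2
      = Fintype.card (Clifford N) * ∑ A ∈ Finset.univ.erase 0, F A := by
  classical
  have hconst : ∀ A ∈ Finset.univ.erase (0 : PauliString N),
      ∑ g : Clifford N, F (g.1 A).2 = ∑ g : Clifford N, F (g.1 P).2 := by
    intro A hA
    obtain ⟨C, hC⟩ := exists_map hP (Finset.ne_of_mem_erase hA)
    rw [← Equiv.sum_comp (Equiv.mulRight C) fun g : Clifford N => F (g.1 P).2]
    simp [mul_val, hC]
  have hperm : ∀ g : Clifford N, ∑ A ∈ Finset.univ.erase (0 : PauliString N), F (g.1 A).2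
      = ∑ A ∈ Finset.univ.erase 0, F A := by
    intro g
    have h1 := Finset.add_sum_erase Finset.univ (fun A => F (g.1 A).2) (Finset.mem_univ 0)
    have h2 := Finset.add_sum_erase Finset.univ F (Finset.mem_univ 0)
    have h3 := Equiv.sum_comp (Equiv.ofBijective _ g.implements.bijective) F
    simp only [Equiv.ofBijective_apply] at h3
    simp only [label_zero] at h1
    linarith
  have h1 := Finset.sum_congr rfl hconst
  rw [Finset.sum_comm, Finset.sum_const, Finset.sum_congr rfl fun g _ => hperm g,
    Finset.sum_const, Finset.card_erase_of_mem (Finset.mem_univ _), nsmul_eq_mul, nsmul_eq_mul,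
    Finset.card_univ, Finset.card_univ] at h1
  rw [h1, Nat.cast_sub Fintype.card_pos]
  simp

/-- Right translation by a Pauli string anticommuting with `P` reverses the sign of every term, so
the sum equals its own negative. -/
theorem sum_conj_pauliOp {N : ℕ} {P : PauliString N} (hP : P ≠ 0) :
    ∑ g : Clifford N, g.mat * pauliOp P * g.matᴴ = 0 := by
  obtain ⟨R, hR⟩ := exists_anticommuting hP
  obtain ⟨C, hC⟩ := exists_pauli R
  simp only [conj_pauliOp]
  have h := Equiv.sum_comp (Equiv.mulRight C)
    fun g : Clifford N => (((g.1 P).1 : ℤ) : ℂ) • pauliOp (g.1 P).2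
  simp only [Equiv.coe_mulRight, mul_val, hC, hR] at h
  push_cast at h
  simp only [neg_mul, one_mul, neg_smul, Finset.sum_neg_distrib] at h
  set M := ∑ g : Clifford N, (((g.1 P).1 : ℤ) : ℂ) • pauliOp (g.1 P).2
  have h2 : (2 : ℂ) • M = 0 := by rw [two_smul]; nth_rewrite 1 [← h]; exact neg_add_cancel M
  exact (smul_eq_zero.1 h2).resolve_left two_ne_zero

/-- The twirl projects onto scalars: it is linear, fixes the identity and kills every other Pauli
string. -/
theorem sum_conj {N : ℕ} (A : QOp N) :
    ∑ g : Clifford N, g.mat * A * g.matᴴ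
      = (Fintype.card (Clifford N) * (A.trace / 2 ^ N) : ℂ) • 1 := by
  have hA : A ∈ Submodule.span ℂ (Set.range (pauliOp : PauliString N → QOp N)) := by
    rw [span_pauliOp]; trivial
  induction hA using Submodule.span_induction with
  | mem x hx =>
    obtain ⟨P, rfl⟩ := hx
    by_cases hP : P = 0
    · subst hP
      rw [trace_pauliOp, if_pos rfl, div_self (pow_ne_zero _ two_ne_zero), pauliOp_zero]
      simp only [mul_one, fun g : Clifford N => g.implements.mul_conjTranspose_self]
      simp [Finset.card_univ, Nat.cast_smul_eq_nsmul]
    · rw [sum_conj_pauliOp hP, trace_pauliOp, if_neg hP]; simp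
  | zero => simp
  | add x y _ _ hx hy =>
    simp only [Matrix.mul_add, Matrix.add_mul, Finset.sum_add_distrib, hx, hy, Matrix.trace_add]
    rw [← add_smul]; congr 1; ring
  | smul c x _ hx =>
    simp only [Matrix.mul_smul, Matrix.smul_mul, ← Finset.smul_sum, hx, Matrix.trace_smul]
    rw [smul_smul]; congr 1; simp only [smul_eq_mul]; ring

end Clifford

/-! ## Pulled-back generators -/

theorem circuitPrefix_succ {N T : ℕ} (C : Circuit N T) {k : ℕ} (h : k < T) :
    circuitPrefix C (k + 1) = (C ⟨k, h⟩).mat * circuitPrefix C k := by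
  rw [circuitPrefix, dif_pos h]

/-- The product of the first `k` Cliffords of a circuit, in the Clifford group modulo phase. -/
noncomputable def prefixProd {N T : ℕ} (C : Circuit N T) : ℕ → Clifford N
  | 0 => 1
  | k + 1 => if h : k < T then C ⟨k, h⟩ * prefixProd C k else prefixProd C k

theorem implements_circuitPrefix {N T : ℕ} (C : Circuit N T) (k : ℕ) :
    Implements (circuitPrefix C k) (prefixProd C k).1 := by
  induction k with
  | zero => exact Implements.one
  | succ k ih =>
    by_cases h : k < T
    · rw [circuitPrefix, prefixProd, dif_pos h, dif_pos h]
      exact (C ⟨k, h⟩).implements.mul ih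
    · rwa [circuitPrefix, prefixProd, dif_neg h, dif_neg h]

/-- The Cliffords `(C_t ⋯ C_1)⁻¹` that pull the signal generators back to the beginning. -/
noncomputable def pullbacks {N T : ℕ} (C : Circuit N T) (t : Fin T) : Clifford N :=
  (prefixProd C (t + 1))⁻¹

/-- The pull-backs determine all prefixes `C_t ⋯ C_1`, and consecutive prefixes determine each
Clifford by cancellation. By finiteness this gives a bijection, so uniform circuits have independent
uniform pull-backs. -/
theorem pullbacks_injective (N T : ℕ) :
    Function.Injective (pullbacks : Circuit N T → Fin T → Clifford N) := by
  intro C D h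
  have h1 : ∀ k, k ≤ T → prefixProd C k = prefixProd D k := by
    intro k hk
    cases k with
    | zero => rfl
    | succ k => exact inv_injective (congrFun h ⟨k, hk⟩)
  funext t
  have h2 := h1 (t + 1) t.2
  rw [prefixProd, prefixProd, dif_pos t.2, dif_pos t.2, h1 t t.2.le] at h2
  exact mul_right_cancel h2

/-- Circuits correspond to the families of their pull-back Cliffords. -/
noncomputable def pullbackEquiv (N T : ℕ) : Circuit N T ≃ (Fin T → Clifford N) :=
  Equiv.ofBijective pullbacks (Finite.injective_iff_bijective.1 (pullbacks_injective N T))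

/-- The image of a Pauli string under a Clifford, with its sign. -/
noncomputable def signedPauli {N : ℕ} (g : Clifford N) (P : PauliString N) : QOp N :=
  (((g.1 P).1 : ℤ) : ℂ) • pauliOp (g.1 P).2

theorem signedPauli_eq_conj {N : ℕ} (g : Clifford N) (P : PauliString N) :
    signedPauli g P = g.mat * pauliOp P * g.matᴴ := (g.conj_pauliOp P).symm

theorem pulledBack_eq {N T : ℕ} (C : Circuit N T) (P : PauliString N) (t : Fin T) :
    pulledBack C P t = signedPauli (pullbacks C t) P := by
  set D := prefixProd C (t + 1) with hD
  have hU := implements_circuitPrefix C (t + 1)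
  have h1 : D.1 ((pullbacks C t).1 P).2 = (((pullbacks C t).1 P).1, P) := by
    have h2 : D * pullbacks C t = 1 := mul_inv_cancel D
    have h3 : (D * pullbacks C t).1 P = (1, P) := by rw [h2]; rfl
    rw [Clifford.mul_val] at h3
    have h4 := congrArg Prod.fst h3
    have h5 := congrArg Prod.snd h3
    refine Prod.ext ?_ h5
    dsimp only at h4 ⊢
    rw [← mul_right_inj ((pullbacks C t).1 P).1, h4, Int.units_mul_self]
  have h6 := hU.pauliOp_eq ((pullbacks C t).1 P).2
  rw [← hD, h1] at h6
  exact h6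

theorem signedPauli_conjTranspose {N : ℕ} (g : Clifford N) (P : PauliString N) :
    (signedPauli g P)ᴴ = signedPauli g P := by
  rw [signedPauli, Matrix.conjTranspose_smul, pauliOp_conjTranspose]
  congr 1
  simp

theorem signedPauli_mul_self {N : ℕ} (g : Clifford N) (P : PauliString N) :
    signedPauli g P * signedPauli g P = 1 := by
  rw [signedPauli, Matrix.smul_mul, Matrix.mul_smul, smul_smul, units_cast_mul_self, one_smul,
    pauliOp_mul_self]

/-! ## Action on the all-zero state -/

/-- The bit that a Pauli matrix flips. -/
def flip1 : Fin 4 → Fin 2 := ![0, 1, 1, 0]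

/-- The phase with which a Pauli matrix acts on `|0⟩`. -/
noncomputable def zphase1 : Fin 4 → ℂ := ![1, 1, Complex.I, 1]

/-- The bits that a Pauli string flips. -/
def flips {N : ℕ} (P : PauliString N) : Bits N := fun i => flip1 (P i)

/-- The phase with which a Pauli string acts on `|0⟩`. -/
noncomputable def zphase {N : ℕ} (P : PauliString N) : ℂ := ∏ i, zphase1 (P i)

theorem pauliOp_apply_zero {N : ℕ} (P : PauliString N) (z : Bits N) :
    pauliOp P z 0 = if z = flips P then zphase P else 0 := by
  have h1 : ∀ p x, pauli1 p x 0 = if x = flip1 p then zphase1 p else 0 := by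
    intro p x
    fin_cases p <;> fin_cases x <;> simp [pauli1, flip1, zphase1]
  change ∏ i, pauli1 (P i) (z i) 0 = _
  simp only [h1]
  by_cases h : z = flips P
  · rw [if_pos h]
    exact Finset.prod_congr rfl fun i _ => if_pos (congrFun h i)
  · rw [if_neg h]
    obtain ⟨i, hi⟩ := Function.ne_iff.1 h
    exact Finset.prod_eq_zero (Finset.mem_univ i) (if_neg hi)

/-- The parity of the number of `Y`s, as a sign. -/
noncomputable def ysgn {N : ℕ} (P : PauliString N) : ℝ := ∏ i, if P i = 2 then -1 else 1

/-- The imaginary part of the phase `i ^ #Y`. -/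
noncomputable def ycoef {N : ℕ} (P : PauliString N) : ℝ := (zphase P).im

/-- The phase `i ^ #Y` has modulus one and square `(-1) ^ #Y`. The square is thus the indicator of
an odd number of `Y`s, and being affine in a product over the qubits, it is easy to sum. -/
theorem ycoef_sq {N : ℕ} (P : PauliString N) : ycoef P ^ 2 = (1 - ysgn P) / 2 := by
  have h1 : zphase P ^ 2 = (ysgn P : ℂ) := by
    rw [zphase, ysgn, ← Finset.prod_pow, Complex.ofReal_prod]
    refine Finset.prod_congr rfl fun i _ => ?_
    generalize P i = p
    fin_cases p <;> simp [zphase1]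
  have h2 : Complex.normSq (zphase P) = 1 := by
    rw [zphase, map_prod]
    refine Finset.prod_eq_one fun i _ => ?_
    generalize P i = p
    fin_cases p <;> simp [zphase1]
  have h3 := congrArg Complex.re h1
  rw [Complex.normSq_apply] at h2
  simp only [sq, Complex.mul_re, Complex.ofReal_re] at h3
  rw [ycoef]
  nlinarith

theorem ysgn_eq_one_or {N : ℕ} (P : PauliString N) : ysgn P = 1 ∨ ysgn P = -1 := by
  refine Finset.prod_induction _ (fun x : ℝ => x = 1 ∨ x = -1) ?_ (Or.inl rfl) ?_
  · rintro a b (rfl | rfl) (rfl | rfl) <;> norm_num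
  · intro i _
    split_ifs <;> simp

theorem ycoef_sq_eq_zero_or {N : ℕ} (P : PauliString N) : ycoef P ^ 2 = 0 ∨ ycoef P ^ 2 = 1 := by
  rw [ycoef_sq]
  rcases ysgn_eq_one_or P with h | h <;> rw [h] <;> norm_num

theorem ycoef_eq_zero_of_flips {N : ℕ} {P : PauliString N} (h : flips P = 0) : ycoef P = 0 := by
  have h1 : ysgn P = 1 := by
    refine Finset.prod_eq_one fun i _ => if_neg fun h2 => ?_
    have h3 := congrFun h i
    simp [flips, h2, flip1] at h3
  have h2 := ycoef_sq P
  rw [h1] at h2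
  nlinarith

theorem norm_zphase {N : ℕ} (P : PauliString N) : ‖zphase P‖ = 1 := by
  rw [zphase, norm_prod]
  refine Finset.prod_eq_one fun i _ => ?_
  generalize P i = p
  fin_cases p <;> simp [zphase1]

theorem flips_pmul {N : ℕ} (P Q : PauliString N) : flips (pmul P Q) = flips P + flips Q := by
  have h : ∀ p q, flip1 (pmul1 p q) = flip1 p + flip1 q := by decide
  exact funext fun i => h _ _

/-! ## Characters of bitstrings -/

/-- The sign `(-1) ^ (x · z)`. -/
noncomputable def chi {N : ℕ} (x z : Bits N) : ℝ :=
  ∏ i, if x i = 1 ∧ z i = 1 then -1 else 1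

theorem chi_eq_one_or {N : ℕ} (x z : Bits N) : chi x z = 1 ∨ chi x z = -1 := by
  refine Finset.prod_induction _ (fun x : ℝ => x = 1 ∨ x = -1) ?_ (Or.inl rfl) ?_
  · rintro a b (rfl | rfl) (rfl | rfl) <;> norm_num
  · intro i _
    split_ifs <;> simp

theorem chi_zero {N : ℕ} (z : Bits N) : chi 0 z = 1 := by simp [chi]

theorem sum_chi_mul_chi {N : ℕ} (x y : Bits N) :
    ∑ z, chi x z * chi y z = if x = y then 2 ^ N else 0 := by
  simp only [chi, ← Finset.prod_mul_distrib]
  rw [sum_bits_prod fun i c => (if x i = 1 ∧ c = 1 then (-1 : ℝ) else 1) *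
    (if y i = 1 ∧ c = 1 then -1 else 1)]
  have h : ∀ a b : Fin 2, ((if a = 1 ∧ (0 : Fin 2) = 1 then (-1 : ℝ) else 1) *
      (if b = 1 ∧ (0 : Fin 2) = 1 then -1 else 1) + (if a = 1 ∧ (1 : Fin 2) = 1 then (-1 : ℝ) else 1) *
      (if b = 1 ∧ (1 : Fin 2) = 1 then -1 else 1)) = if a = b then 2 else 0 := by
    intro a b
    fin_cases a <;> fin_cases b <;> norm_num
  rw [Finset.prod_congr rfl fun i _ => h (x i) (y i)]
  by_cases hxy : x = y
  · simp [hxy]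
  · rw [if_neg hxy]
    obtain ⟨i, hi⟩ := Function.ne_iff.1 hxy
    exact Finset.prod_eq_zero (Finset.mem_univ i) (if_neg hi)

theorem hadamardOp_apply {N : ℕ} (z x : Bits N) :
    hadamardOp N z x = (((Real.sqrt 2)⁻¹ ^ N * chi x z : ℝ) : ℂ) := by
  have h : ∀ a b, hadamard1 a b
      = (((Real.sqrt 2)⁻¹ * if b = 1 ∧ a = 1 then -1 else 1 : ℝ) : ℂ) := by
    intro a b
    fin_cases a <;> fin_cases b <;> simp [hadamard1]
  change ∏ i, hadamard1 (z i) (x i) = _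
  simp only [h, chi]
  rw [← Complex.ofReal_prod, Finset.prod_mul_distrib]
  simp

theorem sqrt_two_inv_pow_mul_self (N : ℕ) :
    (Real.sqrt 2)⁻¹ ^ N * (Real.sqrt 2)⁻¹ ^ N = ((2 : ℝ) ^ N)⁻¹ := by
  rw [← mul_pow, ← mul_inv, Real.mul_self_sqrt (by norm_num), inv_pow]

/-- The response of the x-basis distribution to the generator `P`, in units of `2 / 2 ^ N`. -/
noncomputable def resp {N : ℕ} (g : Clifford N) (P : PauliString N) (z : Bits N) : ℝ :=
  ((g.1 P).1 : ℤ) * ycoef (g.1 P).2 * chi (flips (g.1 P).2) z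

theorem signedPauli_apply_zero {N : ℕ} (g : Clifford N) (P : PauliString N) (z : Bits N) :
    signedPauli g P z 0
      = if z = flips (g.1 P).2 then (((g.1 P).1 : ℤ) : ℂ) * zphase (g.1 P).2 else 0 := by
  rw [signedPauli, Matrix.smul_apply, pauliOp_apply_zero, smul_eq_mul]
  split_ifs <;> simp

/-- The Hadamard layer turns the flipped basis state into a real character, each of the two Hadamard
entries contributing `2 ^ (-N/2)`; only the phase of the Pauli string has an imaginary part. -/
theorem deltaP_eq {N T : ℕ} (C : Circuit N T) (P : PauliString N) (t : Fin T) (z : Bits N) :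
    deltaP C P t z = 2 / 2 ^ N * resp (pullbacks C t) P z := by
  rw [deltaP, pulledBack_eq, Matrix.mul_apply]
  simp only [signedPauli_apply_zero, mul_ite, mul_zero, Finset.sum_ite_eq', Finset.mem_univ, if_true]
  set A := ((pullbacks C t).1 P).2
  rw [hadamardOp_apply, hadamardOp_apply]
  have h0 : chi z 0 = 1 := by simp [chi]
  rw [h0, resp, ycoef]
  set s := ((pullbacks C t).1 P).1
  have h1 : (((Real.sqrt 2)⁻¹ ^ N * chi (flips A) z : ℝ) : ℂ) * (((s : ℤ) : ℂ) * zphase A) *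
      (((Real.sqrt 2)⁻¹ ^ N * 1 : ℝ) : ℂ) = (((Real.sqrt 2)⁻¹ ^ N * (Real.sqrt 2)⁻¹ ^ N *
        ((s : ℤ) : ℝ) * chi (flips A) z : ℝ) : ℂ) * zphase A := by
    push_cast; ring
  rw [h1, Complex.im_ofReal_mul, sqrt_two_inv_pow_mul_self]
  change _ = 2 / 2 ^ N * (((s : ℤ) : ℝ) * (zphase A).im * chi (flips A) z)
  ring

theorem kernelK_eq {N T : ℕ} (C : Circuit N T) (Q : PauliString N) (t : Fin T) (z : Bits N) :
    kernelK C Q t z = if z = flips ((pullbacks C t).1 Q).2 then 1 else 0 := by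
  rw [kernelK, pulledBack_eq, signedPauli_apply_zero]
  split_ifs
  · rw [norm_mul, norm_zphase]
    rcases Int.units_eq_one_or ((pullbacks C t).1 Q).1 with h | h <;> rw [h] <;> simp
  · simp

/-- The bound `ycoef ^ 2` instead of `1` keeps the information that an invisible generator has no
response at all. -/
theorem abs_resp_le {N : ℕ} (g : Clifford N) (P : PauliString N) (z : Bits N) :
    |resp g P z| ≤ ycoef (g.1 P).2 ^ 2 := by
  have h1 : |(((g.1 P).1 : ℤ) : ℝ)| = 1 := by
    rcases Int.units_eq_one_or (g.1 P).1 with h | h <;> rw [h] <;> simp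
  have h2 : |chi (flips (g.1 P).2) z| = 1 := by
    rcases chi_eq_one_or (flips (g.1 P).2) z with h | h <;> rw [h] <;> simp
  rw [resp, abs_mul, abs_mul, h1, h2, one_mul, mul_one]
  rcases ycoef_sq_eq_zero_or (g.1 P).2 with h | h
  · rw [h, pow_eq_zero_iff two_ne_zero |>.1 h, abs_zero]
  · rw [h]; exact (sq_le_one_iff_abs_le_one _).1 h.le

/-- A nontrivial character sums to zero; the trivial one occurs only without `X` and `Y`, and then
the coefficient vanishes. -/
theorem sum_resp {N : ℕ} (g : Clifford N) (P : PauliString N) : ∑ z, resp g P z = 0 := by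
  simp only [resp, ← Finset.mul_sum]
  by_cases h : flips (g.1 P).2 = 0
  · rw [ycoef_eq_zero_of_flips h]; simp
  · have h1 := sum_chi_mul_chi (flips (g.1 P).2) 0
    simp only [chi_zero, mul_one, if_neg h] at h1
    rw [h1, mul_zero]

theorem sum_resp_mul_self {N : ℕ} (g : Clifford N) (P : PauliString N) :
    ∑ z, resp g P z * resp g P z = 2 ^ N * ycoef (g.1 P).2 ^ 2 := by
  have h1 : (((g.1 P).1 : ℤ) : ℝ) * (((g.1 P).1 : ℤ) : ℝ) = 1 := by
    rcases Int.units_eq_one_or (g.1 P).1 with h | h <;> rw [h] <;> simp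
  have h2 : ∀ z, resp g P z * resp g P z = ycoef (g.1 P).2 ^ 2 *
      (chi (flips (g.1 P).2) z * chi (flips (g.1 P).2) z) := fun z => by
    rw [resp]; linear_combination ycoef (g.1 P).2 ^ 2 *
      (chi (flips (g.1 P).2) z * chi (flips (g.1 P).2) z) * h1
  simp only [h2]
  rw [← Finset.mul_sum, sum_chi_mul_chi, if_pos rfl, mul_comm]

theorem sum_resp_mul_resp {N : ℕ} {g h : Clifford N} {P Q : PauliString N}
    (hne : flips (g.1 P).2 ≠ flips (h.1 Q).2) : ∑ z, resp g P z * resp h Q z = 0 := by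
  have h2 : ∀ z, resp g P z * resp h Q z = (((g.1 P).1 : ℤ) * ycoef (g.1 P).2 *
      (((h.1 Q).1 : ℤ) * ycoef (h.1 Q).2)) *
      (chi (flips (g.1 P).2) z * chi (flips (h.1 Q).2) z) := fun z => by
    rw [resp, resp]; ring
  simp only [h2]
  rw [← Finset.mul_sum, sum_chi_mul_chi, if_neg hne, mul_zero]

/-! ## Finite probability -/

open Classical in
/-- The probability of the event `E` for the weights `w`. -/
noncomputable def pr {Ω : Type*} [Fintype Ω] (w : Ω → ℝ) (E : Ω → Prop) : ℝ :=
  ∑ ω, w ω * if E ω then 1 else 0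

/-- The uniform weights on a finite type. -/
noncomputable def unif (Ω : Type*) [Fintype Ω] : Ω → ℝ := fun _ => (Fintype.card Ω : ℝ)⁻¹

theorem sum_unif (Ω : Type*) [Fintype Ω] [Nonempty Ω] : ∑ ω, unif Ω ω = 1 := by
  simp [unif, Finset.card_univ]

theorem unif_nonneg {Ω : Type*} [Fintype Ω] (ω : Ω) : 0 ≤ unif Ω ω := by
  rw [unif]; positivity

section pr

variable {Ω : Type*} [Fintype Ω] {w : Ω → ℝ}

theorem pr_mono (hw : ∀ ω, 0 ≤ w ω) {E F : Ω → Prop} (h : ∀ ω, E ω → F ω) : pr w E ≤ pr w F := by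
  classical
  refine Finset.sum_le_sum fun ω _ => mul_le_mul_of_nonneg_left ?_ (hw ω)
  by_cases hE : E ω
  · simp [hE, h ω hE]
  · rw [if_neg hE]; split_ifs <;> norm_num

theorem pr_or_le (hw : ∀ ω, 0 ≤ w ω) (E F : Ω → Prop) :
    pr w (fun ω => E ω ∨ F ω) ≤ pr w E + pr w F := by
  classical
  rw [pr, pr, pr, ← Finset.sum_add_distrib]
  refine Finset.sum_le_sum fun ω _ => ?_
  rw [← mul_add]
  refine mul_le_mul_of_nonneg_left ?_ (hw ω)
  by_cases hE : E ω <;> by_cases hF : F ω <;> simp [hE, hF]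

theorem pr_exists_le {ι : Type*} [Fintype ι] (hw : ∀ ω, 0 ≤ w ω) (E : ι → Ω → Prop) :
    pr w (fun ω => ∃ i, E i ω) ≤ ∑ i, pr w (E i) := by
  classical
  simp only [pr]
  rw [Finset.sum_comm]
  refine Finset.sum_le_sum fun ω _ => ?_
  rw [← Finset.mul_sum]
  refine mul_le_mul_of_nonneg_left ?_ (hw ω)
  split_ifs with h
  · obtain ⟨i, hi⟩ := h
    have h1 := Finset.single_le_sum (f := fun i => if E i ω then (1 : ℝ) else 0)
      (fun i _ => by split_ifs <;> norm_num) (Finset.mem_univ i)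
    simpa [hi] using h1
  · exact Finset.sum_nonneg fun i _ => by split_ifs <;> norm_num

theorem pr_add_pr_not (hw : ∑ ω, w ω = 1) (E : Ω → Prop) : pr w E + pr w (fun ω => ¬ E ω) = 1 := by
  rw [pr, pr, ← Finset.sum_add_distrib]
  refine Eq.trans ?_ hw
  refine Finset.sum_congr rfl fun ω _ => ?_
  by_cases h : E ω <;> simp [h]

theorem pr_comp_equiv {Ω' : Type*} [Fintype Ω'] (e : Ω' ≃ Ω) (E : Ω → Prop) :
    pr (fun ω => w (e ω)) (fun ω => E (e ω)) = pr w E := by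
  classical
  exact Equiv.sum_comp e fun ω => w ω * if E ω then 1 else 0

end pr

/-- The product of a family of weights. -/
noncomputable def prodWeight {ι Ω : Type*} [Fintype ι] (w : ι → Ω → ℝ) (ω : ι → Ω) : ℝ :=
  ∏ i, w i (ω i)

theorem prodWeight_nonneg {ι Ω : Type*} [Fintype ι] {w : ι → Ω → ℝ} (hw : ∀ i ω, 0 ≤ w i ω)
    (ω : ι → Ω) : 0 ≤ prodWeight w ω :=
  Finset.prod_nonneg fun i _ => hw i _

section prodWeight

variable {ι Ω : Type*} [Fintype ι] [DecidableEq ι] [Fintype Ω] {w : ι → Ω → ℝ}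

theorem sum_prodWeight_mul (F : ι → Ω → ℝ) :
    ∑ ω, prodWeight w ω * ∏ i, F i (ω i) = ∏ i, ∑ x, w i x * F i x := by
  have h := Finset.prod_univ_sum (fun _ : ι => (Finset.univ : Finset Ω)) fun i x => w i x * F i x
  rw [Fintype.piFinset_univ] at h
  rw [h]
  exact Finset.sum_congr rfl fun ω _ => by rw [prodWeight, ← Finset.prod_mul_distrib]

theorem sum_prodWeight (hw : ∀ i, ∑ x, w i x = 1) : ∑ ω, prodWeight w ω = 1 := by
  have h := sum_prodWeight_mul (w := w) fun _ _ => 1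
  simpa [hw] using h

theorem pr_prodWeight_apply (hw : ∀ i, ∑ x, w i x = 1) (i : ι) (E : Ω → Prop) :
    pr (prodWeight w) (fun ω => E (ω i)) = pr (w i) E := by
  classical
  have h := sum_prodWeight_mul (w := w) fun j x => if j = i then (if E x then 1 else 0) else 1
  simp only [Finset.prod_ite_eq', Finset.mem_univ, if_true] at h
  rw [pr, h, ← Finset.mul_prod_erase _ _ (Finset.mem_univ i), Finset.prod_eq_one]
  · simp [pr]
  · intro j hj
    simp [Finset.ne_of_mem_erase hj, hw]

theorem exp_le_one_add_add_sq {y : ℝ} (hy : |y| ≤ 1) : Real.exp y ≤ 1 + y + y ^ 2 := by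
  have := (abs_le.1 (Real.abs_exp_sub_one_sub_id_le hy)).2
  linarith

/-- Chernoff's bound for independent variables in `[-1, 1]` of nonpositive mean. -/
theorem pr_sum_ge_le (hw0 : ∀ i x, 0 ≤ w i x) (hw : ∀ i, ∑ x, w i x = 1) (X : ι → Ω → ℝ)
    (hX : ∀ i x, |X i x| ≤ 1) (hmean : ∀ i, ∑ x, w i x * X i x ≤ 0) {η : ℝ} (h0 : 0 ≤ η)
    (h2 : η ≤ 2) :
    pr (prodWeight w) (fun ω => Fintype.card ι * η ≤ ∑ i, X i (ω i))
      ≤ Real.exp (-(Fintype.card ι * η ^ 2 / 4)) := by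
  classical
  -- The minimiser of `l² - l η`; the hypothesis `η ≤ 2` gives `l ≤ 1`, as the quadratic bound on
  -- the exponential requires.
  set l := η / 2 with hl
  have h1 : ∀ i, ∑ x, w i x * Real.exp (l * X i x) ≤ Real.exp (l ^ 2) := by
    intro i
    have h3 : ∀ x, w i x * Real.exp (l * X i x) ≤ w i x + l * (w i x * X i x) + w i x * l ^ 2 := by
      intro x
      have h4 : |l * X i x| ≤ 1 := by
        rw [abs_mul, abs_of_nonneg (by positivity : 0 ≤ l)]
        exact mul_le_one₀ (by linarith) (abs_nonneg _) (hX i x)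
      have h5 : (l * X i x) ^ 2 ≤ l ^ 2 := by
        rw [mul_pow]
        exact mul_le_of_le_one_right (sq_nonneg _) ((sq_le_one_iff_abs_le_one _).2 (hX i x))
      have h6 := mul_le_mul_of_nonneg_left
        ((exp_le_one_add_add_sq h4).trans (add_le_add_right h5 _)) (hw0 i x)
      linarith
    refine (Finset.sum_le_sum fun x _ => h3 x).trans ?_
    rw [Finset.sum_add_distrib, Finset.sum_add_distrib, hw, ← Finset.mul_sum, ← Finset.sum_mul, hw]
    have h7 : l * ∑ x, w i x * X i x ≤ 0 := mul_nonpos_of_nonneg_of_nonpos (by positivity) (hmean i)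
    linarith [Real.add_one_le_exp (l ^ 2)]
  have h8 : pr (prodWeight w) (fun ω => Fintype.card ι * η ≤ ∑ i, X i (ω i))
      ≤ ∑ ω, prodWeight w ω * (Real.exp (-(l * (Fintype.card ι * η))) *
        ∏ i, Real.exp (l * X i (ω i))) := by
    refine Finset.sum_le_sum fun ω _ => mul_le_mul_of_nonneg_left ?_ (prodWeight_nonneg hw0 ω)
    rw [← Real.exp_sum, ← Real.exp_add, ← Finset.mul_sum]
    split_ifs with h
    · apply Real.one_le_exp
      have := mul_le_mul_of_nonneg_left h (by positivity : 0 ≤ l)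
      linarith
    · positivity
  refine h8.trans ?_
  have h9 : ∑ ω, prodWeight w ω * (Real.exp (-(l * (Fintype.card ι * η))) *
        ∏ i, Real.exp (l * X i (ω i))) = Real.exp (-(l * (Fintype.card ι * η))) *
          ∏ i, ∑ x, w i x * Real.exp (l * X i x) := by
    rw [← sum_prodWeight_mul fun i x => Real.exp (l * X i x), Finset.mul_sum]
    exact Finset.sum_congr rfl fun _ _ => by ring
  have h10 : ∏ i, ∑ x, w i x * Real.exp (l * X i x) ≤ ∏ _i : ι, Real.exp (l ^ 2) :=
    Finset.prod_le_prod (fun i _ => Finset.sum_nonneg fun x _ =>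
      mul_nonneg (hw0 i x) (Real.exp_pos _).le) fun i _ => h1 i
  rw [h9]
  refine (mul_le_mul_of_nonneg_left h10 (Real.exp_pos _).le).trans ?_
  rw [Finset.prod_const, ← Real.exp_nat_mul, ← Real.exp_add, Finset.card_univ]
  apply le_of_eq
  congr 1
  rw [hl]; ring

end prodWeight

/-! ## Random pull-backs -/

/-- Exchanging the coordinate `G t` with an independent copy `g` is an involution of the pairs `(G,
g)` that leaves `f` unchanged. This is the independence of one coordinate from the others. -/
theorem sum_eval_mul_card {ι α β : Type*} [Fintype ι] [DecidableEq ι] [Fintype α] (t : ι)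
    (f : (ι → α) → β) (hf : ∀ G g, f (Function.update G t g) = f G) {M : Type*} [AddCommMonoid M]
    (φ : α → β → M) :
    Fintype.card α • ∑ G : ι → α, φ (G t) (f G) = ∑ G : ι → α, ∑ g, φ g (f G) := by
  have h1 : Fintype.card α • ∑ G : ι → α, φ (G t) (f G)
      = ∑ p : (ι → α) × α, φ (p.1 t) (f p.1) := by
    rw [Fintype.sum_prod_type, Finset.smul_sum]
    simp [Finset.card_univ]
  have h2 : ∑ G : ι → α, ∑ g, φ g (f G) = ∑ p : (ι → α) × α, φ p.2 (f p.1) := by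
    rw [Fintype.sum_prod_type]
  rw [h1, h2]
  let e : (ι → α) × α ≃ (ι → α) × α :=
    { toFun := fun p => (Function.update p.1 t p.2, p.1 t)
      invFun := fun p => (Function.update p.1 t p.2, p.1 t)
      left_inv := fun p => by simp
      right_inv := fun p => by simp }
  rw [← Equiv.sum_comp e]
  simp [e, hf]

instance (N : ℕ) : Nonempty (Clifford N) := ⟨1⟩

theorem sum_comp_pullbacks {N T : ℕ} {M : Type*} [AddCommMonoid M] (φ : (Fin T → Clifford N) → M) :
    ∑ C : Circuit N T, φ (pullbacks C) = ∑ G, φ G :=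
  Fintype.sum_bijective pullbacks (pullbackEquiv N T).bijective _ _ fun _ => rfl

theorem sum_unif_pullbacks {N T : ℕ} {β : Type*} (t : Fin T) (f : (Fin T → Clifford N) → β)
    (hf : ∀ G g, f (Function.update G t g) = f G) (φ : Clifford N → β → ℝ) :
    ∑ C : Circuit N T, unif (Circuit N T) C * φ (pullbacks C t) (f (pullbacks C))
      = ∑ C : Circuit N T, unif (Circuit N T) C *
        ∑ g, unif (Clifford N) g * φ g (f (pullbacks C)) := by
  have h := sum_eval_mul_card t f hf φ
  have h0 : (Fintype.card (Clifford N) : ℝ) ≠ 0 := by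
    exact_mod_cast Fintype.card_ne_zero
  rw [nsmul_eq_mul] at h
  simp only [unif, ← Finset.mul_sum]
  rw [sum_comp_pullbacks fun G => φ (G t) (f G), sum_comp_pullbacks fun G => ∑ g, φ g (f G), ← h,
    inv_mul_cancel_left₀ h0]

theorem sum_unif_eval {N T : ℕ} (t : Fin T) (φ : Clifford N → ℝ) :
    ∑ C : Circuit N T, unif (Circuit N T) C * φ (pullbacks C t)
      = ∑ g, unif (Clifford N) g * φ g := by
  have h := sum_unif_pullbacks (N := N) t (fun _ => ()) (fun _ _ => rfl) fun g _ => φ g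
  rw [h, ← Finset.sum_mul, sum_unif, one_mul]

/-! ### Visibility and collisions of random Pauli images -/

theorem sum_ycoef_sq (N : ℕ) :
    ∑ A ∈ Finset.univ.erase (0 : PauliString N), ycoef A ^ 2 = (4 ^ N - 2 ^ N) / 2 := by
  have h0 : ycoef (0 : PauliString N) ^ 2 = 0 := by rw [ycoef_sq]; simp [ysgn]
  have h1 := Finset.add_sum_erase Finset.univ (fun A : PauliString N => ycoef A ^ 2)
    (Finset.mem_univ 0)
  simp only [h0, zero_add] at h1
  rw [h1]
  simp only [ycoef_sq]
  rw [← Finset.sum_div, Finset.sum_sub_distrib]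
  simp only [ysgn]
  rw [sum_pauliString_prod fun _ p => if p = 2 then (-1 : ℝ) else 1]
  have h2 : ∑ p : Fin 4, (if p = 2 then (-1 : ℝ) else 1) = 2 := by
    simp [Fin.sum_univ_four]; norm_num
  rw [h2]
  simp [Finset.card_univ]

/-- The mean is `(4^N - 2^N) / (2 (4^N - 1)) = 2^N / (2 (2^N + 1))`, which equals `1/3` at `N = 1`
and increases with `N`. -/
theorem one_third_le_sum_ycoef {N : ℕ} (hN : 1 ≤ N) {P : PauliString N} (hP : P ≠ 0) :
    1 / 3 ≤ ∑ g, unif (Clifford N) g * ycoef (g.1 P).2 ^ 2 := by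
  have h := Clifford.sum_label hP fun A => ycoef A ^ 2
  rw [sum_ycoef_sq] at h
  have h0 : (0 : ℝ) < Fintype.card (Clifford N) := by exact_mod_cast Fintype.card_pos
  have h2 : (2 : ℝ) ≤ 2 ^ N := by simpa using pow_le_pow_right₀ (by norm_num : (1 : ℝ) ≤ 2) hN
  have h4 : (4 : ℝ) ^ N = 2 ^ N * 2 ^ N := by rw [← mul_pow]; norm_num
  simp only [unif, ← Finset.mul_sum]
  set S := ∑ g : Clifford N, ycoef (g.1 P).2 ^ 2
  rw [inv_mul_eq_div, le_div_iff₀ h0]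
  rw [h4] at h
  have h5 : (0 : ℝ) < 2 ^ N * 2 ^ N - 1 := by nlinarith
  rw [← mul_le_mul_iff_right₀ h5, h]
  nlinarith [mul_nonneg h0.le (by nlinarith : (0 : ℝ) ≤ 2 ^ N * 2 ^ N - 3 * 2 ^ N + 2)]

open Classical in
theorem sum_flips_eq {N : ℕ} (x : Bits N) :
    ∑ A : PauliString N, (if flips A = x then (1 : ℝ) else 0) = 2 ^ N := by
  have h1 : ∀ A : PauliString N, (if flips A = x then (1 : ℝ) else 0)
      = ∏ i, if flip1 (A i) = x i then (1 : ℝ) else 0 := by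
    intro A
    by_cases h : flips A = x
    · rw [if_pos h]
      exact (Finset.prod_eq_one fun i _ => if_pos (congrFun h i)).symm
    · rw [if_neg h]
      obtain ⟨i, hi⟩ := Function.ne_iff.1 h
      exact (Finset.prod_eq_zero (Finset.mem_univ i) (if_neg hi)).symm
  simp only [h1]
  rw [sum_pauliString_prod fun i p => if flip1 p = x i then (1 : ℝ) else 0]
  have h2 : ∀ b : Fin 2, ∑ p : Fin 4, (if flip1 p = b then (1 : ℝ) else 0) = 2 := by
    intro b
    fin_cases b <;> simp [Fin.sum_univ_four, flip1] <;> norm_num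
  simp only [h2]
  simp

/-- At most `2^N` of the `4^N - 1` equally likely images flip the bits `x`. -/
theorem pr_flips_le {N : ℕ} (hN : 1 ≤ N) {P : PauliString N} (hP : P ≠ 0) (x : Bits N) :
    pr (unif (Clifford N)) (fun g => flips (g.1 P).2 = x) ≤ 2 / 2 ^ N := by
  classical
  have h := Clifford.sum_label hP fun A => if flips A = x then 1 else 0
  have h0 : (0 : ℝ) < Fintype.card (Clifford N) := by exact_mod_cast Fintype.card_pos
  have h2 : (2 : ℝ) ≤ 2 ^ N := by simpa using pow_le_pow_right₀ (by norm_num : (1 : ℝ) ≤ 2) hN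
  have h4 : (4 : ℝ) ^ N = 2 ^ N * 2 ^ N := by rw [← mul_pow]; norm_num
  have h6 : ∑ A ∈ Finset.univ.erase (0 : PauliString N), (if flips A = x then (1 : ℝ) else 0)
      ≤ 2 ^ N := by
    rw [← sum_flips_eq x]
    exact Finset.sum_le_sum_of_subset_of_nonneg (Finset.erase_subset _ _)
      fun _ _ _ => by split_ifs <;> norm_num
  have h7 : pr (unif (Clifford N)) (fun g => flips (g.1 P).2 = x)
      = (Fintype.card (Clifford N) : ℝ)⁻¹ *
        ∑ g : Clifford N, if flips (g.1 P).2 = x then 1 else 0 := by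
    simp only [pr, unif, ← Finset.mul_sum]
    congr 1
    exact Finset.sum_congr rfl fun _ _ => by congr
  rw [h7]
  set S := ∑ g : Clifford N, if flips (g.1 P).2 = x then (1 : ℝ) else 0
  rw [inv_mul_eq_div, div_le_div_iff₀ h0 (by positivity)]
  rw [h4] at h
  have h5 : (0 : ℝ) < 2 ^ N * 2 ^ N - 1 := by nlinarith
  rw [← mul_le_mul_iff_right₀ h5]
  have h8 := mul_le_mul_of_nonneg_left h6 h0.le
  rw [← h] at h8
  have h9 := mul_le_mul_of_nonneg_right h8 (by positivity : (0 : ℝ) ≤ 2 ^ N)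
  have h10 : Fintype.card (Clifford N) * ((2 : ℝ) ^ N * 2 ^ N)
      ≤ Fintype.card (Clifford N) * (2 * (2 ^ N * 2 ^ N - 1)) :=
    mul_le_mul_of_nonneg_left (by nlinarith) h0.le
  linarith

/-- The pulled-back generators flip nonzero, pairwise distinct bitstrings. -/
def FlipsDistinct {N T k : ℕ} (F : Fin k → PauliString N) (G : Fin T → Clifford N) : Prop :=
  (∀ p : Fin k × Fin T, flips ((G p.2).1 (F p.1)).2 ≠ 0) ∧
    Function.Injective fun p : Fin k × Fin T => flips ((G p.2).1 (F p.1)).2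

theorem pr_flips_pullbacks_le {N T : ℕ} (hN : 1 ≤ N) {P : PauliString N} (hP : P ≠ 0) (t : Fin T)
    (f : (Fin T → Clifford N) → Bits N) (hf : ∀ G g, f (Function.update G t g) = f G) :
    pr (unif (Circuit N T)) (fun C => flips ((pullbacks C t).1 P).2 = f (pullbacks C)) ≤ 2 / 2 ^ N := by
  classical
  have h := sum_unif_pullbacks (N := N) t f hf
    fun g x => if flips (g.1 P).2 = x then 1 else 0
  have h1 : pr (unif (Circuit N T)) (fun C => flips ((pullbacks C t).1 P).2 = f (pullbacks C))
      = ∑ C : Circuit N T, unif (Circuit N T) C *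
        pr (unif (Clifford N)) (fun g => flips (g.1 P).2 = f (pullbacks C)) := by
    simp only [pr]
    convert h
  rw [h1]
  calc _ ≤ ∑ C : Circuit N T, unif (Circuit N T) C * (2 / 2 ^ N) :=
        Finset.sum_le_sum fun C _ => mul_le_mul_of_nonneg_left (pr_flips_le hN hP _) (unif_nonneg _)
    _ = 2 / 2 ^ N := by rw [← Finset.sum_mul, sum_unif, one_mul]

theorem add_self_bits {N : ℕ} (x : Bits N) : x + x = 0 := by
  have : ∀ a : Fin 2, a + a = 0 := by decide
  exact funext fun i => this _

/-- At equal times the images are correlated, but a collision means that the image of the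
non-identity product flips nothing. At different times one image is independent of the other, which
serves as a fixed target. -/
theorem pr_flips_pair_le {N T k : ℕ} (hN : 1 ≤ N) {F : Fin k → PauliString N}
    (hF : Function.Injective F) (hF0 : ∀ β, F β ≠ 0) {p q : Fin k × Fin T} (hpq : p ≠ q) :
    pr (unif (Circuit N T)) (fun C => flips ((pullbacks C p.2).1 (F p.1)).2
      = flips ((pullbacks C q.2).1 (F q.1)).2) ≤ 2 / 2 ^ N := by
  by_cases ht : p.2 = q.2
  · have hne : p.1 ≠ q.1 := fun h => hpq (Prod.ext h ht)
    have hmul : pmul (F p.1) (F q.1) ≠ 0 := fun h => hne (hF (eq_of_pmul_eq_zero h))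
    refine le_trans (pr_mono unif_nonneg fun C hC => ?_)
      (pr_flips_pullbacks_le hN hmul p.2 (fun _ => 0) fun _ _ => rfl)
    rw [Clifford.label_pmul, flips_pmul, hC, ht, add_self_bits]
  · exact pr_flips_pullbacks_le hN (hF0 p.1) p.2 (fun G => flips ((G q.2).1 (F q.1)).2)
      fun G g => by rw [Function.update_of_ne (Ne.symm ht)]

theorem pr_not_flipsDistinct_le {N T k : ℕ} (hN : 1 ≤ N) {F : Fin k → PauliString N}
    (hF : Function.Injective F) (hF0 : ∀ β, F β ≠ 0) :
    pr (unif (Circuit N T)) (fun C => ¬ FlipsDistinct F (pullbacks C))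
      ≤ ((k * T : ℕ) + (k * T : ℕ) ^ 2) * (2 / 2 ^ N) := by
  classical
  have h1 : ∀ C : Circuit N T, ¬ FlipsDistinct F (pullbacks C) →
      (∃ p : Fin k × Fin T, flips ((pullbacks C p.2).1 (F p.1)).2 = 0) ∨
      ∃ pq : (Fin k × Fin T) × (Fin k × Fin T), pq.1 ≠ pq.2 ∧
        flips ((pullbacks C pq.1.2).1 (F pq.1.1)).2 = flips ((pullbacks C pq.2.2).1 (F pq.2.1)).2 := by
    intro C hC
    by_contra! h
    exact hC ⟨h.1, fun p q hpq => by_contra fun hne => h.2 (p, q) hne hpq⟩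
  refine (pr_mono unif_nonneg h1).trans ((pr_or_le unif_nonneg _ _).trans ?_)
  rw [add_mul]
  refine add_le_add ((pr_exists_le unif_nonneg _).trans ?_) ((pr_exists_le unif_nonneg _).trans ?_)
  · refine (Finset.sum_le_sum fun p _ =>
      pr_flips_pullbacks_le hN (hF0 p.1) p.2 (fun _ => 0) fun _ _ => rfl).trans (le_of_eq ?_)
    simp [Finset.card_univ]
  · refine (Finset.sum_le_sum (g := fun _ => (2 / 2 ^ N : ℝ)) fun pq _ => ?_).trans (le_of_eq ?_)
    · by_cases h : pq.1 = pq.2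
      · simp only [pr, h, ne_eq, not_true, false_and, if_false, mul_zero, Finset.sum_const_zero]
        positivity
      · exact (pr_mono unif_nonneg fun C hC => hC.2).trans (pr_flips_pair_le hN hF hF0 h)
    · simp [Finset.card_univ, sq]

/-! ## Evolution in the pulled-back frame -/

/-- The channel `ρ ↦ (1 - γ) ρ + γ M ρ M`. -/
noncomputable def flipChannel {N : ℕ} (M : QOp N) (γ : ℝ) (ρ : QOp N) : QOp N :=
  ((1 - γ : ℝ) : ℂ) • ρ + (γ : ℂ) • (M * ρ * M)

/-- The channels `flipChannel (M β) (γ β)` for `β` in a list, one after the other. -/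
noncomputable def flipChannels {N b : ℕ} (l : List (Fin b)) (M : Fin b → QOp N) (γ : Fin b → ℝ)
    (ρ : QOp N) : QOp N :=
  l.foldl (fun σ β => flipChannel (M β) (γ β) σ) ρ

/-- The unitary `exp (-i H)`. -/
noncomputable def expUnitary {N : ℕ} (H : QOp N) : QOp N := NormedSpace.exp ((-Complex.I) • H)

/-- The signal of one time step. -/
noncomputable def signalStep {N b : ℕ} (H : QOp N) (M : Fin b → QOp N) (γ : Fin b → ℝ)
    (ρ : QOp N) : QOp N :=
  flipChannels (List.finRange b) M γ (expUnitary H * ρ * (expUnitary H)ᴴ)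

/-- The state after the first `k` of the maps `Λ`, starting from `|0⟩⟨0|`. -/
noncomputable def evolve {N T : ℕ} (Λ : Fin T → QOp N → QOp N) : ℕ → QOp N
  | 0 => zeroState N
  | k + 1 => if h : k < T then Λ ⟨k, h⟩ (evolve Λ k) else evolve Λ k

/-- The coherent generator of a time step, pulled back by a Clifford. -/
noncomputable def signalH {N a : ℕ} (P : Fin a → PauliString N) (θ : Fin a → ℝ) (g : Clifford N) :
    QOp N := ∑ α, (θ α : ℂ) • signedPauli g (P α)

/-- The signal of one time step, pulled back by a Clifford. -/
noncomputable def pulledStep {N a b : ℕ} (P : Fin a → PauliString N) (θ : Fin a → ℝ)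
    (Q : Fin b → PauliString N) (γ : Fin b → ℝ) (g : Clifford N) : QOp N → QOp N :=
  signalStep (signalH P θ g) (fun β => signedPauli g (Q β)) γ

theorem conj_mul_conj {N : ℕ} {U : QOp N} (hU : U * Uᴴ = 1) (A B : QOp N) :
    Uᴴ * (A * B) * U = (Uᴴ * A * U) * (Uᴴ * B * U) := by
  calc Uᴴ * (A * B) * U = Uᴴ * A * 1 * B * U := by noncomm_ring
    _ = _ := by rw [← hU]; noncomm_ring

theorem flipChannels_conj {N b : ℕ} {U : QOp N} (hU : U * Uᴴ = 1) (l : List (Fin b))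
    (M : Fin b → QOp N) (γ : Fin b → ℝ) (ρ : QOp N) :
    Uᴴ * flipChannels l M γ ρ * U = flipChannels l (fun β => Uᴴ * M β * U) γ (Uᴴ * ρ * U) := by
  induction l generalizing ρ with
  | nil => rfl
  | cons β l ih =>
    have h := ih (flipChannel (M β) (γ β) ρ)
    simp only [flipChannels, List.foldl_cons] at h ⊢
    rw [h]
    congr 1
    simp only [flipChannel, Matrix.mul_add, Matrix.add_mul, Matrix.mul_smul, Matrix.smul_mul,
      ← conj_mul_conj hU]

theorem expUnitary_conj {N : ℕ} {U : QOp N} (hU : U * Uᴴ = 1) (hU' : Uᴴ * U = 1) (H : QOp N) :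
    expUnitary (Uᴴ * H * U) = Uᴴ * expUnitary H * U := by
  have h := Matrix.exp_units_conj' (⟨U, Uᴴ, hU, hU'⟩ : (QOp N)ˣ) ((-Complex.I) • H)
  rw [expUnitary, expUnitary, ← Matrix.smul_mul, ← Matrix.mul_smul]
  exact h

theorem signalStep_conj {N b : ℕ} {U : QOp N} (hU : U * Uᴴ = 1) (hU' : Uᴴ * U = 1) (H : QOp N)
    (M : Fin b → QOp N) (γ : Fin b → ℝ) (ρ : QOp N) :
    Uᴴ * signalStep H M γ ρ * U
      = signalStep (Uᴴ * H * U) (fun β => Uᴴ * M β * U) γ (Uᴴ * ρ * U) := by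
  rw [signalStep, flipChannels_conj hU, signalStep, expUnitary_conj hU hU', conj_mul_conj hU,
    conj_mul_conj hU]
  congr 2
  simp only [Matrix.conjTranspose_mul, Matrix.conjTranspose_conjTranspose, mul_assoc]

/-- In the frame rotated by the current prefix, the Clifford of each step cancels against the change
of frame, and only the rotated signal remains. -/
theorem pullback_stateAfter {N T a b : ℕ} (P : Fin a → PauliString N) (θ : Fin a → Fin T → ℝ)
    (Q : Fin b → PauliString N) (γ : Fin b → Fin T → ℝ) (C : Circuit N T) (k : ℕ) :
    (circuitPrefix C k)ᴴ * stateAfter P θ Q γ C k * circuitPrefix C k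
      = evolve (fun t => pulledStep P (fun α => θ α t) Q (fun β => γ β t) (pullbacks C t)) k := by
  induction k with
  | zero => simp [circuitPrefix, stateAfter, evolve]
  | succ k ih =>
    by_cases h : k < T
    · have hU := implements_circuitPrefix C k
      have hU1 := implements_circuitPrefix C (k + 1)
      rw [stateAfter, evolve, dif_pos h, dif_pos h, ← ih]
      set D := circuitPrefix C k with hD
      set D1 := circuitPrefix C (k + 1) with hD1
      set t : Fin T := ⟨k, h⟩
      set ρ := stateAfter P θ Q γ C k
      have h1 : D1 * Dᴴ = (C t).mat := by
        rw [hD1, circuitPrefix_succ C h, mul_assoc, hU.mul_conjTranspose_self, mul_one]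
      have h2 : D1ᴴ * ((C t).mat * ρ * (C t).matᴴ) * D1 = Dᴴ * ρ * D := by
        rw [← h1, Matrix.conjTranspose_mul, Matrix.conjTranspose_conjTranspose]
        calc D1ᴴ * (D1 * Dᴴ * ρ * (D * D1ᴴ)) * D1 = (D1ᴴ * D1) * Dᴴ * ρ * D * (D1ᴴ * D1) := by
              noncomm_ring
          _ = Dᴴ * ρ * D := by rw [hU1.conjTranspose_mul_self, one_mul, mul_one]
      have h3 := signalStep_conj hU1.mul_conjTranspose_self hU1.conjTranspose_mul_self
        (∑ α, (θ α t : ℂ) • pauliOp (P α)) (fun β => pauliOp (Q β)) (fun β => γ β t)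
        ((C t).mat * ρ * (C t).matᴴ)
      rw [h2] at h3
      refine Eq.trans h3 ?_
      have h4 : ∀ R, D1ᴴ * pauliOp R * D1 = signedPauli (pullbacks C t) R := fun R =>
        pulledBack_eq C R t
      have h5 : D1ᴴ * (∑ α, (θ α t : ℂ) • pauliOp (P α)) * D1
          = signalH P (fun α => θ α t) (pullbacks C t) := by
        simp only [Matrix.mul_sum, Matrix.sum_mul, Matrix.mul_smul, Matrix.smul_mul, h4, signalH]
      rw [h5]
      simp only [h4]
      rfl
    · rw [stateAfter, evolve, dif_neg h, dif_neg h, ← ih, circuitPrefix, dif_neg h]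

theorem finalState_eq {N T a b : ℕ} (P : Fin a → PauliString N) (θ : Fin a → Fin T → ℝ)
    (Q : Fin b → PauliString N) (γ : Fin b → Fin T → ℝ) (C : Circuit N T) :
    finalState P θ Q γ C
      = evolve (fun t => pulledStep P (fun α => θ α t) Q (fun β => γ β t) (pullbacks C t)) T :=
  pullback_stateAfter P θ Q γ C T

/-! ### The coherent unitary -/

theorem signalH_isHermitian {N a : ℕ} (P : Fin a → PauliString N) (θ : Fin a → ℝ)
    (g : Clifford N) : (signalH P θ g).IsHermitian := by
  rw [Matrix.IsHermitian, signalH, Matrix.conjTranspose_sum]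
  refine Finset.sum_congr rfl fun α _ => ?_
  rw [Matrix.conjTranspose_smul, signedPauli_conjTranspose]
  congr 1
  exact Complex.conj_ofReal _

theorem exists_diagonalization {N : ℕ} {H : QOp N} (hH : H.IsHermitian) :
    ∃ (V : QOp N) (d : Bits N → ℝ), V * Vᴴ = 1 ∧ Vᴴ * V = 1 ∧
      H = V * Matrix.diagonal (fun j => (d j : ℂ)) * Vᴴ ∧
      expUnitary H = V * Matrix.diagonal (fun j => Complex.exp (-(d j * Complex.I))) * Vᴴ := by
  have hV : (hH.eigenvectorUnitary : QOp N) * (hH.eigenvectorUnitary : QOp N)ᴴ = 1 :=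
    Matrix.mem_unitaryGroup_iff.1 hH.eigenvectorUnitary.2
  have hV' := mul_eq_one_comm.1 hV
  have h1 : H = (hH.eigenvectorUnitary : QOp N) *
      Matrix.diagonal (fun j => (hH.eigenvalues j : ℂ)) * (hH.eigenvectorUnitary : QOp N)ᴴ := by
    conv_lhs => rw [hH.spectral_theorem]
    rfl
  generalize (hH.eigenvectorUnitary : QOp N) = V at *
  refine ⟨V, hH.eigenvalues, hV, hV', h1, ?_⟩
  have h2 := expUnitary_conj (U := Vᴴ) (by rw [Matrix.conjTranspose_conjTranspose, hV'])
    (by rw [Matrix.conjTranspose_conjTranspose, hV])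
    (Matrix.diagonal fun j => (hH.eigenvalues j : ℂ))
  rw [Matrix.conjTranspose_conjTranspose, ← h1] at h2
  rw [h2, expUnitary, ← Matrix.diagonal_smul, Matrix.exp_diagonal]
  congr 3
  funext j
  rw [Pi.coe_exp, ← Complex.exp_eq_exp_ℂ]
  congr 1
  simp [mul_comm]

theorem expUnitary_mul_conjTranspose {N : ℕ} {H : QOp N} (hH : H.IsHermitian) :
    expUnitary H * (expUnitary H)ᴴ = 1 := by
  obtain ⟨V, d, hV, hV', -, h⟩ := exists_diagonalization hH
  rw [h]
  simp only [Matrix.conjTranspose_mul, Matrix.conjTranspose_conjTranspose,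
    Matrix.diagonal_conjTranspose]
  set D := Matrix.diagonal fun j => Complex.exp (-(d j * Complex.I)) with hD
  have h1 : D * Matrix.diagonal (star fun j => Complex.exp (-(d j * Complex.I))) = 1 := by
    rw [hD, Matrix.diagonal_mul_diagonal, ← Matrix.diagonal_one]
    congr 1
    funext j
    rw [Pi.star_apply, Complex.star_def, ← Complex.exp_conj, ← Complex.exp_add]
    simp
  calc V * D * Vᴴ * (V * (_ * Vᴴ)) = V * D * (Vᴴ * V) * (_ * Vᴴ) := by noncomm_ring
    _ = V * (D * Matrix.diagonal (star fun j => Complex.exp (-(d j * Complex.I)))) * Vᴴ := by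
      rw [hV']; noncomm_ring
    _ = 1 := by rw [h1, mul_one, hV]

/-- Apply `cos x ≥ 1 - x²/2` to each eigenvalue. -/
theorem re_trace_expUnitary_ge {N : ℕ} {H : QOp N} (hH : H.IsHermitian) :
    2 ^ N - (H * H).trace.re / 2 ≤ (expUnitary H).trace.re := by
  obtain ⟨V, d, hV, hV', h1, h2⟩ := exists_diagonalization hH
  have h3 : ∀ D : QOp N, (V * D * Vᴴ).trace = D.trace := fun D => by
    rw [Matrix.trace_mul_comm, ← mul_assoc, hV', one_mul]
  have h4 : H * H = V * Matrix.diagonal (fun j => (d j : ℂ) * d j) * Vᴴ := by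
    rw [← Matrix.diagonal_mul_diagonal]
    conv_lhs => rw [h1]
    calc _ = V * Matrix.diagonal (fun j => (d j : ℂ)) * (Vᴴ * V) *
          Matrix.diagonal (fun j => (d j : ℂ)) * Vᴴ := by noncomm_ring
      _ = _ := by rw [hV']; noncomm_ring
  rw [h4, h2, h3, h3, Matrix.trace_diagonal, Matrix.trace_diagonal, Complex.re_sum, Complex.re_sum]
  have h5 : (2 : ℝ) ^ N = ∑ _j : Bits N, (1 : ℝ) := by simp [Finset.card_univ]
  rw [h5, Finset.sum_div, ← Finset.sum_sub_distrib]
  refine Finset.sum_le_sum fun j _ => ?_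
  have h6 : (Complex.exp (-(d j * Complex.I))).re = Real.cos (d j) := by
    rw [Complex.exp_re]; simp
  rw [h6, ← Complex.ofReal_mul, Complex.ofReal_re]
  have := Real.one_sub_sq_div_two_le_cos (x := d j)
  nlinarith

/-! ### Positivity and trace -/

section positivity

open scoped ComplexOrder

theorem flipChannel_posSemidef {N : ℕ} {M : QOp N} (hM : Mᴴ = M) {γ : ℝ} (h0 : 0 ≤ γ) (h1 : γ ≤ 1)
    {ρ : QOp N} (hρ : ρ.PosSemidef) : (flipChannel M γ ρ).PosSemidef := by
  have h2 : (M * ρ * M).PosSemidef := by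
    have := hρ.mul_mul_conjTranspose_same M
    rwa [hM] at this
  exact (hρ.smul (Complex.zero_le_real.2 (sub_nonneg.2 h1))).add (h2.smul (Complex.zero_le_real.2 h0))

theorem flipChannel_trace {N : ℕ} {M : QOp N} (hM : M * M = 1) (γ : ℝ) (ρ : QOp N) :
    (flipChannel M γ ρ).trace = ρ.trace := by
  rw [flipChannel, Matrix.trace_add, Matrix.trace_smul, Matrix.trace_smul, Matrix.trace_mul_comm,
    ← mul_assoc, hM, one_mul, ← add_smul, ← Complex.ofReal_add]
  simp

theorem flipChannels_posSemidef {N b : ℕ} (l : List (Fin b)) {M : Fin b → QOp N}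
    (hM : ∀ β, (M β)ᴴ = M β) {γ : Fin b → ℝ} (h0 : ∀ β, 0 ≤ γ β) (h1 : ∀ β, γ β ≤ 1)
    {ρ : QOp N} (hρ : ρ.PosSemidef) : (flipChannels l M γ ρ).PosSemidef := by
  induction l generalizing ρ with
  | nil => exact hρ
  | cons β l ih => exact ih (flipChannel_posSemidef (hM β) (h0 β) (h1 β) hρ)

theorem flipChannels_trace {N b : ℕ} (l : List (Fin b)) {M : Fin b → QOp N}
    (hM : ∀ β, M β * M β = 1) (γ : Fin b → ℝ) (ρ : QOp N) :
    (flipChannels l M γ ρ).trace = ρ.trace := by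
  induction l generalizing ρ with
  | nil => rfl
  | cons β l ih => exact (ih _).trans (flipChannel_trace (hM β) _ _)

theorem re_diag_nonneg {N : ℕ} {ρ : QOp N} (hρ : ρ.PosSemidef) (z : Bits N) : 0 ≤ (ρ z z).re :=
  (Complex.le_def.1 (hρ.diag_nonneg (i := z))).1

/-- Flipped branches contribute nonnegatively and are dropped; the remaining product of factors `1 -
γ` is at least one minus the sum of the rates. -/
theorem flipChannels_apply_zero_ge {N b : ℕ} (l : List (Fin b)) {M : Fin b → QOp N}
    (hM : ∀ β, (M β)ᴴ = M β) {γ : Fin b → ℝ} (h0 : ∀ β, 0 ≤ γ β) (h1 : ∀ β, γ β ≤ 1)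
    {ρ : QOp N} (hρ : ρ.PosSemidef) (hl : (l.map γ).sum ≤ 1) :
    (1 - (l.map γ).sum) * (ρ 0 0).re ≤ (flipChannels l M γ ρ 0 0).re := by
  induction l generalizing ρ with
  | nil => simp [flipChannels]
  | cons β l ih =>
    rw [List.map_cons, List.sum_cons] at hl ⊢
    have hl' : (l.map γ).sum ≤ 1 := by linarith [h0 β]
    refine le_trans ?_ (ih (flipChannel_posSemidef (hM β) (h0 β) (h1 β) hρ) hl')
    have h4 : (M β * ρ * M β).PosSemidef := by
      have := hρ.mul_mul_conjTranspose_same (M β)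
      rwa [hM] at this
    have h6 : (flipChannel (M β) (γ β) ρ 0 0).re
        = (1 - γ β) * (ρ 0 0).re + γ β * ((M β * ρ * M β) 0 0).re := by
      simp [flipChannel]
    have h8 : 0 ≤ (l.map γ).sum := List.sum_nonneg fun x hx => by
      obtain ⟨β', -, rfl⟩ := List.mem_map.1 hx
      exact h0 β'
    rw [h6]
    have h11 := mul_nonneg (mul_nonneg (h0 β) h8) (re_diag_nonneg hρ 0)
    have h12 : 0 ≤ (1 - (l.map γ).sum) * (γ β * ((M β * ρ * M β) 0 0).re) :=
      mul_nonneg (by linarith) (mul_nonneg (h0 β) (re_diag_nonneg h4 0))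
    linarith

/-! ### One time step: positivity, trace and mean return probability -/

section pulledStep

variable {N a b : ℕ} (P : Fin a → PauliString N) (θ : Fin a → ℝ) (Q : Fin b → PauliString N)
  {γ : Fin b → ℝ} (g : Clifford N)

theorem pulledStep_posSemidef (h0 : ∀ β, 0 ≤ γ β) (h1 : ∀ β, γ β ≤ 1) {ρ : QOp N}
    (hρ : ρ.PosSemidef) : (pulledStep P θ Q γ g ρ).PosSemidef :=
  flipChannels_posSemidef _ (fun β => signedPauli_conjTranspose g (Q β)) h0 h1
    (hρ.mul_mul_conjTranspose_same _)

theorem pulledStep_trace (γ : Fin b → ℝ) (ρ : QOp N) :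
    (pulledStep P θ Q γ g ρ).trace = ρ.trace := by
  rw [pulledStep, signalStep, flipChannels_trace _ fun β => signedPauli_mul_self g (Q β),
    Matrix.trace_mul_comm, ← mul_assoc,
    mul_eq_one_comm.1 (expUnitary_mul_conjTranspose (signalH_isHermitian P θ g)), one_mul]

theorem expUnitary_signalH :
    expUnitary (signalH P θ g)
      = g.mat * expUnitary (∑ α, (θ α : ℂ) • pauliOp (P α)) * g.matᴴ := by
  have h := expUnitary_conj (U := g.matᴴ)
    (by rw [Matrix.conjTranspose_conjTranspose, g.implements.conjTranspose_mul_self])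
    (by rw [Matrix.conjTranspose_conjTranspose, g.implements.mul_conjTranspose_self])
    (∑ α, (θ α : ℂ) • pauliOp (P α))
  rw [Matrix.conjTranspose_conjTranspose] at h
  rw [← h, signalH]
  congr 1
  simp only [Matrix.mul_sum, Matrix.sum_mul, Matrix.mul_smul, Matrix.smul_mul, signedPauli_eq_conj]

variable {P}

theorem trace_generator_sq (hP : Function.Injective P) :
    ((∑ α, (θ α : ℂ) • pauliOp (P α)) * ∑ α, (θ α : ℂ) • pauliOp (P α)).trace
      = (((2 : ℝ) ^ N * ∑ α, θ α ^ 2 : ℝ) : ℂ) := by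
  simp only [Finset.sum_mul, Matrix.mul_sum, Matrix.smul_mul, Matrix.mul_smul, Matrix.trace_sum,
    Matrix.trace_smul, trace_pauliOp_mul, smul_eq_mul, hP.eq_iff, mul_ite, mul_zero]
  simp only [Finset.sum_ite_eq, Finset.mem_univ, if_true]
  push_cast
  rw [Finset.mul_sum]
  exact Finset.sum_congr rfl fun _ _ => by ring

theorem generator_isHermitian :
    (∑ α, (θ α : ℂ) • pauliOp (P α) : QOp N).IsHermitian := by
  rw [Matrix.IsHermitian, Matrix.conjTranspose_sum]
  refine Finset.sum_congr rfl fun α _ => ?_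
  rw [Matrix.conjTranspose_smul, pauliOp_conjTranspose]
  congr 1
  exact Complex.conj_ofReal _

/-- Split the rotated unitary `W` as `u + (W - u)`, with `u` its normalised trace. The twirl makes
the cross terms average to zero, and the remaining quadratic term is positive, so the average is at
least `|u|²` times the initial population. As the generators are distinct, hence trace-orthogonal,
the deviation of `u` involves only `∑ θ²`. -/
theorem sum_expUnitary_conj_ge (hP : Function.Injective P) {ρ : QOp N} (hρ : ρ.PosSemidef) :
    (1 - ∑ α, θ α ^ 2) * (ρ 0 0).re ≤ ∑ g, unif (Clifford N) g *
      ((expUnitary (signalH P θ g) * ρ * (expUnitary (signalH P θ g))ᴴ) 0 0).re := by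
  set H : QOp N := ∑ α, (θ α : ℂ) • pauliOp (P α) with hH
  set u : ℂ := (expUnitary H).trace / 2 ^ N with hu
  set W : Clifford N → QOp N := fun g => expUnitary (signalH P θ g) with hW
  have hcard : (Fintype.card (Clifford N) : ℝ) ≠ 0 := by exact_mod_cast Fintype.card_ne_zero
  have hsum : ∑ g, (W g - u • 1) = 0 := by
    rw [Finset.sum_sub_distrib]
    simp only [hW, expUnitary_signalH]
    rw [Clifford.sum_conj, Finset.sum_const, Finset.card_univ, ← Nat.cast_smul_eq_nsmul ℂ,
      smul_smul, sub_self]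
  have hexp : ∀ g, W g * ρ * (W g)ᴴ = (u * star u) • ρ + u • (ρ * (W g - u • 1)ᴴ)
      + star u • ((W g - u • 1) * ρ) + (W g - u • 1) * ρ * (W g - u • 1)ᴴ := by
    intro g
    rw [Matrix.conjTranspose_sub, Matrix.conjTranspose_smul, Matrix.conjTranspose_one]
    simp only [Matrix.mul_sub, Matrix.sub_mul, Matrix.mul_smul, Matrix.smul_mul, mul_one, one_mul,
      smul_sub, smul_smul]
    module
  have hpos : ∀ g, 0 ≤ (((W g - u • 1) * ρ * (W g - u • 1)ᴴ : QOp N) 0 0).re := fun g =>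
    re_diag_nonneg (hρ.mul_mul_conjTranspose_same _) 0
  have h1 : ∑ g, (u • (ρ * (W g - u • 1)ᴴ) + star u • ((W g - u • 1) * ρ)) = 0 := by
    rw [Finset.sum_add_distrib, ← Finset.smul_sum, ← Finset.smul_sum, ← Finset.mul_sum,
      ← Finset.sum_mul, ← Matrix.conjTranspose_sum, hsum]
    simp
  have h2 : ∑ g, ((u • (ρ * (W g - u • 1)ᴴ) + star u • ((W g - u • 1) * ρ) : QOp N) 0 0).re = 0 := by
    have h3 := congrArg (fun M : QOp N => (M 0 0).re) h1
    simpa [Matrix.sum_apply] using h3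
  have h4 : Fintype.card (Clifford N) * (Complex.normSq u * (ρ 0 0).re)
      ≤ ∑ g, ((W g * ρ * (W g)ᴴ) 0 0).re := by
    have h5 : ∀ g, Complex.normSq u * (ρ 0 0).re +
        ((u • (ρ * (W g - u • 1)ᴴ) + star u • ((W g - u • 1) * ρ) : QOp N) 0 0).re
          ≤ ((W g * ρ * (W g)ᴴ) 0 0).re := by
      intro g
      rw [hexp g, add_assoc ((u * star u) • ρ), Matrix.add_apply _ ((W g - u • 1) * ρ * _),
        Matrix.add_apply ((u * star u) • ρ), Complex.add_re, Complex.add_re]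
      have h6 : (((u * star u) • ρ) 0 0).re = Complex.normSq u * (ρ 0 0).re := by
        rw [Matrix.smul_apply, smul_eq_mul, Complex.star_def, Complex.mul_conj,
          Complex.re_ofReal_mul]
      rw [h6]
      linarith [hpos g]
    have h7 := Finset.sum_le_sum fun g (_ : g ∈ Finset.univ) => h5 g
    rw [Finset.sum_add_distrib, h2, add_zero, Finset.sum_const, Finset.card_univ,
      nsmul_eq_mul] at h7
    exact h7
  -- From `|u|² ≥ (Re u)² ≥ 2 Re u - 1` and `Re u ≥ 1 - ∑ θ² / 2`.
  have h8 : 1 - ∑ α, θ α ^ 2 ≤ Complex.normSq u := by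
    have h9 := re_trace_expUnitary_ge (generator_isHermitian (P := P) θ)
    rw [trace_generator_sq θ hP, Complex.ofReal_re] at h9
    have h10 : u.re = (expUnitary H).trace.re / 2 ^ N := by
      rw [hu, show (2 : ℂ) ^ N = (((2 : ℝ) ^ N : ℝ) : ℂ) by push_cast; rfl, Complex.div_ofReal_re]
    have h11 : 1 - (∑ α, θ α ^ 2) / 2 ≤ u.re := by
      rw [h10, le_div_iff₀ (by positivity)]
      refine le_trans (le_of_eq ?_) h9
      ring
    rw [Complex.normSq_apply]
    nlinarith [sq_nonneg (u.re - 1), mul_self_nonneg u.im]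
  simp only [unif, ← Finset.mul_sum]
  have h12 : (0 : ℝ) < Fintype.card (Clifford N) := by exact_mod_cast Fintype.card_pos
  rw [inv_mul_eq_div, le_div_iff₀ h12, mul_comm]
  refine le_trans (mul_le_mul_of_nonneg_left ?_ h12.le) h4
  exact mul_le_mul_of_nonneg_right h8 (re_diag_nonneg hρ 0)

theorem sum_pulledStep_apply_zero_ge (hP : Function.Injective P) (h0 : ∀ β, 0 ≤ γ β)
    (h1 : ∑ β, γ β ≤ 1) {ρ : QOp N} (hρ : ρ.PosSemidef) :
    (1 - (∑ β, γ β + ∑ α, θ α ^ 2)) * (ρ 0 0).re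
      ≤ ∑ g, unif (Clifford N) g * (pulledStep P θ Q γ g ρ 0 0).re := by
  have h1' : ∀ β, γ β ≤ 1 := fun β =>
    (Finset.single_le_sum (fun β _ => h0 β) (Finset.mem_univ β)).trans h1
  have hl : ((List.finRange b).map γ).sum = ∑ β, γ β := (Fin.sum_univ_def γ).symm
  have h2 : ∀ g, (1 - ∑ β, γ β) *
      ((expUnitary (signalH P θ g) * ρ * (expUnitary (signalH P θ g))ᴴ) 0 0).re
        ≤ (pulledStep P θ Q γ g ρ 0 0).re := fun g => by
    have h3 := flipChannels_apply_zero_ge (List.finRange b)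
      (fun β => signedPauli_conjTranspose g (Q β)) h0 h1'
      (hρ.mul_mul_conjTranspose_same (expUnitary (signalH P θ g))) (hl.le.trans h1)
    rwa [hl] at h3
  refine le_trans ?_ (Finset.sum_le_sum fun g _ =>
    mul_le_mul_of_nonneg_left (h2 g) (unif_nonneg g))
  have h4 := mul_le_mul_of_nonneg_left (sum_expUnitary_conj_ge θ hP hρ) (sub_nonneg.2 h1)
  rw [Finset.mul_sum] at h4
  have h5 : 0 ≤ (∑ β, γ β) * (∑ α, θ α ^ 2) * (ρ 0 0).re :=
    mul_nonneg (mul_nonneg (Finset.sum_nonneg fun β _ => h0 β)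
      (Finset.sum_nonneg fun α _ => sq_nonneg _)) (re_diag_nonneg hρ 0)
  calc _ ≤ (1 - ∑ β, γ β) * ((1 - ∑ α, θ α ^ 2) * (ρ 0 0).re) := by linarith
    _ ≤ _ := h4
    _ = _ := Finset.sum_congr rfl fun _ _ => by ring

end pulledStep

/-! ### Whole circuits: outcome distributions and mean fidelity -/

theorem zeroState_posSemidef (N : ℕ) : (zeroState N).PosSemidef := by
  rw [zeroState, ← Matrix.diagonal_single]
  exact Matrix.PosSemidef.diagonal (Pi.single_nonneg.2 zero_le_one)

theorem evolve_posSemidef {N T : ℕ} {Λ : Fin T → QOp N → QOp N}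
    (h : ∀ t ρ, ρ.PosSemidef → (Λ t ρ).PosSemidef) (k : ℕ) : (evolve Λ k).PosSemidef := by
  induction k with
  | zero => exact zeroState_posSemidef N
  | succ k ih =>
    rw [evolve]
    split_ifs
    · exact h _ _ ih
    · exact ih

theorem evolve_trace {N T : ℕ} {Λ : Fin T → QOp N → QOp N} (h : ∀ t ρ, (Λ t ρ).trace = ρ.trace)
    (k : ℕ) : (evolve Λ k).trace = 1 := by
  induction k with
  | zero => simp [evolve, zeroState]
  | succ k ih =>
    rw [evolve]
    split_ifs
    · rw [h, ih]
    · exact ih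

/-- Causality: the state before step `t` does not involve the pull-back at `t`, which may therefore
be averaged with that state held fixed. -/
theorem evolve_update {N T : ℕ} {α : Type*} (S : Fin T → α → QOp N → QOp N) (G : Fin T → α)
    (t : Fin T) (g : α) {k : ℕ} (hk : k ≤ t) :
    evolve (fun s => S s (Function.update G t g s)) k = evolve (fun s => S s (G s)) k := by
  induction k with
  | zero => rfl
  | succ k ih =>
    have hkT : k < T := lt_of_lt_of_le (Nat.lt_of_succ_le hk) t.2.le
    have hne : (⟨k, hkT⟩ : Fin T) ≠ t := fun h => by
      rw [← h] at hk
      exact absurd hk (Nat.not_succ_le_self k)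
    rw [evolve, evolve, dif_pos hkT, dif_pos hkT, ih (Nat.le_of_succ_le hk),
      Function.update_of_ne hne]

section distributions

variable {N T a b : ℕ} (P : Fin a → PauliString N) (θ : Fin a → Fin T → ℝ)
  (Q : Fin b → PauliString N) {γ : Fin b → Fin T → ℝ} (C : Circuit N T)

theorem finalState_posSemidef (h0 : ∀ β t, 0 ≤ γ β t) (h1 : ∀ β t, γ β t ≤ 1) :
    (finalState P θ Q γ C).PosSemidef := by
  rw [finalState_eq]
  exact evolve_posSemidef (fun t ρ hρ => pulledStep_posSemidef P _ Q _ (fun β => h0 β t)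
    (fun β => h1 β t) hρ) T

theorem finalState_trace (γ : Fin b → Fin T → ℝ) : (finalState P θ Q γ C).trace = 1 := by
  rw [finalState_eq]
  exact evolve_trace (fun t ρ => pulledStep_trace P _ Q _ _ ρ) T

theorem hadamardOp_conjTranspose (N : ℕ) : (hadamardOp N)ᴴ = hadamardOp N := by
  rw [hadamardOp_eq_tens, tens_conjTranspose]
  congr 1
  funext i
  ext x y
  fin_cases x <;> fin_cases y <;> simp [hadamard1, Matrix.conjTranspose_apply]

theorem hadamardOp_mul_self (N : ℕ) : hadamardOp N * hadamardOp N = 1 := by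
  have h : (((Real.sqrt 2 : ℝ) : ℂ))⁻¹ * (((Real.sqrt 2 : ℝ) : ℂ))⁻¹ = 2⁻¹ := by
    rw [← mul_inv, ← Complex.ofReal_mul, Real.mul_self_sqrt (by norm_num)]; norm_num
  have h1 : hadamard1 * hadamard1 = 1 := by
    rw [hadamard1, Matrix.smul_mul, Matrix.mul_smul, smul_smul, h]
    ext x y
    fin_cases x <;> fin_cases y <;> norm_num [Matrix.mul_apply, Fin.sum_univ_two]
  rw [hadamardOp_eq_tens, tens_mul]
  simp only [h1]
  exact tens_one N

theorem probZ_nonneg (h0 : ∀ β t, 0 ≤ γ β t) (h1 : ∀ β t, γ β t ≤ 1) (z : Bits N) :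
    0 ≤ probZ P θ Q γ C z := re_diag_nonneg (finalState_posSemidef P θ Q C h0 h1) z

theorem probX_nonneg (h0 : ∀ β t, 0 ≤ γ β t) (h1 : ∀ β t, γ β t ≤ 1) (z : Bits N) :
    0 ≤ probX P θ Q γ C z := by
  have h := (finalState_posSemidef P θ Q C h0 h1).mul_mul_conjTranspose_same (hadamardOp N)
  rw [hadamardOp_conjTranspose] at h
  exact re_diag_nonneg h z

theorem sum_probZ (γ : Fin b → Fin T → ℝ) : ∑ z, probZ P θ Q γ C z = 1 := by
  have h := congrArg Complex.re (finalState_trace P θ Q C γ)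
  rwa [Matrix.trace, Complex.re_sum] at h

theorem sum_probX (γ : Fin b → Fin T → ℝ) : ∑ z, probX P θ Q γ C z = 1 := by
  have h : (hadamardOp N * finalState P θ Q γ C * hadamardOp N).trace = 1 := by
    rw [Matrix.trace_mul_comm, ← mul_assoc, hadamardOp_mul_self, one_mul, finalState_trace]
  have h := congrArg Complex.re h
  rwa [Matrix.trace, Complex.re_sum] at h

variable {P}

/-- The mean fidelity of random circuits. -/
theorem sum_probZ_zero_ge (hP : Function.Injective P) (h0 : ∀ β t, 0 ≤ γ β t)
    (h1 : ∑ β, ∑ t, γ β t ≤ 1) :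
    1 - (∑ β, ∑ t, γ β t + ∑ α, ∑ t, θ α t ^ 2)
      ≤ ∑ C : Circuit N T, unif (Circuit N T) C * probZ P θ Q γ C 0 := by
  rw [Finset.sum_comm] at h1
  have h1' : ∀ t, ∑ β, γ β t ≤ 1 := fun t =>
    (Finset.single_le_sum (f := fun t => ∑ β, γ β t)
      (fun t _ => Finset.sum_nonneg fun β _ => h0 β t) (Finset.mem_univ t)).trans h1
  have h1'' : ∀ β t, γ β t ≤ 1 := fun β t =>
    (Finset.single_le_sum (fun β _ => h0 β t) (Finset.mem_univ β)).trans (h1' t)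
  set S : Fin T → Clifford N → QOp N → QOp N := fun t =>
    pulledStep P (fun α => θ α t) Q (fun β => γ β t) with hS
  set A : Fin T → ℝ := fun t => ∑ β, γ β t + ∑ α, θ α t ^ 2 with hA
  have hA0 : ∀ t, 0 ≤ A t := fun t => add_nonneg (Finset.sum_nonneg fun β _ => h0 β t)
    (Finset.sum_nonneg fun α _ => sq_nonneg _)
  have hpsd : ∀ (G : Fin T → Clifford N) k, (evolve (fun t => S t (G t)) k).PosSemidef :=
    fun G k => evolve_posSemidef (fun t ρ hρ => pulledStep_posSemidef P _ Q _
      (fun β => h0 β t) (fun β => h1'' β t) hρ) k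
  have key : ∀ k ≤ T, 1 - ∑ i ∈ Finset.range k, (if h : i < T then A ⟨i, h⟩ else 0)
      ≤ ∑ C : Circuit N T, unif (Circuit N T) C *
        (evolve (fun t => S t (pullbacks C t)) k 0 0).re := by
    intro k
    induction k with
    | zero =>
      intro _
      have : ∀ C : Circuit N T, (evolve (fun t => S t (pullbacks C t)) 0 0 0).re = 1 := fun C => by
        simp [evolve, zeroState]
      simp only [this, mul_one, sum_unif]
      simp
    | succ k ih =>
      intro hk
      have hkT : k < T := hk
      have h2 := sum_unif_pullbacks (N := N) (⟨k, hkT⟩ : Fin T)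
        (fun G => evolve (fun t => S t (G t)) k)
        (fun G g => evolve_update S G ⟨k, hkT⟩ g le_rfl)
        fun g ρ => (S ⟨k, hkT⟩ g ρ 0 0).re
      have h3 : ∀ C : Circuit N T, evolve (fun t => S t (pullbacks C t)) (k + 1)
          = S ⟨k, hkT⟩ (pullbacks C ⟨k, hkT⟩) (evolve (fun t => S t (pullbacks C t)) k) :=
        fun C => by rw [evolve, dif_pos hkT]
      simp only [h3]
      rw [h2, Finset.sum_range_succ, dif_pos hkT]
      have h4 : ∀ C : Circuit N T, (1 - A ⟨k, hkT⟩) *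
          (evolve (fun t => S t (pullbacks C t)) k 0 0).re ≤ ∑ g, unif (Clifford N) g *
            (S ⟨k, hkT⟩ g (evolve (fun t => S t (pullbacks C t)) k) 0 0).re := fun C =>
        sum_pulledStep_apply_zero_ge _ Q hP (fun β => h0 β _) (h1' _) (hpsd _ k)
      refine le_trans ?_ (Finset.sum_le_sum fun C _ =>
        mul_le_mul_of_nonneg_left (h4 C) (unif_nonneg C))
      -- Populations are at most one, so multiplication by `1 - A` costs at most `A`. The losses of
      -- the steps then add up.
      have h5 : ∀ C : Circuit N T, (evolve (fun t => S t (pullbacks C t)) k 0 0).re ≤ 1 := by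
        intro C
        have h6 := congrArg Complex.re (evolve_trace (Λ := fun t => S t (pullbacks C t))
          (fun t ρ => pulledStep_trace P _ Q _ _ ρ) k)
        rw [Matrix.trace, Complex.re_sum, Complex.one_re] at h6
        rw [← h6]
        exact Finset.single_le_sum (f := fun z => (evolve (fun t => S t (pullbacks C t)) k z z).re)
          (fun z _ => re_diag_nonneg (hpsd _ k) z) (Finset.mem_univ 0)
      have h7 : ∀ C : Circuit N T, unif (Circuit N T) C *
          (evolve (fun t => S t (pullbacks C t)) k 0 0).re - unif (Circuit N T) C * A ⟨k, hkT⟩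
            ≤ unif (Circuit N T) C * ((1 - A ⟨k, hkT⟩) *
              (evolve (fun t => S t (pullbacks C t)) k 0 0).re) := by
        intro C
        rw [← mul_sub]
        refine mul_le_mul_of_nonneg_left ?_ (unif_nonneg C)
        nlinarith [mul_le_mul_of_nonneg_left (h5 C) (hA0 ⟨k, hkT⟩)]
      refine le_trans ?_ (Finset.sum_le_sum fun C _ => h7 C)
      rw [Finset.sum_sub_distrib, ← Finset.sum_mul, sum_unif]
      linarith [ih hkT.le]
  have h8 := key T le_rfl
  have h9 : ∀ C, probZ P θ Q γ C 0 = (evolve (fun t => S t (pullbacks C t)) T 0 0).re :=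
    fun C => by rw [probZ, finalState_eq]
  simp only [h9]
  refine le_trans (le_of_eq ?_) h8
  rw [Finset.sum_range]
  simp only [Fin.is_lt, dif_pos, Fin.eta, hA]
  rw [Finset.sum_add_distrib, Finset.sum_comm, Finset.sum_comm (f := fun α t => θ α t ^ 2)]

end distributions

end positivity

/-! ## Trace norm -/

section normed

open scoped Matrix.Norms.L2Operator

/-- The functional `O ↦ tr (O ρ)`. -/
noncomputable def traceDual {N : ℕ} (ρ : QOp N) : QOp N →L[ℂ] ℂ :=
  LinearMap.toContinuousLinearMap
    ((Matrix.traceLinearMap (Bits N) ℂ ℂ).comp (LinearMap.mulRight ℂ ρ))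

/-- The trace norm, as the dual norm of the operator norm. -/
noncomputable def traceNorm {N : ℕ} (ρ : QOp N) : ℝ := ‖traceDual ρ‖

section traceNorm

variable {N : ℕ}

theorem traceDual_apply (ρ O : QOp N) : traceDual ρ O = (O * ρ).trace := rfl

theorem norm_trace_mul_le (ρ O : QOp N) : ‖(O * ρ).trace‖ ≤ traceNorm ρ * ‖O‖ :=
  (traceDual ρ).le_opNorm O

theorem traceNorm_nonneg (ρ : QOp N) : 0 ≤ traceNorm ρ := norm_nonneg _

theorem traceNorm_le {ρ : QOp N} {r : ℝ} (hr : 0 ≤ r) (h : ∀ O : QOp N, ‖(O * ρ).trace‖ ≤ r * ‖O‖) :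
    traceNorm ρ ≤ r := ContinuousLinearMap.opNorm_le_bound _ hr h

theorem traceNorm_add_le (ρ σ : QOp N) : traceNorm (ρ + σ) ≤ traceNorm ρ + traceNorm σ := by
  have h : traceDual (ρ + σ) = traceDual ρ + traceDual σ := by
    ext O; simp [traceDual_apply, mul_add]
  rw [traceNorm, h]; exact norm_add_le _ _

theorem traceNorm_smul (c : ℂ) (ρ : QOp N) : traceNorm (c • ρ) = ‖c‖ * traceNorm ρ := by
  have h : traceDual (c • ρ) = c • traceDual ρ := by
    ext O; simp [traceDual_apply]
  rw [traceNorm, h]; exact norm_smul _ _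

theorem traceNorm_sub_le (ρ σ : QOp N) : traceNorm (ρ - σ) ≤ traceNorm ρ + traceNorm σ := by
  have h := traceNorm_add_le ρ ((-1 : ℂ) • σ)
  rw [traceNorm_smul] at h
  simpa [sub_eq_add_neg] using h

theorem traceNorm_zero : traceNorm (0 : QOp N) = 0 := by
  have h := traceNorm_smul (0 : ℂ) (0 : QOp N)
  simpa using h

theorem traceNorm_mul_mul_le (A ρ B : QOp N) :
    traceNorm (A * ρ * B) ≤ ‖A‖ * ‖B‖ * traceNorm ρ := by
  refine traceNorm_le (by have := traceNorm_nonneg ρ; positivity) fun O => ?_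
  have h1 : (O * (A * ρ * B)).trace = ((B * O * A) * ρ).trace := by
    rw [← mul_assoc, Matrix.trace_mul_comm]
    congr 1; noncomm_ring
  rw [h1]
  refine (norm_trace_mul_le _ _).trans ?_
  have h2 : ‖B * O * A‖ ≤ ‖B‖ * ‖O‖ * ‖A‖ :=
    (norm_mul_le _ _).trans (mul_le_mul_of_nonneg_right (norm_mul_le _ _) (norm_nonneg _))
  calc _ ≤ traceNorm ρ * (‖B‖ * ‖O‖ * ‖A‖) :=
        mul_le_mul_of_nonneg_left h2 (traceNorm_nonneg ρ)
    _ = _ := by ring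

theorem norm_le_one_of_unitary {U : QOp N} (h : Uᴴ * U = 1) : ‖U‖ ≤ 1 := by
  have h1 := Matrix.l2_opNorm_conjTranspose_mul_self U
  rw [h, CStarRing.norm_one] at h1
  nlinarith [norm_nonneg U]

theorem zeroState_eq_diagonal (N : ℕ) :
    zeroState N = Matrix.diagonal (Pi.single (0 : Bits N) (1 : ℂ)) := by
  rw [zeroState, Matrix.diagonal_single]

theorem trace_zeroState_mul (A : QOp N) : (zeroState N * A).trace = A 0 0 := by
  rw [zeroState, Matrix.trace_single_mul]; simp

theorem norm_zeroState_le (N : ℕ) : ‖zeroState N‖ ≤ 1 := by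
  rw [zeroState_eq_diagonal, Matrix.l2_opNorm_diagonal]
  refine (pi_norm_le_iff_of_nonneg zero_le_one).2 fun z => ?_
  by_cases h : z = 0
  · subst h; simp
  · simp [Pi.single_eq_of_ne h]

theorem norm_apply_zero_le (A : QOp N) : ‖A 0 0‖ ≤ ‖A‖ := by
  have h := Matrix.l2_opNorm_mulVec A (WithLp.toLp 2 (Pi.single 0 1))
  have h1 := PiLp.norm_apply_le (WithLp.toLp 2 (A *ᵥ (Pi.single 0 1 : Bits N → ℂ))) 0
  have h2 : ‖(WithLp.toLp 2 (Pi.single 0 1 : Bits N → ℂ) : EuclideanSpace ℂ (Bits N))‖ = 1 := by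
    simp
  rw [h2, mul_one] at h
  refine le_trans ?_ (h1.trans h)
  simp

theorem traceNorm_zeroState_le (N : ℕ) : traceNorm (zeroState N) ≤ 1 :=
  traceNorm_le zero_le_one fun O => by
    rw [Matrix.trace_mul_comm, trace_zeroState_mul, one_mul]; exact norm_apply_zero_le O

theorem abs_re_apply_zero_le (A : QOp N) : |(A 0 0).re| ≤ traceNorm A := by
  rw [← trace_zeroState_mul A]
  refine (Complex.abs_re_le_norm _).trans ((norm_trace_mul_le _ _).trans ?_)
  exact mul_le_of_le_one_right (traceNorm_nonneg A) (norm_zeroState_le N)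

/-- The trace norm dominates the total variation of the measured distribution. -/
theorem abs_sum_mul_diag_le (E : QOp N) {w : Bits N → ℝ} (hw : ∀ z, |w z| ≤ 1) :
    |∑ z, w z * ((hadamardOp N * E * hadamardOp N) z z).re| ≤ traceNorm E := by
  have h1 : ∑ z, w z * ((hadamardOp N * E * hadamardOp N) z z).re
      = ((hadamardOp N * Matrix.diagonal (fun z => (w z : ℂ)) * hadamardOp N * E).trace).re := by
    have h2 : (hadamardOp N * Matrix.diagonal (fun z => (w z : ℂ)) * hadamardOp N * E).trace
        = (Matrix.diagonal (fun z => (w z : ℂ)) * (hadamardOp N * E * hadamardOp N)).trace := by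
      rw [mul_assoc, mul_assoc, Matrix.trace_mul_comm, mul_assoc]
    rw [h2, Matrix.trace, Complex.re_sum]
    refine Finset.sum_congr rfl fun z _ => ?_
    rw [Matrix.diag_apply, Matrix.diagonal_mul, Complex.re_ofReal_mul]
  rw [h1]
  refine (Complex.abs_re_le_norm _).trans ((norm_trace_mul_le _ _).trans ?_)
  refine mul_le_of_le_one_right (traceNorm_nonneg E) ?_
  have hh : ‖hadamardOp N‖ ≤ 1 := norm_le_one_of_unitary (by
    rw [hadamardOp_conjTranspose, hadamardOp_mul_self])
  have hd : ‖(Matrix.diagonal (fun z => (w z : ℂ)) : QOp N)‖ ≤ 1 := by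
    rw [Matrix.l2_opNorm_diagonal]
    refine (pi_norm_le_iff_of_nonneg zero_le_one).2 fun z => ?_
    rw [Complex.norm_real]; exact hw z
  calc _ ≤ ‖hadamardOp N‖ * ‖(Matrix.diagonal (fun z => (w z : ℂ)) : QOp N)‖ * ‖hadamardOp N‖ :=
        (norm_mul_le _ _).trans (mul_le_mul_of_nonneg_right (norm_mul_le _ _) (norm_nonneg _))
    _ ≤ 1 * 1 * 1 := by gcongr
    _ = 1 := by norm_num

end traceNorm

/-! ## First-order perturbation theory -/

/-- `Λ` is a trace-norm contraction that agrees with `1 + L` up to second order in `s`. -/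
structure IsPerturbation {N : ℕ} (Λ L : QOp N → QOp N) (s : ℝ) : Prop where
  nonneg : 0 ≤ s
  map_sub : ∀ ρ σ, L (ρ - σ) = L ρ - L σ
  contract : ∀ ρ, traceNorm (Λ ρ) ≤ traceNorm ρ
  first : ∀ ρ, traceNorm (Λ ρ - ρ) ≤ 2 * s * traceNorm ρ
  linear : ∀ ρ, traceNorm (L ρ) ≤ 2 * s * traceNorm ρ
  second : ∀ ρ, traceNorm (Λ ρ - ρ - L ρ) ≤ 3 * s ^ 2 * traceNorm ρ

namespace IsPerturbation

variable {N : ℕ} {Λ L Λ' L' : QOp N → QOp N} {s s' : ℝ}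

theorem id : IsPerturbation (fun ρ : QOp N => ρ) (fun _ => 0) 0 where
  nonneg := le_rfl
  map_sub _ _ := by simp
  contract _ := le_rfl
  first _ := by simp [traceNorm_zero]
  linear _ := by simp [traceNorm_zero]
  second _ := by simp [traceNorm_zero]

theorem comp (h' : IsPerturbation Λ' L' s') (h : IsPerturbation Λ L s) :
    IsPerturbation (fun ρ => Λ' (Λ ρ)) (fun ρ => L ρ + L' ρ) (s + s') where
  nonneg := add_nonneg h.nonneg h'.nonneg
  map_sub ρ σ := by rw [h.map_sub, h'.map_sub]; abel
  contract ρ := (h'.contract _).trans (h.contract ρ)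
  first ρ := by
    have e : Λ' (Λ ρ) - ρ = (Λ' (Λ ρ) - Λ ρ) + (Λ ρ - ρ) := by abel
    rw [e]
    refine (traceNorm_add_le _ _).trans ?_
    have h1 := (h'.first (Λ ρ)).trans
      (mul_le_mul_of_nonneg_left (h.contract ρ) (mul_nonneg zero_le_two h'.nonneg))
    linarith [h.first ρ]
  linear ρ := by
    refine (traceNorm_add_le _ _).trans ?_
    linarith [h.linear ρ, h'.linear ρ]
  second ρ := by
    -- The last term of the splitting is of size `4 s s'`, within the cross term `6 s s'` of `3 (s +
    -- s')²`; this is why the constants are stable under composition.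
    have e : Λ' (Λ ρ) - ρ - (L ρ + L' ρ)
        = (Λ' (Λ ρ) - Λ ρ - L' (Λ ρ)) + (Λ ρ - ρ - L ρ) + L' (Λ ρ - ρ) := by
      rw [h'.map_sub]; abel
    rw [e]
    refine (traceNorm_add_le _ _).trans ((add_le_add_left (traceNorm_add_le _ _) _).trans ?_)
    have h1 := (h'.second (Λ ρ)).trans (mul_le_mul_of_nonneg_left (h.contract ρ)
      (mul_nonneg zero_le_three (sq_nonneg s')))
    have h2 := (h'.linear (Λ ρ - ρ)).trans
      (mul_le_mul_of_nonneg_left (h.first ρ) (mul_nonneg zero_le_two h'.nonneg))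
    have h3 := h.second ρ
    have h4 : 0 ≤ s * s' * traceNorm ρ :=
      mul_nonneg (mul_nonneg h.nonneg h'.nonneg) (traceNorm_nonneg ρ)
    nlinarith

end IsPerturbation

theorem isPerturbation_flipChannel {N : ℕ} {M : QOp N} (hM : Mᴴ = M) (hM2 : M * M = 1) {γ : ℝ}
    (h0 : 0 ≤ γ) (h1 : γ ≤ 1) :
    IsPerturbation (flipChannel M γ) (fun ρ => (γ : ℂ) • (M * ρ * M - ρ)) γ := by
  have hn : ‖M‖ ≤ 1 := norm_le_one_of_unitary (by rw [hM, hM2])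
  have hγ : ‖(γ : ℂ)‖ = γ := by rw [Complex.norm_real, Real.norm_of_nonneg h0]
  have hγ' : ‖((1 - γ : ℝ) : ℂ)‖ = 1 - γ := by
    rw [Complex.norm_real, Real.norm_of_nonneg (sub_nonneg.2 h1)]
  have hc : ∀ ρ, traceNorm (M * ρ * M) ≤ traceNorm ρ := fun ρ => by
    refine (traceNorm_mul_mul_le _ _ _).trans (mul_le_of_le_one_left (traceNorm_nonneg ρ) ?_)
    exact mul_le_one₀ hn (norm_nonneg _) hn
  have he : ∀ ρ, flipChannel M γ ρ - ρ = (γ : ℂ) • (M * ρ * M - ρ) := fun ρ => by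
    rw [flipChannel]; push_cast; module
  have hl : ∀ ρ, traceNorm ((γ : ℂ) • (M * ρ * M - ρ)) ≤ 2 * γ * traceNorm ρ := fun ρ => by
    rw [traceNorm_smul, hγ]
    have := mul_le_mul_of_nonneg_left ((traceNorm_sub_le (M * ρ * M) ρ).trans
      (add_le_add_left (hc ρ) _)) h0
    linarith
  refine ⟨h0, fun ρ σ => ?_, fun ρ => ?_, fun ρ => ?_, hl, fun ρ => ?_⟩
  · rw [Matrix.mul_sub, Matrix.sub_mul]; module
  · refine (traceNorm_add_le _ _).trans ?_
    rw [traceNorm_smul, traceNorm_smul, hγ, hγ']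
    have := mul_le_mul_of_nonneg_left (hc ρ) h0
    linarith
  · rw [he]; exact hl ρ
  · rw [he, sub_self, traceNorm_zero]
    have := traceNorm_nonneg ρ
    positivity

theorem isPerturbation_flipChannels {N b : ℕ} (l : List (Fin b)) {M : Fin b → QOp N}
    (hM : ∀ β, (M β)ᴴ = M β) (hM2 : ∀ β, M β * M β = 1) {γ : Fin b → ℝ} (h0 : ∀ β, 0 ≤ γ β)
    (h1 : ∀ β, γ β ≤ 1) :
    IsPerturbation (flipChannels l M γ)
      (fun ρ => (l.map fun β => (γ β : ℂ) • (M β * ρ * M β - ρ)).sum) (l.map γ).sum := by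
  induction l with
  | nil => exact IsPerturbation.id
  | cons β l ih =>
    simp only [List.map_cons, List.sum_cons]
    exact ih.comp (isPerturbation_flipChannel (hM β) (hM2 β) (h0 β) (h1 β))

/-- Diagonalisation reduces both estimates to scalar bounds for `exp (-i d)` at eigenvalues with
`|d| ≤ s`. -/
theorem norm_expUnitary_sub_one_le {N : ℕ} {H : QOp N} (hH : H.IsHermitian) {s : ℝ}
    (hs : ‖H‖ ≤ s) (hs1 : s ≤ 1) :
    ‖expUnitary H - 1‖ ≤ s ∧ ‖expUnitary H - 1 + Complex.I • H‖ ≤ s ^ 2 := by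
  obtain ⟨V, d, hV, hV', h1, h2⟩ := exists_diagonalization hH
  have hVn : ‖V‖ ≤ 1 := norm_le_one_of_unitary hV'
  have hVn' : ‖Vᴴ‖ ≤ 1 := by rwa [Matrix.l2_opNorm_conjTranspose]
  have hconj : ∀ D : QOp N, ‖V * D * Vᴴ‖ ≤ ‖D‖ := fun D => by
    calc ‖V * D * Vᴴ‖ ≤ ‖V‖ * ‖D‖ * ‖Vᴴ‖ :=
          (norm_mul_le _ _).trans (mul_le_mul_of_nonneg_right (norm_mul_le _ _) (norm_nonneg _))
      _ ≤ 1 * ‖D‖ * 1 := by gcongr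
      _ = ‖D‖ := by ring
  have hs0 : 0 ≤ s := (norm_nonneg _).trans hs
  have hd : ∀ j, |d j| ≤ s := by
    intro j
    have h3 : Matrix.diagonal (fun j => (d j : ℂ)) = Vᴴ * H * V := by
      rw [h1]
      calc _ = (Vᴴ * V) * Matrix.diagonal (fun j => (d j : ℂ)) * (Vᴴ * V) := by
            rw [hV', one_mul, mul_one]
        _ = _ := by noncomm_ring
    have h4 : ‖(Matrix.diagonal (fun j => (d j : ℂ)) : QOp N)‖ ≤ s := by
      rw [h3]
      calc ‖Vᴴ * H * V‖ ≤ ‖Vᴴ‖ * ‖H‖ * ‖V‖ :=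
            (norm_mul_le _ _).trans (mul_le_mul_of_nonneg_right (norm_mul_le _ _) (norm_nonneg _))
        _ ≤ 1 * s * 1 := mul_le_mul (mul_le_mul hVn' hs (norm_nonneg _) zero_le_one) hVn
              (norm_nonneg _) (by linarith)
        _ = s := by ring
    rw [Matrix.l2_opNorm_diagonal] at h4
    have h5 := (norm_le_pi_norm (fun j => (d j : ℂ)) j).trans h4
    rwa [Complex.norm_real] at h5
  have hone : (1 : QOp N) = V * Matrix.diagonal (fun _ => 1) * Vᴴ := by
    rw [Matrix.diagonal_one, mul_one, hV]
  have e1 : expUnitary H - 1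
      = V * Matrix.diagonal (fun j => Complex.exp (-(d j * Complex.I)) - 1) * Vᴴ := by
    rw [h2]
    nth_rewrite 1 [hone]
    rw [← Matrix.sub_mul, ← Matrix.mul_sub, Matrix.diagonal_sub]
  have e2 : expUnitary H - 1 + Complex.I • H = V * Matrix.diagonal
      (fun j => Complex.exp (-(d j * Complex.I)) - 1 + Complex.I * d j) * Vᴴ := by
    rw [e1]
    nth_rewrite 1 [h1]
    rw [← Matrix.smul_mul, ← Matrix.mul_smul, ← Matrix.add_mul, ← Matrix.mul_add,
      ← Matrix.diagonal_smul, Matrix.diagonal_add]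
    rfl
  constructor
  · rw [e1]
    refine (hconj _).trans ?_
    rw [Matrix.l2_opNorm_diagonal]
    refine (pi_norm_le_iff_of_nonneg hs0).2 fun j => ?_
    have h6 := Real.norm_exp_I_mul_ofReal_sub_one_le (x := -d j)
    rw [Real.norm_eq_abs, abs_neg] at h6
    refine le_trans (le_of_eq ?_) (h6.trans (hd j))
    congr 3
    push_cast; ring
  · rw [e2]
    refine (hconj _).trans ?_
    rw [Matrix.l2_opNorm_diagonal]
    refine (pi_norm_le_iff_of_nonneg (sq_nonneg s)).2 fun j => ?_
    have h7 : ‖(-(d j * Complex.I) : ℂ)‖ = |d j| := by simp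
    have h6 := Complex.norm_exp_sub_one_sub_id_le (x := -(d j * Complex.I))
      (by rw [h7]; exact (hd j).trans hs1)
    rw [h7] at h6
    have h8 : |d j| ^ 2 ≤ s ^ 2 := pow_le_pow_left₀ (abs_nonneg _) (hd j) 2
    refine le_trans (le_of_eq ?_) (h6.trans h8)
    congr 1
    ring

theorem isPerturbation_expUnitary {N : ℕ} {H : QOp N} (hH : H.IsHermitian) {s : ℝ}
    (hs : ‖H‖ ≤ s) (hs1 : s ≤ 1) :
    IsPerturbation (fun ρ => expUnitary H * ρ * (expUnitary H)ᴴ)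
      (fun ρ => (-Complex.I) • (H * ρ - ρ * H)) s := by
  obtain ⟨hW1, hW2⟩ := norm_expUnitary_sub_one_le hH hs hs1
  set W := expUnitary H with hW
  have hWW : W * Wᴴ = 1 := expUnitary_mul_conjTranspose hH
  have hn : ‖W‖ ≤ 1 := norm_le_one_of_unitary (mul_eq_one_comm.1 hWW)
  have hn' : ‖Wᴴ‖ ≤ 1 := by rwa [Matrix.l2_opNorm_conjTranspose]
  have hs0 : 0 ≤ s := (norm_nonneg _).trans hs
  have hW1' : ‖Wᴴ - 1‖ ≤ s := by
    rw [← Matrix.l2_opNorm_conjTranspose]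
    simpa using hW1
  have hW2' : ‖Wᴴ - 1 - Complex.I • H‖ ≤ s ^ 2 := by
    rw [← Matrix.l2_opNorm_conjTranspose]
    rw [Matrix.conjTranspose_sub, Matrix.conjTranspose_sub, Matrix.conjTranspose_smul, hH,
      Matrix.conjTranspose_conjTranspose, Matrix.conjTranspose_one]
    simpa using hW2
  have bound : ∀ (A ρ B : QOp N) (x y : ℝ), ‖A‖ ≤ x → ‖B‖ ≤ y →
      traceNorm (A * ρ * B) ≤ x * y * traceNorm ρ := fun A ρ B x y hA hB =>
    (traceNorm_mul_mul_le A ρ B).trans (mul_le_mul_of_nonneg_right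
      (mul_le_mul hA hB (norm_nonneg _) ((norm_nonneg _).trans hA)) (traceNorm_nonneg ρ))
  have h1n : ‖(1 : QOp N)‖ ≤ 1 := CStarRing.norm_one.le
  refine ⟨hs0, fun ρ σ => ?_, fun ρ => ?_, fun ρ => ?_, fun ρ => ?_, fun ρ => ?_⟩
  · rw [Matrix.mul_sub, Matrix.sub_mul]; module
  · simpa using bound W ρ Wᴴ 1 1 hn hn'
  · have e : W * ρ * Wᴴ - ρ = (W - 1) * ρ * Wᴴ + 1 * ρ * (Wᴴ - 1) := by noncomm_ring
    rw [e]
    refine (traceNorm_add_le _ _).trans ?_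
    have := bound (W - 1) ρ Wᴴ s 1 hW1 hn'
    have := bound 1 ρ (Wᴴ - 1) 1 s h1n hW1'
    linarith
  · rw [traceNorm_smul, norm_neg, Complex.norm_I, one_mul]
    refine (traceNorm_sub_le _ _).trans ?_
    have h3 := bound H ρ 1 s 1 hs h1n
    have h4 := bound 1 ρ H 1 s h1n hs
    rw [mul_one] at h3
    rw [one_mul] at h4
    linarith
  -- The left remainder, the right remainder and the mixed term each cost `s²`, which is the
  -- constant `3`.
  · have e : W * ρ * Wᴴ - ρ - (-Complex.I) • (H * ρ - ρ * H)
        = (W - 1 + Complex.I • H) * ρ * Wᴴ + 1 * ρ * (Wᴴ - 1 - Complex.I • H)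
          + (-(Complex.I • H)) * ρ * (Wᴴ - 1) := by
      simp only [neg_smul, smul_sub, ← Matrix.smul_mul]
      noncomm_ring
    rw [e]
    refine (traceNorm_add_le _ _).trans ((add_le_add_left (traceNorm_add_le _ _) _).trans ?_)
    have h3 := bound (W - 1 + Complex.I • H) ρ Wᴴ (s ^ 2) 1 hW2 hn'
    have h4 := bound 1 ρ (Wᴴ - 1 - Complex.I • H) 1 (s ^ 2) h1n hW2'
    have h5 := bound (-(Complex.I • H)) ρ (Wᴴ - 1) s s
      (by rw [norm_neg, norm_smul, Complex.norm_I, one_mul]; exact hs) hW1'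
    linarith

theorem norm_signedPauli_le {N : ℕ} (g : Clifford N) (P : PauliString N) : ‖signedPauli g P‖ ≤ 1 :=
  norm_le_one_of_unitary (by rw [signedPauli_conjTranspose, signedPauli_mul_self])

/-- The first-order change of the state in one time step. -/
noncomputable def stepGenerator {N a b : ℕ} (P : Fin a → PauliString N) (θ : Fin a → ℝ)
    (Q : Fin b → PauliString N) (γ : Fin b → ℝ) (g : Clifford N) (ρ : QOp N) : QOp N :=
  (-Complex.I) • (signalH P θ g * ρ - ρ * signalH P θ g) +
    ∑ β, (γ β : ℂ) • (signedPauli g (Q β) * ρ * signedPauli g (Q β) - ρ)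

theorem isPerturbation_pulledStep {N a b : ℕ} (P : Fin a → PauliString N) {θ : Fin a → ℝ}
    (Q : Fin b → PauliString N) {γ : Fin b → ℝ} (g : Clifford N) (h0 : ∀ β, 0 ≤ γ β)
    (h1 : ∀ β, γ β ≤ 1) (hθ : ∑ α, |θ α| ≤ 1) :
    IsPerturbation (pulledStep P θ Q γ g) (stepGenerator P θ Q γ g) (∑ α, |θ α| + ∑ β, γ β) := by
  have hH : ‖signalH P θ g‖ ≤ ∑ α, |θ α| := by
    refine (norm_sum_le _ _).trans (Finset.sum_le_sum fun α _ => ?_)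
    rw [norm_smul, Complex.norm_real, Real.norm_eq_abs]
    exact mul_le_of_le_one_right (abs_nonneg _) (norm_signedPauli_le g _)
  have h := (isPerturbation_flipChannels (List.finRange b)
    (fun β => signedPauli_conjTranspose g (Q β)) (fun β => signedPauli_mul_self g (Q β)) h0 h1).comp
      (isPerturbation_expUnitary (signalH_isHermitian P θ g) hH hθ)
  simp only [← Fin.sum_univ_def] at h
  exact h

/-- Duhamel-type induction: evaluating the generator of a step at the initial state rather than the
current one costs at most `2 s` times twice the strength accumulated so far. -/
theorem evolve_perturbation {N T : ℕ} {Λ L : Fin T → QOp N → QOp N} {s : Fin T → ℝ}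
    (h : ∀ t, IsPerturbation (Λ t) (L t) (s t)) :
    traceNorm (evolve Λ T - zeroState N) ≤ 2 * ∑ t, s t ∧
      traceNorm (evolve Λ T - zeroState N - ∑ t, L t (zeroState N)) ≤ 3 * (∑ t, s t) ^ 2 := by
  have key : ∀ k ≤ T, traceNorm (evolve Λ k) ≤ 1 ∧
      0 ≤ ∑ i ∈ Finset.range k, (if h : i < T then s ⟨i, h⟩ else 0) ∧
      traceNorm (evolve Λ k - zeroState N)
        ≤ 2 * ∑ i ∈ Finset.range k, (if h : i < T then s ⟨i, h⟩ else 0) ∧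
      traceNorm (evolve Λ k - zeroState N -
          ∑ i ∈ Finset.range k, (if h : i < T then L ⟨i, h⟩ (zeroState N) else 0))
        ≤ 3 * (∑ i ∈ Finset.range k, (if h : i < T then s ⟨i, h⟩ else 0)) ^ 2 := by
    intro k
    induction k with
    | zero =>
      intro _
      refine ⟨traceNorm_zeroState_le N, by simp, ?_, ?_⟩ <;> simp [evolve, traceNorm_zero]
    | succ k ih =>
      intro hk
      have hkT : k < T := hk
      obtain ⟨i0, i1, i2, i3⟩ := ih hkT.le
      have hp := h ⟨k, hkT⟩
      rw [Finset.sum_range_succ, Finset.sum_range_succ, dif_pos hkT, dif_pos hkT, evolve,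
        dif_pos hkT]
      set ρ := evolve Λ k
      set S := ∑ i ∈ Finset.range k, (if h : i < T then s ⟨i, h⟩ else 0)
      set D := ∑ i ∈ Finset.range k, (if h : i < T then L ⟨i, h⟩ (zeroState N) else 0)
      have hs := hp.nonneg
      refine ⟨(hp.contract ρ).trans i0, add_nonneg i1 hs, ?_, ?_⟩
      · have e : Λ ⟨k, hkT⟩ ρ - zeroState N = (Λ ⟨k, hkT⟩ ρ - ρ) + (ρ - zeroState N) := by abel
        rw [e]
        refine (traceNorm_add_le _ _).trans ?_
        have h1 := (hp.first ρ).trans (mul_le_of_le_one_right (by positivity) i0)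
        linarith
      · have e : Λ ⟨k, hkT⟩ ρ - zeroState N - (D + L ⟨k, hkT⟩ (zeroState N))
            = (Λ ⟨k, hkT⟩ ρ - ρ - L ⟨k, hkT⟩ ρ) + (ρ - zeroState N - D)
              + L ⟨k, hkT⟩ (ρ - zeroState N) := by
          rw [hp.map_sub]; abel
        rw [e]
        refine (traceNorm_add_le _ _).trans ((add_le_add_left (traceNorm_add_le _ _) _).trans ?_)
        have h1 := (hp.second ρ).trans (mul_le_of_le_one_right (by positivity) i0)
        have h2 := (hp.linear (ρ - zeroState N)).trans
          (mul_le_mul_of_nonneg_left i2 (by positivity))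
        have h3 := mul_nonneg i1 hs
        nlinarith
  obtain ⟨-, -, h2, h3⟩ := key T le_rfl
  rw [Finset.sum_range] at h2 h3
  rw [Finset.sum_range] at h3
  simp only [Fin.is_lt, dif_pos, Fin.eta] at h2 h3
  exact ⟨h2, h3⟩

end normed

/-! ## First-order response of the outcome distributions -/

section response

variable {N : ℕ}

theorem hadamard_zeroState_diag (A B : QOp N) (z : Bits N) :
    (hadamardOp N * (A * zeroState N * B) * hadamardOp N) z z
      = (hadamardOp N * A) z 0 * (B * hadamardOp N) 0 z := by
  have h : hadamardOp N * (A * zeroState N * B) * hadamardOp N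
      = (hadamardOp N * A) * zeroState N * (B * hadamardOp N) := by noncomm_ring
  rw [h, zeroState, Matrix.mul_apply, Finset.sum_eq_single 0]
  · rw [Matrix.mul_single_apply_same, mul_one]
  · intro y _ hy
    rw [Matrix.mul_single_apply_of_ne _ _ _ _ _ hy, zero_mul]
  · simp

theorem hadamardOp_comm_apply (z x : Bits N) : hadamardOp N x z = hadamardOp N z x := by
  rw [hadamardOp_apply, hadamardOp_apply]
  congr 2
  exact Finset.prod_congr rfl fun i _ => by simp only [and_comm]

theorem hadamard_signedPauli_apply (g : Clifford N) (P : PauliString N) (z : Bits N) :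
    (hadamardOp N * signedPauli g P) z 0 * hadamardOp N 0 z
      = (((2 : ℝ) ^ N)⁻¹ * ((g.1 P).1 : ℤ) * chi (flips (g.1 P).2) z : ℝ) * zphase (g.1 P).2 := by
  rw [Matrix.mul_apply]
  simp only [signedPauli_apply_zero, mul_ite, mul_zero, Finset.sum_ite_eq', Finset.mem_univ,
    if_true]
  rw [hadamardOp_apply, hadamardOp_apply, ← sqrt_two_inv_pow_mul_self,
    show chi z 0 = 1 by simp [chi]]
  push_cast; ring

theorem signedPauli_hadamard_apply (g : Clifford N) (P : PauliString N) (z : Bits N) :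
    (signedPauli g P * hadamardOp N) 0 z = star ((hadamardOp N * signedPauli g P) z 0) := by
  have h : signedPauli g P * hadamardOp N = (hadamardOp N * signedPauli g P)ᴴ := by
    rw [Matrix.conjTranspose_mul, hadamardOp_conjTranspose, signedPauli_conjTranspose]
  rw [h, Matrix.conjTranspose_apply]

theorem star_hadamardOp_apply (z x : Bits N) : star (hadamardOp N z x) = hadamardOp N z x := by
  rw [hadamardOp_apply]; exact Complex.conj_ofReal _

theorem hadamard_commutator_re (g : Clifford N) (P : PauliString N) (z : Bits N) :
    ((hadamardOp N * ((-Complex.I) • (signedPauli g P * zeroState N - zeroState N * signedPauli g P))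
      * hadamardOp N) z z).re = 2 / 2 ^ N * resp g P z := by
  have h1 := hadamard_zeroState_diag (signedPauli g P) 1 z
  have h2 := hadamard_zeroState_diag 1 (signedPauli g P) z
  rw [mul_one, one_mul, hadamard_signedPauli_apply] at h1
  rw [one_mul, mul_one, signedPauli_hadamard_apply] at h2
  have h3 : hadamardOp N z 0 * star ((hadamardOp N * signedPauli g P) z 0)
      = star ((hadamardOp N * signedPauli g P) z 0 * hadamardOp N 0 z) := by
    rw [star_mul', star_hadamardOp_apply, hadamardOp_comm_apply z 0, mul_comm]
  rw [h3, hadamard_signedPauli_apply] at h2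
  rw [Matrix.mul_smul, Matrix.smul_mul, Matrix.mul_sub, Matrix.sub_mul, Matrix.smul_apply,
    Matrix.sub_apply, h1, h2, resp, ycoef]
  have h4 : ∀ (r : ℝ) (c : ℂ), ((-Complex.I) • (r * c - star (r * c))).re = 2 * r * c.im := by
    intro r c
    simp
    ring
  rw [h4]
  ring

/-- A Pauli string maps `|0⟩` to a basis state up to phase, and all basis states look uniform in the
x-basis. Incoherent signals are therefore invisible there at first order. -/
theorem hadamard_flip_re (g : Clifford N) (Q : PauliString N) (z : Bits N) :
    ((hadamardOp N * (signedPauli g Q * zeroState N * signedPauli g Q) * hadamardOp N) z z).re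
      = 1 / 2 ^ N := by
  rw [hadamard_zeroState_diag, signedPauli_hadamard_apply, Complex.star_def, Complex.mul_conj,
    Complex.ofReal_re, Matrix.mul_apply]
  simp only [signedPauli_apply_zero, mul_ite, mul_zero, Finset.sum_ite_eq', Finset.mem_univ,
    if_true]
  rw [hadamardOp_apply, Complex.normSq_mul, Complex.normSq_mul, Complex.normSq_ofReal,
    Complex.normSq_eq_norm_sq (zphase _), norm_zphase, ← Complex.ofReal_intCast,
    Complex.normSq_ofReal]
  have h1 : (((g.1 Q).1 : ℤ) : ℝ) * (((g.1 Q).1 : ℤ) : ℝ) = 1 := by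
    rcases Int.units_eq_one_or (g.1 Q).1 with h | h <;> rw [h] <;> simp
  have h2 : chi (flips (g.1 Q).2) z * chi (flips (g.1 Q).2) z = 1 := by
    rcases chi_eq_one_or (flips (g.1 Q).2) z with h | h <;> rw [h] <;> simp
  rw [h1, one_pow, mul_one, mul_one, mul_mul_mul_comm, h2, sqrt_two_inv_pow_mul_self, mul_one,
    one_div]

theorem hadamard_zeroState_re (z : Bits N) :
    ((hadamardOp N * zeroState N * hadamardOp N) z z).re = 1 / 2 ^ N := by
  have h := hadamard_zeroState_diag (1 : QOp N) 1 z
  rw [one_mul, mul_one, mul_one, one_mul, hadamardOp_apply, hadamardOp_apply,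
    show chi z 0 = 1 by simp [chi], chi_zero, ← Complex.ofReal_mul] at h
  rw [h, Complex.ofReal_re, mul_one, sqrt_two_inv_pow_mul_self, one_div]

theorem hadamard_stepGenerator_re {a b : ℕ} (P : Fin a → PauliString N) (θ : Fin a → ℝ)
    (Q : Fin b → PauliString N) (γ : Fin b → ℝ) (g : Clifford N) (z : Bits N) :
    ((hadamardOp N * stepGenerator P θ Q γ g (zeroState N) * hadamardOp N) z z).re
      = ∑ α, θ α * (2 / 2 ^ N * resp g (P α) z) := by
  have h1 : (-Complex.I) • (signalH P θ g * zeroState N - zeroState N * signalH P θ g)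
      = ∑ α, (θ α : ℂ) • ((-Complex.I) •
        (signedPauli g (P α) * zeroState N - zeroState N * signedPauli g (P α))) := by
    rw [signalH, Finset.sum_mul, Finset.mul_sum, ← Finset.sum_sub_distrib, Finset.smul_sum]
    refine Finset.sum_congr rfl fun α _ => ?_
    rw [Matrix.smul_mul, Matrix.mul_smul, ← smul_sub, smul_comm]
  have h2 : ∀ β, ((hadamardOp N * (signedPauli g (Q β) * zeroState N * signedPauli g (Q β)
      - zeroState N) * hadamardOp N) z z).re = 0 := fun β => by
    rw [Matrix.mul_sub, Matrix.sub_mul, Matrix.sub_apply, Complex.sub_re, hadamard_flip_re,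
      hadamard_zeroState_re, sub_self]
  rw [stepGenerator, h1, Matrix.mul_add, Matrix.add_mul, Matrix.add_apply, Complex.add_re]
  simp only [Matrix.mul_sum, Matrix.sum_mul, Matrix.sum_apply, Complex.re_sum, Matrix.mul_smul (hadamardOp N) (Complex.ofReal _),
    Matrix.smul_mul (Complex.ofReal _), Matrix.smul_apply, smul_eq_mul, Complex.re_ofReal_mul, h2, hadamard_commutator_re, mul_zero,
    Finset.sum_const_zero, add_zero]

variable {T a b : ℕ} (P : Fin a → PauliString N) (θ : Fin a → Fin T → ℝ)
  (Q : Fin b → PauliString N) {γ : Fin b → Fin T → ℝ}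

theorem abs_probZ_zero_sub_one_le_and_exists (h0 : ∀ β t, 0 ≤ γ β t)
    (hS : (∑ α, ∑ t, |θ α t|) + ∑ β, ∑ t, γ β t ≤ 1) (C : Circuit N T) :
    |probZ P θ Q γ C 0 - 1| ≤ 2 * ((∑ α, ∑ t, |θ α t|) + ∑ β, ∑ t, γ β t) ∧
    ∃ E : QOp N, traceNorm E ≤ 3 * ((∑ α, ∑ t, |θ α t|) + ∑ β, ∑ t, γ β t) ^ 2 ∧
      ∀ z, probX P θ Q γ C z = 1 / 2 ^ N +
        (∑ p : Fin a × Fin T, θ p.1 p.2 * (2 / 2 ^ N * resp (pullbacks C p.2) (P p.1) z)) +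
        ((hadamardOp N * E * hadamardOp N) z z).re := by
  have hsum : (∑ α, ∑ t, |θ α t|) + ∑ β, ∑ t, γ β t
      = ∑ t, (∑ α, |θ α t| + ∑ β, γ β t) := by
    rw [Finset.sum_add_distrib, Finset.sum_comm, Finset.sum_comm (f := fun β t => γ β t)]
  rw [hsum] at hS ⊢
  have hnn : ∀ t, 0 ≤ ∑ α, |θ α t| + ∑ β, γ β t := fun t =>
    add_nonneg (Finset.sum_nonneg fun _ _ => abs_nonneg _) (Finset.sum_nonneg fun β _ => h0 β t)
  have hle : ∀ t, ∑ α, |θ α t| + ∑ β, γ β t ≤ 1 := fun t =>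
    (Finset.single_le_sum (fun t _ => hnn t) (Finset.mem_univ t)).trans hS
  have hθ : ∀ t, ∑ α, |θ α t| ≤ 1 := fun t => by
    linarith [hle t, Finset.sum_nonneg fun β (_ : β ∈ Finset.univ) => h0 β t]
  have hγ : ∀ β t, γ β t ≤ 1 := fun β t => by
    have h1 := Finset.single_le_sum (fun β _ => h0 β t) (Finset.mem_univ β)
    linarith [hle t, Finset.sum_nonneg fun α (_ : α ∈ Finset.univ) => abs_nonneg (θ α t)]
  obtain ⟨h1, h2⟩ := evolve_perturbation fun t => isPerturbation_pulledStep P Q (pullbacks C t)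
    (fun β => h0 β t) (fun β => hγ β t) (hθ t)
  rw [← finalState_eq] at h1 h2
  constructor
  · refine le_trans (le_of_eq ?_) ((abs_re_apply_zero_le _).trans h1)
    rw [Matrix.sub_apply, Complex.sub_re, probZ]
    simp [zeroState]
  · refine ⟨_, h2, fun z => ?_⟩
    have h3 : finalState P θ Q γ C = zeroState N + (∑ t, stepGenerator P (fun α => θ α t) Q
        (fun β => γ β t) (pullbacks C t) (zeroState N)) + (finalState P θ Q γ C - zeroState N -
        ∑ t, stepGenerator P (fun α => θ α t) Q (fun β => γ β t) (pullbacks C t) (zeroState N)) := by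
      abel
    rw [probX]
    conv_lhs => rw [h3]
    rw [Matrix.mul_add, Matrix.mul_add, Matrix.add_mul, Matrix.add_mul, Matrix.add_apply,
      Matrix.add_apply, Complex.add_re, Complex.add_re, hadamard_zeroState_re]
    congr 2
    rw [Matrix.mul_sum, Matrix.sum_mul, Matrix.sum_apply, Complex.re_sum]
    simp only [hadamard_stepGenerator_re]
    rw [Finset.sum_comm, Fintype.sum_prod_type]

end response

/-! ## Least squares -/

section leastSquares

variable {R K : Type} [Fintype R] [Fintype K] [DecidableEq K] {V : Matrix R K ℝ} {d : K → ℝ}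

theorem isUnit_gram (h : Vᵀ * V = Matrix.diagonal d) (hd : ∀ k, d k ≠ 0) : IsUnit (Vᵀ * V) := by
  rw [h, Matrix.isUnit_diagonal, Pi.isUnit_iff]
  exact fun k => (hd k).isUnit

theorem leastSquares_apply (h : Vᵀ * V = Matrix.diagonal d) (hd : ∀ k, d k ≠ 0) (y : R → ℝ)
    (k : K) : leastSquares V y k = (d k)⁻¹ * ∑ r, V r k * y r := by
  have h1 : (Vᵀ * V)⁻¹ = Matrix.diagonal fun k => (d k)⁻¹ := by
    rw [h]
    refine Matrix.inv_eq_right_inv ?_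
    rw [Matrix.diagonal_mul_diagonal, ← Matrix.diagonal_one]
    congr 1
    funext k
    exact mul_inv_cancel₀ (hd k)
  rw [leastSquares, h1, ← Matrix.mulVec_mulVec, Matrix.mulVec_diagonal]
  rfl

end leastSquares

/-! ### Orthogonality of the design columns and explicit regressions -/

section designs

variable {N T k n : ℕ} {F : Fin k → PauliString N} {C : Fin n → Circuit N T}

/-- The number of circuits in which the pulled-back generator is visible in the x-basis. -/
noncomputable def visibleCount (F : Fin k → PauliString N) (C : Fin n → Circuit N T)
    (p : Fin k × Fin T) : ℝ := ∑ i, ycoef ((pullbacks (C i) p.2).1 (F p.1)).2 ^ 2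

theorem designX_none (r : Fin n × Bits N) : designX F C r none = 1 / 2 ^ N := rfl

theorem designX_some (r : Fin n × Bits N) (p : Fin k × Fin T) :
    designX F C r (some p) = 2 / 2 ^ N * resp (pullbacks (C r.1) p.2) (F p.1) r.2 :=
  deltaP_eq _ _ _ _

theorem designZ_none (r : Fin n × Bits N) : designZ F C r none = if r.2 = 0 then 1 else 0 := rfl

theorem designZ_some (r : Fin n × Bits N) (p : Fin k × Fin T) :
    designZ F C r (some p)
      = if r.2 = flips ((pullbacks (C r.1) p.2).1 (F p.1)).2 then 1 else 0 :=
  kernelK_eq _ _ _ _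

/-- Distinct characters are orthogonal within each circuit, and signal columns are orthogonal to the
constant one since responses sum to zero. The squared norm of a signal column counts the circuits in
which it is visible. -/
theorem designX_gram (hC : ∀ i, FlipsDistinct F (pullbacks (C i))) :
    (designX F C)ᵀ * designX F C = Matrix.diagonal fun c =>
      c.elim (n / 2 ^ N : ℝ) fun p => 4 / 2 ^ N * visibleCount F C p := by
  have h2 : (2 : ℝ) ^ N ≠ 0 := by positivity
  ext c d
  rw [Matrix.mul_apply, Fintype.sum_prod_type]
  simp only [Matrix.transpose_apply]
  rcases c with _ | p <;> rcases d with _ | q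
  · rw [Matrix.diagonal_apply_eq]
    simp only [designX_none, Finset.sum_const, Finset.card_univ, nsmul_eq_mul]
    simp
    field_simp
  · rw [Matrix.diagonal_apply_ne _ (by simp)]
    refine Finset.sum_eq_zero fun i _ => ?_
    simp only [designX_none, designX_some, ← Finset.mul_sum, sum_resp, mul_zero]
  · rw [Matrix.diagonal_apply_ne _ (by simp)]
    refine Finset.sum_eq_zero fun i _ => ?_
    simp only [designX_none, designX_some, ← Finset.mul_sum, ← Finset.sum_mul, sum_resp, mul_zero,
      zero_mul]
  · simp only [designX_some]
    have h3 : ∀ i, ∑ z, 2 / 2 ^ N * resp (pullbacks (C i) p.2) (F p.1) z *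
        (2 / 2 ^ N * resp (pullbacks (C i) q.2) (F q.1) z) = (4 / (2 ^ N * 2 ^ N)) *
        ∑ z, resp (pullbacks (C i) p.2) (F p.1) z * resp (pullbacks (C i) q.2) (F q.1) z := by
      intro i
      rw [Finset.mul_sum]
      refine Finset.sum_congr rfl fun z _ => ?_
      ring
    simp only [h3]
    by_cases hpq : p = q
    · subst hpq
      rw [Matrix.diagonal_apply_eq]
      simp only [sum_resp_mul_self]
      rw [← Finset.mul_sum, ← Finset.mul_sum, Option.elim_some, visibleCount]
      field_simp
    · rw [Matrix.diagonal_apply_ne _ (by simpa using hpq)]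
      refine Finset.sum_eq_zero fun i _ => ?_
      rw [sum_resp_mul_resp fun h => hpq ((hC i).2 h), mul_zero]

/-- In each circuit the columns are indicators of distinct single bitstrings. -/
theorem designZ_gram (hC : ∀ i, FlipsDistinct F (pullbacks (C i))) :
    (designZ F C)ᵀ * designZ F C = Matrix.diagonal fun _ => (n : ℝ) := by
  ext c d
  rw [Matrix.mul_apply, Fintype.sum_prod_type]
  simp only [Matrix.transpose_apply]
  rcases c with _ | p <;> rcases d with _ | q
  · rw [Matrix.diagonal_apply_eq]
    simp [designZ_none]
  · rw [Matrix.diagonal_apply_ne _ (by simp)]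
    refine Finset.sum_eq_zero fun i _ => Finset.sum_eq_zero fun z _ => ?_
    rw [designZ_none, designZ_some]
    dsimp only
    by_cases hz : z = 0
    · have h1 : ¬ z = flips ((pullbacks (C i) q.2).1 (F q.1)).2 := fun h =>
        (hC i).1 q (h.symm.trans hz)
      rw [if_neg h1, mul_zero]
    · rw [if_neg hz, zero_mul]
  · rw [Matrix.diagonal_apply_ne _ (by simp)]
    refine Finset.sum_eq_zero fun i _ => Finset.sum_eq_zero fun z _ => ?_
    rw [designZ_none, designZ_some]
    dsimp only
    by_cases hz : z = 0
    · have h1 : ¬ z = flips ((pullbacks (C i) p.2).1 (F p.1)).2 := fun h =>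
        (hC i).1 p (h.symm.trans hz)
      rw [if_neg h1, zero_mul]
    · rw [if_neg hz, mul_zero]
  · simp only [designZ_some]
    by_cases hpq : p = q
    · subst hpq
      rw [Matrix.diagonal_apply_eq]
      simp
    · rw [Matrix.diagonal_apply_ne _ (by simpa using hpq)]
      refine Finset.sum_eq_zero fun i _ => Finset.sum_eq_zero fun z _ => ?_
      by_cases hz : z = flips ((pullbacks (C i) p.2).1 (F p.1)).2
      · rw [if_neg fun h => hpq ((hC i).2 (hz.symm.trans h)), mul_zero]
      · rw [if_neg hz, zero_mul]

theorem leastSquares_designZ (hC : ∀ i, FlipsDistinct F (pullbacks (C i))) (hn : 0 < n) (y : Fin n × Bits N → ℝ) :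
    leastSquares (designZ F C) y none = (n : ℝ)⁻¹ * ∑ i, y (i, 0) := by
  have hn' : (n : ℝ) ≠ 0 := by exact_mod_cast hn.ne'
  rw [leastSquares_apply (designZ_gram hC) fun _ => hn', Fintype.sum_prod_type]
  simp [designZ_none]

theorem leastSquares_designX (hC : ∀ i, FlipsDistinct F (pullbacks (C i))) (hn : 0 < n) (hv : ∀ p, 0 < visibleCount F C p)
    (y : Fin n × Bits N → ℝ) (p : Fin k × Fin T) :
    leastSquares (designX F C) y (some p) = (2 * visibleCount F C p)⁻¹ *
      ∑ i, ∑ z, resp (pullbacks (C i) p.2) (F p.1) z * y (i, z) := by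
  have hn' : (0 : ℝ) < n := by exact_mod_cast hn
  rw [leastSquares_apply (designX_gram hC), Fintype.sum_prod_type]
  · simp only [designX_some, Option.elim_some, mul_assoc, ← Finset.mul_sum]
    have := hv p
    field_simp
    norm_num
  · rintro (_ | p)
    · simp only [Option.elim_none]; positivity
    · have := hv p
      simp only [Option.elim_some]; positivity

end designs

/-! ## Typical circuits -/

/-- Circuits for which the regressions are well conditioned and the mean fidelity is large. -/
structure TypicalCircuits {N T a b n : ℕ} (P : Fin a → PauliString N) (θ : Fin a → Fin T → ℝ)
    (Q : Fin b → PauliString N) (γ : Fin b → Fin T → ℝ) (C : Fin n → Circuit N T) : Prop where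
  coherent : ∀ i, FlipsDistinct P (pullbacks (C i))
  incoherent : ∀ i, FlipsDistinct Q (pullbacks (C i))
  visible : ∀ p, (n : ℝ) / 4 ≤ visibleCount P C p
  fidelity : (n : ℝ) / 2 ≤ ∑ i, probZ P θ Q γ (C i) 0

theorem abs_sum_resp_mul_le {N : ℕ} (g : Clifford N) (P : PauliString N) {y : Bits N → ℝ} {r : ℝ}
    (hy : ∀ w : Bits N → ℝ, (∀ z, |w z| ≤ 1) → |∑ z, w z * y z| ≤ r) :
    |∑ z, resp g P z * y z| ≤ ycoef (g.1 P).2 ^ 2 * r := by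
  rcases ycoef_sq_eq_zero_or (g.1 P).2 with h | h
  · have h1 : ∀ z, resp g P z = 0 := fun z => by
      have := abs_resp_le g P z
      rw [h] at this
      exact abs_nonpos_iff.1 this
    simp [h1, h]
  · rw [h, one_mul]
    exact hy _ fun z => (abs_resp_le g P z).trans h.le

/-! ### The bias for typical circuits -/

section bias

variable {N T a b n : ℕ} {P : Fin a → PauliString N} {θ : Fin a → Fin T → ℝ}
  {Q : Fin b → PauliString N} {γ : Fin b → Fin T → ℝ} {C : Fin n → Circuit N T}

theorem TypicalCircuits.visible_pos (hC : TypicalCircuits P θ Q γ C) (hn : 0 < n)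
    (p : Fin a × Fin T) : 0 < visibleCount P C p := by
  have : (0 : ℝ) < n := by exact_mod_cast hn
  exact lt_of_lt_of_le (by positivity) (hC.visible p)

theorem fidelityMean_eq (hC : TypicalCircuits P θ Q γ C) (hn : 0 < n) :
    fidelityMean P θ Q γ C = (n : ℝ)⁻¹ * ∑ i, probZ P θ Q γ (C i) 0 :=
  leastSquares_designZ hC.incoherent hn _

theorem half_le_fidelityMean (hC : TypicalCircuits P θ Q γ C) (hn : 0 < n) :
    1 / 2 ≤ fidelityMean P θ Q γ C := by
  have hn' : (0 : ℝ) < n := by exact_mod_cast hn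
  rw [fidelityMean_eq hC hn, inv_mul_eq_div, le_div_iff₀ hn']
  linarith [hC.fidelity]

/-- Only visible circuits contribute to the numerator, and the denominator is twice their number, so
the visible count cancels. -/
theorem abs_leastSquares_designX_le (hC : TypicalCircuits P θ Q γ C) (hn : 0 < n)
    {y : Fin n × Bits N → ℝ} {r : ℝ}
    (hy : ∀ i, ∀ w : Bits N → ℝ, (∀ z, |w z| ≤ 1) → |∑ z, w z * y (i, z)| ≤ r)
    (p : Fin a × Fin T) : |leastSquares (designX P C) y (some p)| ≤ r / 2 := by
  have hv := hC.visible_pos hn p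
  rw [leastSquares_designX hC.coherent hn (hC.visible_pos hn), abs_mul, abs_inv,
    abs_of_pos (by positivity : 0 < 2 * visibleCount P C p), inv_mul_eq_div,
    div_le_div_iff₀ (by positivity) two_pos]
  have h1 := (Finset.abs_sum_le_sum_abs _ _).trans (Finset.sum_le_sum fun i (_ : i ∈ Finset.univ) =>
    abs_sum_resp_mul_le (pullbacks (C i) p.2) (P p.1) (hy i))
  rw [← Finset.sum_mul] at h1
  change _ ≤ visibleCount P C p * r at h1
  linarith

theorem abs_leastSquares_probX_le (hC : TypicalCircuits P θ Q γ C) (hn : 0 < n)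
    (h0 : ∀ β t, 0 ≤ γ β t) (h1 : ∀ β t, γ β t ≤ 1) (p : Fin a × Fin T) :
    |leastSquares (designX P C) (fun r => probX P θ Q γ (C r.1) r.2) (some p)| ≤ 1 / 2 := by
  refine abs_leastSquares_designX_le hC hn (fun i w hw => ?_) p
  refine (Finset.abs_sum_le_sum_abs _ _).trans ?_
  rw [← sum_probX P θ Q (C i) γ]
  refine Finset.sum_le_sum fun z _ => ?_
  have h2 := probX_nonneg P θ Q (C i) h0 h1 z
  rw [abs_mul, abs_of_nonneg h2]
  exact mul_le_of_le_one_left h2 (hw z)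

/-- Orthogonality of the columns makes the regression exact on the linear model; only the residual
`e` contaminates it. -/
theorem leastSquares_designX_model (hC : TypicalCircuits P θ Q γ C) (hn : 0 < n)
    (e : Fin n × Bits N → ℝ) (ϑ : Fin a × Fin T → ℝ) (p : Fin a × Fin T) :
    leastSquares (designX P C) (fun r => 1 / 2 ^ N +
      (∑ q, ϑ q * (2 / 2 ^ N * resp (pullbacks (C r.1) q.2) (P q.1) r.2)) + e r) (some p)
      = ϑ p + leastSquares (designX P C) e (some p) := by
  have hv := hC.visible_pos hn p
  rw [leastSquares_designX hC.coherent hn (hC.visible_pos hn),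
    leastSquares_designX hC.coherent hn (hC.visible_pos hn)]
  have h1 : ∀ i, ∑ z, resp (pullbacks (C i) p.2) (P p.1) z * (1 / 2 ^ N +
      (∑ q, ϑ q * (2 / 2 ^ N * resp (pullbacks (C i) q.2) (P q.1) z)) + e (i, z))
      = 2 * ϑ p * ycoef ((pullbacks (C i) p.2).1 (P p.1)).2 ^ 2
        + ∑ z, resp (pullbacks (C i) p.2) (P p.1) z * e (i, z) := by
    intro i
    simp only [mul_add, Finset.sum_add_distrib, ← Finset.sum_mul, sum_resp, zero_mul, zero_add,
      Finset.mul_sum]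
    congr 1
    rw [Finset.sum_comm, Finset.sum_eq_single p]
    · have h2 : ∀ z, resp (pullbacks (C i) p.2) (P p.1) z *
          (ϑ p * (2 / 2 ^ N * resp (pullbacks (C i) p.2) (P p.1) z)) = ϑ p * (2 / 2 ^ N) *
          (resp (pullbacks (C i) p.2) (P p.1) z * resp (pullbacks (C i) p.2) (P p.1) z) :=
        fun z => by ring
      simp only [h2]
      rw [← Finset.mul_sum, sum_resp_mul_self]
      have : (2 : ℝ) ^ N ≠ 0 := by positivity
      field_simp
    · intro q _ hq
      have h2 : ∀ z, resp (pullbacks (C i) p.2) (P p.1) z *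
          (ϑ q * (2 / 2 ^ N * resp (pullbacks (C i) q.2) (P q.1) z)) = ϑ q * (2 / 2 ^ N) *
          (resp (pullbacks (C i) p.2) (P p.1) z * resp (pullbacks (C i) q.2) (P q.1) z) :=
        fun z => by ring
      simp only [h2]
      rw [← Finset.mul_sum, sum_resp_mul_resp fun h => hq ((hC.coherent i).2 h).symm, mul_zero]
    · simp
  simp only [h1]
  rw [Finset.sum_add_distrib, ← Finset.mul_sum, mul_add]
  congr 1
  change (2 * visibleCount P C p)⁻¹ * (2 * ϑ p * visibleCount P C p) = _
  field_simp

theorem abs_le_sum_signals (h0 : ∀ β t, 0 ≤ γ β t) (θ : Fin a → Fin T → ℝ) (α : Fin a)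
    (t : Fin T) : |θ α t| ≤ (∑ α, ∑ t, |θ α t|) + ∑ β, ∑ t, γ β t := by
  have h1 := Finset.single_le_sum (f := fun t => |θ α t|) (fun _ _ => abs_nonneg _)
    (Finset.mem_univ t)
  have h2 := Finset.single_le_sum (f := fun α => ∑ t, |θ α t|)
    (fun _ _ => Finset.sum_nonneg fun _ _ => abs_nonneg _) (Finset.mem_univ α)
  have h3 : 0 ≤ ∑ β, ∑ t, γ β t := Finset.sum_nonneg fun β _ => Finset.sum_nonneg fun t _ => h0 β t
  linarith

theorem abs_thetaBias_le (hC : TypicalCircuits P θ Q γ C) (hn : 0 < n)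
    (h0 : ∀ β t, 0 ≤ γ β t) (h1 : ∀ β t, γ β t ≤ 1) (α : Fin a) (t : Fin T) :
    |thetaBias P θ Q γ C α t| ≤ 7 * ((∑ α, ∑ t, |θ α t|) + ∑ β, ∑ t, γ β t) ^ 2 := by
  have hA := half_le_fidelityMean hC hn
  have hA0 : 0 < fidelityMean P θ Q γ C := by linarith
  have hθ := abs_le_sum_signals h0 θ α t
  rw [thetaBias]
  have hx := abs_leastSquares_probX_le hC hn h0 h1 (α, t)
  set x := leastSquares (designX P C) (fun r => probX P θ Q γ (C r.1) r.2) (some (α, t)) with hxdef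
  set S := (∑ α, ∑ t, |θ α t|) + ∑ β, ∑ t, γ β t with hSdef
  have hS0 : 0 ≤ S := (abs_nonneg _).trans hθ
  have e1 : x / fidelityMean P θ Q γ C - θ α t
      = (x - θ α t * fidelityMean P θ Q γ C) / fidelityMean P θ Q γ C := by
    field_simp
  -- In the perturbative case the numerator is off by `3 S²/2` and the fidelity by `2 S`, giving `7
  -- S²/2` before division by a fidelity of at least `1/2`.
  by_cases hS : S ≤ 1
  · have hE := fun i => abs_probZ_zero_sub_one_le_and_exists P θ Q h0 hS (C i)
    choose hZ E hE1 hE2 using hE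
    have h3 : x = θ α t + leastSquares (designX P C)
        (fun r => ((hadamardOp N * E r.1 * hadamardOp N) r.2 r.2).re) (some (α, t)) := by
      refine Eq.trans ?_ (leastSquares_designX_model hC hn
        (fun r => ((hadamardOp N * E r.1 * hadamardOp N) r.2 r.2).re) (fun p => θ p.1 p.2) (α, t))
      rw [hxdef]
      congr 1
      exact funext fun r => hE2 r.1 r.2
    have h4 := abs_leastSquares_designX_le hC hn
      (y := fun r => ((hadamardOp N * E r.1 * hadamardOp N) r.2 r.2).re) (r := 3 * S ^ 2)
      (fun i w hw => (abs_sum_mul_diag_le (E i) hw).trans (hE1 i)) (α, t)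
    have h5 : |x - θ α t| ≤ 3 * S ^ 2 / 2 := by rwa [h3, add_sub_cancel_left]
    have h6 : |fidelityMean P θ Q γ C - 1| ≤ 2 * S := by
      have hn' : (0 : ℝ) < n := by exact_mod_cast hn
      have h7 : fidelityMean P θ Q γ C - 1 = (∑ i, (probZ P θ Q γ (C i) 0 - 1)) / n := by
        rw [fidelityMean_eq hC hn, Finset.sum_sub_distrib, inv_mul_eq_div, sub_div]
        simp [hn'.ne']
      rw [h7, abs_div, abs_of_pos hn', div_le_iff₀ hn']
      refine (Finset.abs_sum_le_sum_abs _ _).trans ((Finset.sum_le_sum fun i _ => hZ i).trans ?_)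
      rw [Finset.sum_const, Finset.card_univ, Fintype.card_fin, nsmul_eq_mul, mul_comm]
    rw [e1, abs_div, abs_of_pos hA0, div_le_iff₀ hA0]
    have e2 : x - θ α t * fidelityMean P θ Q γ C
        = (x - θ α t) - θ α t * (fidelityMean P θ Q γ C - 1) := by ring
    have h8 : |θ α t * (fidelityMean P θ Q γ C - 1)| ≤ S * (2 * S) := by
      rw [abs_mul]; exact mul_le_mul hθ h6 (abs_nonneg _) hS0
    have h9 : 7 * S ^ 2 * (1 / 2) ≤ 7 * S ^ 2 * fidelityMean P θ Q γ C :=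
      mul_le_mul_of_nonneg_left hA (by positivity)
    rw [e2]
    refine (abs_sub _ _).trans ?_
    linarith
  -- For `S > 1` first-order theory is not available, but the trivial bound `1 + S` is already below
  -- `7 S²`.
  · have h3 : |x / fidelityMean P θ Q γ C| ≤ 1 := by
      rw [abs_div, abs_of_pos hA0, div_le_one hA0]
      linarith
    refine (abs_sub _ _).trans ?_
    nlinarith

end bias

/-! ## Shot noise -/

/-- The weights of the shots of `n` circuits with outcome distributions `w`. -/
noncomputable def shotsWeight {N n m : ℕ} (w : Fin n → Bits N → ℝ) (s : Shots N n m) : ℝ :=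
  ∏ i, ∏ j, w i (s i j)

section shots

variable {N n m : ℕ} {w : Fin n → Bits N → ℝ}

theorem shotsWeight_nonneg (hw0 : ∀ i x, 0 ≤ w i x) (s : Shots N n m) : 0 ≤ shotsWeight w s :=
  Finset.prod_nonneg fun i _ => Finset.prod_nonneg fun _ _ => hw0 i _

theorem shotsWeight_curry (s : Fin n × Fin m → Bits N) :
    shotsWeight w (Equiv.curry _ _ _ s) = prodWeight (fun p : Fin n × Fin m => w p.1) s := by
  rw [prodWeight, Fintype.prod_prod_type]
  rfl

theorem sum_shotsWeight (hw : ∀ i, ∑ x, w i x = 1) :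
    ∑ s : Shots N n m, shotsWeight w s = 1 := by
  rw [← Equiv.sum_comp (Equiv.curry (Fin n) (Fin m) (Bits N))]
  simp only [shotsWeight_curry]
  exact sum_prodWeight fun p => hw p.1

/-- The deviation of a statistic of the shots from its mean. -/
noncomputable def deviation (w g : Fin n → Bits N → ℝ) (s : Shots N n m) : ℝ :=
  ∑ i, ∑ j, (g i (s i j) - ∑ z, g i z * w i z)

theorem abs_sum_mul_le_of_weights (hw0 : ∀ i x, 0 ≤ w i x) (hw : ∀ i, ∑ x, w i x = 1)
    {g : Fin n → Bits N → ℝ} (hg : ∀ i z, |g i z| ≤ 1) (i : Fin n) : |∑ z, g i z * w i z| ≤ 1 := by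
  rw [← hw i]
  refine (Finset.abs_sum_le_sum_abs _ _).trans (Finset.sum_le_sum fun z _ => ?_)
  rw [abs_mul, abs_of_nonneg (hw0 i z)]
  exact mul_le_of_le_one_left (hw0 i z) (hg i z)

theorem pr_shotsWeight (E : Shots N n m → Prop) :
    pr (shotsWeight w) E = pr (prodWeight fun p : Fin n × Fin m => w p.1)
      (fun s => E (Equiv.curry (Fin n) (Fin m) (Bits N) s)) := by
  rw [← pr_comp_equiv (Equiv.curry (Fin n) (Fin m) (Bits N))]
  simp only [shotsWeight_curry]

theorem deviation_curry (w g : Fin n → Bits N → ℝ) (s : Fin n × Fin m → Bits N) :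
    deviation w g (Equiv.curry (Fin n) (Fin m) (Bits N) s)
      = ∑ p : Fin n × Fin m, (g p.1 (s p) - ∑ z, g p.1 z * w p.1 z) := by
  rw [Fintype.sum_prod_type]
  rfl

/-- Centred statistics lie in `[-2, 2]`. Halving them and using Chernoff's bound at `η / 4` with `n
m` shots gives the exponent `(η / 4)² / 4 = η² / 64` per shot. -/
theorem pr_deviation_ge_le (hw0 : ∀ i x, 0 ≤ w i x) (hw : ∀ i, ∑ x, w i x = 1)
    {g : Fin n → Bits N → ℝ} (hg : ∀ i z, |g i z| ≤ 1) {η : ℝ} (h0 : 0 ≤ η) (h1 : η ≤ 1) :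
    pr (shotsWeight w) (fun s : Shots N n m => n * m * η / 2 ≤ deviation w g s)
      ≤ Real.exp (-(n * m * η ^ 2 / 64)) := by
  rw [pr_shotsWeight]
  have hmean := abs_sum_mul_le_of_weights hw0 hw hg
  have hX : ∀ (p : Fin n × Fin m) x, |(g p.1 x - ∑ z, g p.1 z * w p.1 z) / 2| ≤ 1 := by
    intro p x
    rw [abs_div, abs_two, div_le_one two_pos]
    linarith [abs_sub (g p.1 x) (∑ z, g p.1 z * w p.1 z), hg p.1 x, hmean p.1]
  have hX0 : ∀ p : Fin n × Fin m, ∑ x, w p.1 x * ((g p.1 x - ∑ z, g p.1 z * w p.1 z) / 2) ≤ 0 := by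
    intro p
    have : ∀ x, w p.1 x * ((g p.1 x - ∑ z, g p.1 z * w p.1 z) / 2)
        = (g p.1 x * w p.1 x - w p.1 x * ∑ z, g p.1 z * w p.1 z) / 2 := fun x => by ring
    simp only [this]
    rw [← Finset.sum_div, Finset.sum_sub_distrib, ← Finset.sum_mul, hw]
    simp
  have h2 := pr_sum_ge_le (w := fun p : Fin n × Fin m => w p.1) (fun p => hw0 p.1)
    (fun p => hw p.1) _ hX hX0 (η := η / 4) (by linarith) (by linarith)
  have e : (Fintype.card (Fin n × Fin m) : ℝ) = n * m := by simp
  rw [e] at h2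
  have e2 : (n * m * (η / 4) ^ 2 / 4 : ℝ) = n * m * η ^ 2 / 64 := by ring
  rw [e2] at h2
  have h4 : ∀ s, 0 ≤ prodWeight (fun p : Fin n × Fin m => w p.1) s :=
    prodWeight_nonneg fun p x => hw0 p.1 x
  refine le_trans (pr_mono h4 fun s hs => ?_) h2
  rw [deviation_curry] at hs
  rw [← Finset.sum_div]
  have h3 : (n * m * η / 2 : ℝ) / 2 = n * m * (η / 4) := by ring
  rw [← h3]
  exact div_le_div_of_nonneg_right hs two_pos.le

theorem pr_abs_deviation_ge_le (hw0 : ∀ i x, 0 ≤ w i x) (hw : ∀ i, ∑ x, w i x = 1)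
    {g : Fin n → Bits N → ℝ} (hg : ∀ i z, |g i z| ≤ 1) {η : ℝ} (h0 : 0 ≤ η) (h1 : η ≤ 1) :
    pr (shotsWeight w) (fun s : Shots N n m => n * m * η / 2 ≤ |deviation w g s|)
      ≤ 2 * Real.exp (-(n * m * η ^ 2 / 64)) := by
  have h2 := pr_deviation_ge_le (m := m) hw0 hw hg h0 h1
  have h3 := pr_deviation_ge_le (m := m) hw0 hw (g := fun i z => -g i z)
    (fun i z => by rw [abs_neg]; exact hg i z) h0 h1
  have e : ∀ s : Shots N n m, deviation w (fun i z => -g i z) s = -deviation w g s := fun s => by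
    simp only [deviation, neg_mul, ← Finset.sum_neg_distrib]
    refine Finset.sum_congr rfl fun i _ => Finset.sum_congr rfl fun j _ => ?_
    rw [Finset.sum_neg_distrib]; ring
  simp only [e] at h3
  refine (pr_mono (shotsWeight_nonneg hw0) fun s hs => ?_).trans
    ((pr_or_le (shotsWeight_nonneg hw0) _ _).trans ((add_le_add h2 h3).trans (by linarith)))
  exact le_abs.1 hs

theorem sum_mul_empirical (s : Shots N n m) (g : Bits N → ℝ) (i : Fin n) :
    ∑ z, g z * empirical s (i, z) = (∑ j, g (s i j)) / m := by
  simp only [empirical, Finset.card_filter]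
  push_cast
  simp only [← mul_div_assoc, ← Finset.sum_div, Finset.mul_sum]
  rw [Finset.sum_comm]
  congr 1
  refine Finset.sum_congr rfl fun j _ => ?_
  simp

theorem sum_mul_empirical_sub (hm : 0 < m) (s : Shots N n m) (g : Fin n → Bits N → ℝ) :
    ∑ i, ∑ z, g i z * empirical s (i, z) - ∑ i, ∑ z, g i z * w i z = deviation w g s / m := by
  have hm' : (m : ℝ) ≠ 0 := by exact_mod_cast hm.ne'
  simp only [sum_mul_empirical, deviation, Finset.sum_sub_distrib]
  rw [sub_div, ← Finset.sum_div]
  congr 1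
  simp only [Finset.sum_const, Finset.card_univ, Fintype.card_fin, nsmul_eq_mul]
  rw [← Finset.mul_sum, mul_div_cancel_left₀ _ hm']

end shots

/-! ### From shot noise to the errors of the estimators -/

section estimators

variable {N T a b n m : ℕ} {P : Fin a → PauliString N} {θ : Fin a → Fin T → ℝ}
  {Q : Fin b → PauliString N} {γ : Fin b → Fin T → ℝ} {C : Fin n → Circuit N T}

open Classical in
/-- The statistic of the z-basis shots that estimates the signal fidelity. -/
noncomputable def zeroIndicator {N n : ℕ} (_i : Fin n) (z : Bits N) : ℝ := if z = 0 then 1 else 0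

theorem sum_zeroIndicator_mul (i : Fin n) (y : Bits N → ℝ) :
    ∑ z, zeroIndicator i z * y z = y 0 := by simp [zeroIndicator]

theorem abs_fidelityEst_sub_le (hC : TypicalCircuits P θ Q γ C) (hn : 0 < n) (hm : 0 < m)
    {s : Shots N n m} {η : ℝ}
    (hs : |deviation (fun i => probZ P θ Q γ (C i)) zeroIndicator s| ≤ n * m * η / 2) :
    |fidelityEst Q C s - fidelityMean P θ Q γ C| ≤ η / 2 := by
  have hn' : (0 : ℝ) < n := by exact_mod_cast hn
  have hm' : (0 : ℝ) < m := by exact_mod_cast hm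
  have h1 := sum_mul_empirical_sub (w := fun i => probZ P θ Q γ (C i)) hm s zeroIndicator
  simp only [sum_zeroIndicator_mul] at h1
  rw [fidelityMean_eq hC hn, fidelityEst, leastSquares_designZ hC.incoherent hn, ← mul_sub, h1,
    abs_mul, abs_div, abs_inv, abs_of_pos hn', abs_of_pos hm', inv_mul_eq_div, div_div,
    div_le_iff₀ (by positivity)]
  linarith

theorem abs_leastSquares_empirical_sub_le (hC : TypicalCircuits P θ Q γ C) (hn : 0 < n)
    (hm : 0 < m) {s : Shots N n m} {η : ℝ} (p : Fin a × Fin T)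
    (hs : |deviation (fun i => probX P θ Q γ (C i))
      (fun i => resp (pullbacks (C i) p.2) (P p.1)) s| ≤ n * m * η / 2) :
    |leastSquares (designX P C) (empirical s) (some p)
      - leastSquares (designX P C) (fun r => probX P θ Q γ (C r.1) r.2) (some p)| ≤ η := by
  have hm' : (0 : ℝ) < m := by exact_mod_cast hm
  have hn' : (0 : ℝ) < n := by exact_mod_cast hn
  have hv := hC.visible_pos hn p
  have h1 := sum_mul_empirical_sub (w := fun i => probX P θ Q γ (C i)) hm s
    (fun i => resp (pullbacks (C i) p.2) (P p.1))
  have hη : 0 ≤ η := by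
    have h2 := (abs_nonneg _).trans hs
    by_contra h3
    nlinarith [mul_pos hn' hm']
  rw [leastSquares_designX hC.coherent hn (hC.visible_pos hn),
    leastSquares_designX hC.coherent hn (hC.visible_pos hn), ← mul_sub, h1, abs_mul, abs_div,
    abs_inv, abs_of_pos hm', abs_of_pos (by positivity : 0 < 2 * visibleCount P C p),
    inv_mul_eq_div, div_div, div_le_iff₀ (by positivity)]
  refine hs.trans ?_
  have h2 := mul_le_mul_of_nonneg_right (hC.visible p) (mul_nonneg hm'.le hη)
  linarith

theorem abs_thetaEst_sub_le (hC : TypicalCircuits P θ Q γ C) (hn : 0 < n) (hm : 0 < m)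
    (h0 : ∀ β t, 0 ≤ γ β t) (h1 : ∀ β t, γ β t ≤ 1) {sx sz : Shots N n m} {η : ℝ} (hη : η ≤ 1 / 8)
    (α : Fin a) (t : Fin T)
    (hsx : |deviation (fun i => probX P θ Q γ (C i))
      (fun i => resp (pullbacks (C i) t) (P α)) sx| ≤ n * m * η / 2)
    (hsz : |deviation (fun i => probZ P θ Q γ (C i)) zeroIndicator sz| ≤ n * m * η / 2) :
    0 < fidelityEst Q C sz ∧
      |thetaEst P Q C sx sz α t - θ α t| ≤ 8 * η + |thetaBias P θ Q γ C α t| := by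
  have hA := half_le_fidelityMean hC hn
  have hz := abs_fidelityEst_sub_le hC hn hm hsz
  have hx := abs_leastSquares_empirical_sub_le hC hn hm (α, t) hsx
  have hx1 := abs_leastSquares_probX_le hC hn h0 h1 (α, t)
  rw [thetaEst, thetaBias]
  set A := fidelityMean P θ Q γ C
  set A' := fidelityEst Q C sz
  set x := leastSquares (designX P C) (fun r => probX P θ Q γ (C r.1) r.2) (some (α, t))
  set x' := leastSquares (designX P C) (empirical sx) (some (α, t))
  have hA' : 3 / 8 ≤ A' := by linarith [(abs_le.1 hz).1]
  have hA0 : 0 < A := by linarith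
  have hA'0 : 0 < A' := by linarith
  have hη0 : 0 ≤ η := (abs_nonneg _).trans hx
  refine ⟨hA'0, ?_⟩
  -- The terms are numerator noise, denominator noise and bias. The bounds `A' ≥ 3/8` and `|x / A| ≤
  -- 1` make each noise term at most `8 η / 3`.
  have e : x' / A' - θ α t = (x' - x) / A' + x / A * ((A - A') / A') + (x / A - θ α t) := by
    field_simp
    ring
  rw [e]
  have h2 : |(x' - x) / A'| ≤ 8 / 3 * η := by
    rw [abs_div, abs_of_pos hA'0, div_le_iff₀ hA'0]
    nlinarith [mul_le_mul_of_nonneg_left hA' hη0]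
  have h3 : |x / A| ≤ 1 := by
    rw [abs_div, abs_of_pos hA0, div_le_one hA0]; linarith
  have h4 : |(A - A') / A'| ≤ 8 / 3 * η := by
    rw [abs_div, abs_of_pos hA'0, div_le_iff₀ hA'0, abs_sub_comm]
    nlinarith [mul_le_mul_of_nonneg_left hA' hη0]
  have h5 : |x / A * ((A - A') / A')| ≤ 8 / 3 * η := by
    rw [abs_mul]
    exact (mul_le_of_le_one_left (abs_nonneg _) h3).trans h4
  refine (abs_add_le _ _).trans (add_le_add_left ((abs_add_le _ _).trans ?_) _)
  linarith

end estimators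

/-! ## Random circuits are typical -/

theorem pr_not_typical_le {N T a b : ℕ} (n : ℕ) (hN : 1 ≤ N) {P : Fin a → PauliString N}
    (θ : Fin a → Fin T → ℝ) {Q : Fin b → PauliString N} {γ : Fin b → Fin T → ℝ}
    (hP : Function.Injective P) (hP0 : ∀ α, P α ≠ 0) (hQ : Function.Injective Q)
    (hQ0 : ∀ β, Q β ≠ 0) (h0 : ∀ β t, 0 ≤ γ β t)
    (hc : (∑ β, ∑ t, γ β t) + (∑ α, ∑ t, θ α t ^ 2) ≤ 1 / 4) :
    pr (prodWeight fun _ : Fin n => unif (Circuit N T)) (fun C => ¬ TypicalCircuits P θ Q γ C)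
      ≤ n * (((a * T : ℕ) + (a * T : ℕ) ^ 2) * (2 / 2 ^ N))
        + n * (((b * T : ℕ) + (b * T : ℕ) ^ 2) * (2 / 2 ^ N))
        + (a * T : ℕ) * Real.exp (-(n / 576)) + Real.exp (-(n / 576)) := by
  have hw0 : ∀ (_ : Fin n) (C : Circuit N T), 0 ≤ unif (Circuit N T) C := fun _ => unif_nonneg
  have hw : ∀ _ : Fin n, ∑ C, unif (Circuit N T) C = 1 := fun _ => sum_unif _
  have hW := prodWeight_nonneg hw0
  have hγ1 : ∑ β, ∑ t, γ β t ≤ 1 := by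
    have : 0 ≤ ∑ α, ∑ t, θ α t ^ 2 :=
      Finset.sum_nonneg fun _ _ => Finset.sum_nonneg fun _ _ => sq_nonneg _
    linarith
  have hγ : ∀ β t, γ β t ≤ 1 := fun β t => by
    have h1 := Finset.single_le_sum (fun t _ => h0 β t) (Finset.mem_univ t)
    have h2 := Finset.single_le_sum (f := fun β => ∑ t, γ β t)
      (fun β _ => Finset.sum_nonneg fun t _ => h0 β t) (Finset.mem_univ β)
    linarith
  have hsplit : ∀ C : Fin n → Circuit N T, ¬ TypicalCircuits P θ Q γ C →
      (((∃ i, ¬ FlipsDistinct P (pullbacks (C i))) ∨ ∃ i, ¬ FlipsDistinct Q (pullbacks (C i))) ∨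
        ∃ p, visibleCount P C p < n / 4) ∨ ∑ i, probZ P θ Q γ (C i) 0 < n / 2 := by
    intro C hC
    by_contra! h
    exact hC ⟨h.1.1.1, h.1.1.2, h.1.2, h.2⟩
  have hcoll : ∀ {k : ℕ} {F : Fin k → PauliString N}, Function.Injective F → (∀ β, F β ≠ 0) →
      pr (prodWeight fun _ : Fin n => unif (Circuit N T))
        (fun C => ∃ i, ¬ FlipsDistinct F (pullbacks (C i)))
        ≤ n * (((k * T : ℕ) + (k * T : ℕ) ^ 2) * (2 / 2 ^ N)) := by
    intro k F hF hF0
    refine (pr_exists_le hW _).trans ?_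
    have h1 : ∀ i : Fin n, pr (prodWeight fun _ : Fin n => unif (Circuit N T))
        (fun C => ¬ FlipsDistinct F (pullbacks (C i)))
        ≤ ((k * T : ℕ) + (k * T : ℕ) ^ 2) * (2 / 2 ^ N) := fun i => by
      rw [pr_prodWeight_apply hw i fun C => ¬ FlipsDistinct F (pullbacks C)]
      exact pr_not_flipsDistinct_le hN hF hF0
    refine (Finset.sum_le_sum fun i _ => h1 i).trans (le_of_eq ?_)
    rw [Finset.sum_const, Finset.card_univ, Fintype.card_fin, nsmul_eq_mul]
  have hvis : ∀ p : Fin a × Fin T, pr (prodWeight fun _ : Fin n => unif (Circuit N T))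
      (fun C => visibleCount P C p < n / 4) ≤ Real.exp (-(n / 576)) := by
    intro p
    -- The gap between the mean `1/3` and the required fraction `1/4` is `1/12`, whence the exponent
    -- `(1/12)² / 4 = 1/576`.
    have h1 := pr_sum_ge_le hw0 hw
      (fun (_ : Fin n) C => 1 / 3 - ycoef ((pullbacks C p.2).1 (P p.1)).2 ^ 2)
      (fun _ C => by
        rcases ycoef_sq_eq_zero_or ((pullbacks C p.2).1 (P p.1)).2 with h | h <;> rw [h] <;>
          norm_num [abs_le])
      (fun _ => by
        have h2 := one_third_le_sum_ycoef hN (hP0 p.1)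
        rw [← sum_unif_eval p.2 fun g => ycoef (g.1 (P p.1)).2 ^ 2] at h2
        simp only [mul_sub, Finset.sum_sub_distrib, ← Finset.sum_mul, sum_unif, one_mul]
        linarith)
      (η := 1 / 12) (by norm_num) (by norm_num)
    rw [Fintype.card_fin] at h1
    refine le_trans (pr_mono hW fun C hC => ?_) (h1.trans (le_of_eq ?_))
    · rw [Finset.sum_sub_distrib, Finset.sum_const, Finset.card_univ, Fintype.card_fin,
        nsmul_eq_mul]
      rw [visibleCount] at hC
      linarith
    · congr 1; ring
  have hfid : pr (prodWeight fun _ : Fin n => unif (Circuit N T))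
      (fun C => ∑ i, probZ P θ Q γ (C i) 0 < n / 2) ≤ Real.exp (-(n / 576)) := by
    -- The bound `1/4` on the signal strength gives mean fidelity at least `3/4`, leaving a gap
    -- `1/4` above the required `1/2`.
    have h1 := pr_sum_ge_le hw0 hw (fun (_ : Fin n) C => 3 / 4 - probZ P θ Q γ C 0)
      (fun _ C => by
        have h2 := probZ_nonneg P θ Q C h0 hγ 0
        have h3 : probZ P θ Q γ C 0 ≤ 1 := by
          rw [← sum_probZ P θ Q C γ]
          exact Finset.single_le_sum (fun z _ => probZ_nonneg P θ Q C h0 hγ z) (Finset.mem_univ 0)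
        rw [abs_le]; constructor <;> linarith)
      (fun _ => by
        have h2 := sum_probZ_zero_ge θ Q hP h0 hγ1
        simp only [mul_sub, Finset.sum_sub_distrib, ← Finset.sum_mul, sum_unif, one_mul]
        linarith)
      (η := 1 / 4) (by norm_num) (by norm_num)
    rw [Fintype.card_fin] at h1
    refine le_trans (pr_mono hW fun C hC => ?_) (h1.trans ?_)
    · rw [Finset.sum_sub_distrib, Finset.sum_const, Finset.card_univ, Fintype.card_fin,
        nsmul_eq_mul]
      linarith
    · apply Real.exp_le_exp.2
      have : (0 : ℝ) ≤ n := Nat.cast_nonneg n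
      linarith
  refine (pr_mono hW hsplit).trans ((pr_or_le hW _ _).trans (add_le_add ?_ hfid))
  refine (pr_or_le hW _ _).trans (add_le_add ((pr_or_le hW _ _).trans
    (add_le_add (hcoll hP hP0) (hcoll hQ hQ0))) ?_)
  refine (pr_exists_le hW _).trans ((Finset.sum_le_sum fun p _ => hvis p).trans (le_of_eq ?_))
  rw [Finset.sum_const, Finset.card_univ, Fintype.card_prod, Fintype.card_fin, Fintype.card_fin,
    nsmul_eq_mul]

/-! ## The random experiment -/

/-- Condition on the circuits: on good ones the indicator of `E` is at least one minus the
indicators of the two bad shot events, so a union bound suffices for the shots. -/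
theorem experimentProb_ge {N T a b n m : ℕ} {P : Fin a → PauliString N} {θ : Fin a → Fin T → ℝ}
    {Q : Fin b → PauliString N} {γ : Fin b → Fin T → ℝ} (h0 : ∀ β t, 0 ≤ γ β t)
    (h1 : ∀ β t, γ β t ≤ 1) {E : (Fin n → Circuit N T) → Shots N n m → Shots N n m → Prop}
    (G : (Fin n → Circuit N T) → Prop) (Bx Bz : (Fin n → Circuit N T) → Shots N n m → Prop)
    (hE : ∀ C sx sz, G C → ¬ Bx C sx → ¬ Bz C sz → E C sx sz) {δ₁ δ₂ : ℝ} (hδ₂ : δ₂ ≤ 1)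
    (hG : pr (prodWeight fun _ : Fin n => unif (Circuit N T)) (fun C => ¬ G C) ≤ δ₁)
    (hB : ∀ C, G C → pr (shotsWeight fun i => probX P θ Q γ (C i)) (Bx C) +
      pr (shotsWeight fun i => probZ P θ Q γ (C i)) (Bz C) ≤ δ₂) :
    (1 - δ₁) * (1 - δ₂) ≤ experimentProb P θ Q γ n m E := by
  classical
  have hx0 : ∀ (C : Fin n → Circuit N T) (s : Shots N n m),
      0 ≤ shotsWeight (fun i => probX P θ Q γ (C i)) s :=
    fun C => shotsWeight_nonneg fun i => probX_nonneg P θ Q (C i) h0 h1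
  have hz0 : ∀ (C : Fin n → Circuit N T) (s : Shots N n m),
      0 ≤ shotsWeight (fun i => probZ P θ Q γ (C i)) s :=
    fun C => shotsWeight_nonneg fun i => probZ_nonneg P θ Q (C i) h0 h1
  have hx1 : ∀ C : Fin n → Circuit N T,
      ∑ s : Shots N n m, shotsWeight (fun i => probX P θ Q γ (C i)) s = 1 :=
    fun C => sum_shotsWeight fun i => sum_probX P θ Q (C i) γ
  have hz1 : ∀ C : Fin n → Circuit N T,
      ∑ s : Shots N n m, shotsWeight (fun i => probZ P θ Q γ (C i)) s = 1 :=
    fun C => sum_shotsWeight fun i => sum_probZ P θ Q (C i) γ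
  have hU : ∀ C : Fin n → Circuit N T, (Fintype.card (Fin n → Circuit N T) : ℝ)⁻¹
      = prodWeight (fun _ : Fin n => unif (Circuit N T)) C := fun C => by
    simp [prodWeight, unif]
  have hinner : ∀ C, G C → 1 - δ₂ ≤ ∑ sx : Shots N n m, ∑ sz : Shots N n m,
      shotsWeight (fun i => probX P θ Q γ (C i)) sx *
        shotsWeight (fun i => probZ P θ Q γ (C i)) sz * (if E C sx sz then 1 else 0) := by
    intro C hC
    set wx : Shots N n m → ℝ := shotsWeight fun i => probX P θ Q γ (C i) with hwx
    set wz : Shots N n m → ℝ := shotsWeight fun i => probZ P θ Q γ (C i) with hwz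
    have h2 : ∀ sx sz, wx sx * wz sz * (1 - (if Bx C sx then 1 else 0) - (if Bz C sz then 1 else 0))
        ≤ wx sx * wz sz * (if E C sx sz then 1 else 0) := by
      intro sx sz
      refine mul_le_mul_of_nonneg_left ?_ (mul_nonneg (hx0 C sx) (hz0 C sz))
      by_cases hb : Bx C sx
      · rw [if_pos hb]; split_ifs <;> norm_num
      · by_cases hb' : Bz C sz
        · rw [if_pos hb']; split_ifs <;> norm_num
        · rw [if_neg hb, if_neg hb', if_pos (hE C sx sz hC hb hb')]; norm_num
    refine le_trans ?_ (Finset.sum_le_sum fun sx _ => Finset.sum_le_sum fun sz _ => h2 sx sz)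
    have h3 : ∑ sx, ∑ sz, wx sx * wz sz *
        (1 - (if Bx C sx then 1 else 0) - (if Bz C sz then 1 else 0))
        = 1 - pr wx (Bx C) - pr wz (Bz C) := by
      have h4 : ∀ sx, ∑ sz, wx sx * wz sz *
          (1 - (if Bx C sx then 1 else 0) - (if Bz C sz then 1 else 0))
          = wx sx - wx sx * (if Bx C sx then 1 else 0) - wx sx * pr wz (Bz C) := by
        intro sx
        have h5 : ∀ sz, wx sx * wz sz *
            (1 - (if Bx C sx then 1 else 0) - (if Bz C sz then 1 else 0))
            = (wx sx - wx sx * (if Bx C sx then 1 else 0)) * wz sz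
              - wx sx * (wz sz * (if Bz C sz then 1 else 0)) := fun sz => by ring
        simp only [h5]
        rw [Finset.sum_sub_distrib, ← Finset.mul_sum, ← Finset.mul_sum, hz1 C, mul_one]
        rfl
      simp only [h4]
      rw [Finset.sum_sub_distrib, Finset.sum_sub_distrib, ← Finset.sum_mul, hx1 C, one_mul]
      rfl
    rw [h3]
    linarith [hB C hC]
  have houter : ∀ C, prodWeight (fun _ : Fin n => unif (Circuit N T)) C * (if G C then 1 else 0)
      * (1 - δ₂) ≤ ∑ sx : Shots N n m, ∑ sz : Shots N n m,
        (Fintype.card (Fin n → Circuit N T) : ℝ)⁻¹ *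
        (∏ i, ∏ j, probX P θ Q γ (C i) (sx i j)) * (∏ i, ∏ j, probZ P θ Q γ (C i) (sz i j)) *
        (if E C sx sz then 1 else 0) := by
    intro C
    have hWC : 0 ≤ prodWeight (fun _ : Fin n => unif (Circuit N T)) C :=
      prodWeight_nonneg (fun _ => unif_nonneg) C
    rw [hU C]
    by_cases hC : G C
    · rw [if_pos hC, mul_one]
      refine (mul_le_mul_of_nonneg_left (hinner C hC) hWC).trans (le_of_eq ?_)
      simp only [Finset.mul_sum, shotsWeight]
      exact Finset.sum_congr rfl fun _ _ => Finset.sum_congr rfl fun _ _ => by ring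
    · rw [if_neg hC, mul_zero, zero_mul]
      exact Finset.sum_nonneg fun sx _ => Finset.sum_nonneg fun sz _ =>
        mul_nonneg (mul_nonneg (mul_nonneg hWC (hx0 C sx)) (hz0 C sz)) (by split_ifs <;> norm_num)
  have hfin : (1 - δ₁) * (1 - δ₂) ≤ pr (prodWeight fun _ : Fin n => unif (Circuit N T)) G * (1 - δ₂) := by
    refine mul_le_mul_of_nonneg_right ?_ (by linarith)
    have := pr_add_pr_not (sum_prodWeight (w := fun _ : Fin n => unif (Circuit N T))
      fun _ => sum_unif _) G
    linarith
  refine hfin.trans ?_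
  rw [pr, Finset.sum_mul, experimentProb]
  refine Finset.sum_le_sum fun C _ => ?_
  convert houter C

/-! ## Numerical estimates -/

theorem sampleScale_eq {K δ ε : ℝ} (hK : 1 ≤ K) (hδ : 0 < δ) (hδ2 : δ ≤ 1 / 2) (hε : 0 < ε)
    (hε1 : ε ≤ 1) (h : ε ^ 2 * Real.log (1 / δ) ≤ 1) :
    sampleScale K δ ε = Real.log (K / δ) / ε ^ 2 := by
  have hL : 0 ≤ Real.log (K / δ) := Real.log_nonneg (by rw [le_div_iff₀ hδ]; linarith)
  rw [sampleScale]
  refine max_eq_left (max_le ?_ ?_)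
  · exact div_le_div_of_nonneg_left hL (by positivity) (by nlinarith)
  · rw [div_eq_mul_inv]
    refine mul_le_mul_of_nonneg_left ?_ hL
    rw [← one_div, le_div_iff₀ (by positivity)]
    linarith

theorem half_le_log_one_div {δ : ℝ} (hδ : 0 < δ) (hδ2 : δ ≤ 1 / 2) : 1 / 2 ≤ Real.log (1 / δ) := by
  have h1 : Real.log 2 ≤ Real.log (1 / δ) :=
    Real.log_le_log two_pos (by rw [le_div_iff₀ hδ]; linarith)
  linarith [Real.log_two_gt_d9]

/-- Enough shots for the union bound. -/
theorem exponent_le_of_sampleScale_le {K δ ε M : ℝ} (hK : 1 ≤ K) (hδ : 0 < δ) (hδ2 : δ ≤ 1 / 2)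
    (hε : 0 < ε) (hM : 50000 * sampleScale K δ ε ≤ M) :
    5 * Real.log (K / δ) ≤ M * (min ε 1 / 8) ^ 2 / 64 := by
  have hL : 0 ≤ Real.log (K / δ) := Real.log_nonneg (by rw [le_div_iff₀ hδ]; linarith)
  have h1 : Real.log (K / δ) / ε ^ 2 ≤ sampleScale K δ ε := le_max_left _ _
  have h2 : Real.log (K / δ) * Real.log (1 / δ) ≤ sampleScale K δ ε :=
    (le_max_right _ _).trans (le_max_right _ _)
  have h3 := half_le_log_one_div hδ hδ2
  -- The estimate needs `M ≥ 20480 log (K/δ) / (min ε 1)²`. For `ε ≤ 1` the first term of the scale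
  -- gives this; for `ε ≥ 1` the third does, since `log (1/δ) ≥ 1/2`.
  rcases le_total ε 1 with h | h
  · rw [min_eq_left h]
    have h4 : 50000 * (Real.log (K / δ) / ε ^ 2) ≤ M := by linarith
    rw [← mul_div_assoc, div_le_iff₀ (by positivity)] at h4
    nlinarith
  · rw [min_eq_right h]
    have h4 : Real.log (K / δ) * (1 / 2) ≤ Real.log (K / δ) * Real.log (1 / δ) :=
      mul_le_mul_of_nonneg_left h3 hL
    linarith

theorem exp_neg_mul_log {x : ℝ} (hx : 0 < x) (k : ℕ) : Real.exp (-(k * Real.log x)) = x⁻¹ ^ k := by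
  rw [Real.exp_neg, Real.exp_nat_mul, Real.exp_log hx, inv_pow]

theorem exp_le_of_five_log_le {K δ x : ℝ} (hK : 1 ≤ K) (hδ : 0 < δ) (hδ2 : δ ≤ 1 / 2)
    (hx : 5 * Real.log (K / δ) ≤ x) : K * Real.exp (-x) ≤ δ / 16 := by
  have hK0 : 0 < K := by linarith
  have h1 : Real.exp (-x) ≤ (δ / K) ^ 5 := by
    rw [← inv_div K δ, ← exp_neg_mul_log (by positivity)]
    exact Real.exp_le_exp.2 (by push_cast; linarith)
  have hq : δ / K ≤ 1 / 2 := by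
    rw [div_le_iff₀ hK0]; linarith
  have h2 : (δ / K) ^ 4 ≤ (1 / 2) ^ 4 := pow_le_pow_left₀ (by positivity) hq 4
  calc K * Real.exp (-x) ≤ K * (δ / K) ^ 5 := mul_le_mul_of_nonneg_left h1 hK0.le
    _ = δ * (δ / K) ^ 4 := by field_simp
    _ ≤ δ * (1 / 2) ^ 4 := mul_le_mul_of_nonneg_left h2 hδ.le
    _ = δ / 16 := by ring

/-- Everything is measured in `q = δ / (K + K')`: the number of circuits costs `q⁻¹`, the number of
pairs `q⁻²`, and `2 ^ (-N)` is at most `q ^ 20`. The surplus powers of `q ≤ 1/2` absorb the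
constants, and one remaining factor `q ≤ δ` gives the bound. -/
theorem collision_bound {N n : ℕ} {K K' δ : ℝ} (hK : 1 ≤ K) (hK' : 0 ≤ K') (hδ : 0 < δ)
    (hδ2 : δ ≤ 1 / 2) (hN : 50000 * Real.log ((K + K') / δ) ≤ N)
    (hn : (n : ℝ) ≤ 2880 * Real.log (K / δ) + 1) :
    n * ((K + K ^ 2) * (2 / 2 ^ N)) + n * ((K' + K' ^ 2) * (2 / 2 ^ N)) ≤ δ / 4 := by
  set q := δ / (K + K') with hq
  have hS : 0 < K + K' := by linarith
  have hq0 : 0 < q := by positivity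
  have hqδ : q ≤ δ := by rw [hq, div_le_iff₀ hS]; nlinarith
  have hq2 : q ≤ 1 / 2 := hqδ.trans hδ2
  have hSq : K + K' = δ * q⁻¹ := by rw [hq]; field_simp
  have hS1 : K + K' ≤ q⁻¹ := by
    rw [hSq]; exact mul_le_of_le_one_left (by positivity) (by linarith)
  have hlog : Real.log (K / δ) ≤ q⁻¹ := by
    have h1 : K / δ ≤ q⁻¹ := by
      rw [hq, inv_div]; exact div_le_div_of_nonneg_right (by linarith) hδ.le
    exact ((Real.log_le_sub_one_of_pos (by positivity)).trans (by linarith)).trans h1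
  have hn' : (n : ℝ) ≤ 2881 * q⁻¹ := by
    have : 1 ≤ q⁻¹ := (by linarith : (1 : ℝ) ≤ K + K').trans hS1
    linarith
  have h2N : (2 / 2 ^ N : ℝ) ≤ 2 * q ^ 20 := by
    have hL : 0 ≤ Real.log ((K + K') / δ) :=
      Real.log_nonneg (by rw [le_div_iff₀ hδ]; linarith)
    have h3 : Real.exp (N * Real.log 2) = 2 ^ N := by
      rw [Real.exp_nat_mul, Real.exp_log two_pos]
    have h4 : ((2 : ℝ) ^ N)⁻¹ ≤ q ^ 20 := by
      rw [← h3, ← Real.exp_neg, hq, ← inv_div (K + K') δ, ← exp_neg_mul_log (by positivity)]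
      refine Real.exp_le_exp.2 (neg_le_neg ?_)
      have h5 : (N : ℝ) * (1 / 2) ≤ N * Real.log 2 :=
        mul_le_mul_of_nonneg_left (by linarith [Real.log_two_gt_d9]) (Nat.cast_nonneg N)
      push_cast
      linarith
    rw [div_eq_mul_inv]
    linarith
  have hsum : (K + K ^ 2) + (K' + K' ^ 2) ≤ 2 * (q⁻¹) ^ 2 := by
    have h6 : (K + K') ^ 2 ≤ q⁻¹ ^ 2 := pow_le_pow_left₀ hS.le hS1 2
    nlinarith [mul_nonneg (by linarith : 0 ≤ K) hK']
  have h7 : q ^ 16 ≤ (1 / 2) ^ 16 := pow_le_pow_left₀ hq0.le hq2 16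
  calc n * ((K + K ^ 2) * (2 / 2 ^ N)) + n * ((K' + K' ^ 2) * (2 / 2 ^ N))
      = n * (((K + K ^ 2) + (K' + K' ^ 2)) * (2 / 2 ^ N)) := by ring
    _ ≤ (2881 * q⁻¹) * ((2 * q⁻¹ ^ 2) * (2 * q ^ 20)) := by
        have : 0 ≤ (K + K ^ 2) + (K' + K' ^ 2) := by nlinarith
        gcongr
    _ = 11524 * (q * q ^ 16) := by field_simp; norm_num
    _ ≤ 11524 * (δ * (1 / 2) ^ 16) := by gcongr
    _ ≤ δ / 4 := by norm_num; linarith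

/-! ### Choice of constants and the final union bound -/

theorem mainTheorem1 :
    ∃ c C₀ C : ℝ, 0 < c ∧ 0 < C₀ ∧ 0 < C ∧
      ∀ (N T a b : ℕ), 0 < T → 0 < a →
      ∀ (P : Fin a → PauliString N) (θ : Fin a → Fin T → ℝ)
        (Q : Fin b → PauliString N) (γ : Fin b → Fin T → ℝ),
        Function.Injective P → (∀ α, P α ≠ 0) →
        Function.Injective Q → (∀ β, Q β ≠ 0) →
        (∀ β t, 0 ≤ γ β t) →
        (∑ β, ∑ t, γ β t) + (∑ α, ∑ t, θ α t ^ 2) ≤ c →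
      ∀ δ ε : ℝ, 0 < δ → δ ≤ 1 / 2 → 0 < ε →
        C * Real.log (((a * T : ℕ) + (b * T : ℕ) : ℝ) / δ) ≤ N →
        (∀ n m : ℕ, n = ⌈C₀ * Real.log ((a * T : ℕ) / δ)⌉₊ →
          C * sampleScale (a * T : ℕ) δ ε ≤ ((n * m : ℕ) : ℝ) →
          1 - δ ≤ experimentProb P θ Q γ n m (fun Circ sx sz =>
            IsUnit ((designX P Circ)ᵀ * designX P Circ) ∧
            IsUnit ((designZ Q Circ)ᵀ * designZ Q Circ) ∧
            0 < fidelityMean P θ Q γ Circ ∧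
            0 < fidelityEst Q Circ sz ∧
            ∀ α t,
              |thetaBias P θ Q γ Circ α t| ≤
                C * ((∑ α, ∑ t, |θ α t|) + ∑ β, ∑ t, γ β t) ^ 2 ∧
              |thetaEst P Q Circ sx sz α t - θ α t| ≤ ε + |thetaBias P θ Q γ Circ α t|)) ∧
        (ε ≤ 1 → ε ^ 2 * Real.log (1 / δ) ≤ 1 →
          sampleScale (a * T : ℕ) δ ε = Real.log ((a * T : ℕ) / δ) / ε ^ 2) := by
  -- `2880 = 5 * 576` makes the Chernoff exponent over circuits at least `5 log (K/δ)`; `50000` is a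
  -- generous common constant for the register size, the shots and the bias.
  refine ⟨1 / 4, 2880, 50000, by norm_num, by norm_num, by norm_num, ?_⟩
  intro N T a b hT ha P θ Q γ hP hP0 hQ hQ0 h0 hc δ ε hδ hδ2 hε hN
  have hK : (1 : ℝ) ≤ (a * T : ℕ) := by exact_mod_cast Nat.mul_pos ha hT
  refine ⟨?_, fun hε1 h => sampleScale_eq hK hδ hδ2 hε hε1 h⟩
  intro n m hn hM
  set K : ℝ := ((a * T : ℕ) : ℝ) with hKdef
  have hL : 1 / 2 ≤ Real.log (K / δ) := by
    refine (half_le_log_one_div hδ hδ2).trans (Real.log_le_log (by positivity) ?_)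
    exact div_le_div_of_nonneg_right hK hδ.le
  have hK' : (0 : ℝ) ≤ (b * T : ℕ) := Nat.cast_nonneg _
  have hn1 : 2880 * Real.log (K / δ) ≤ n := by rw [hn]; exact Nat.le_ceil _
  have hn2 : (n : ℝ) ≤ 2880 * Real.log (K / δ) + 1 := by
    rw [hn]; exact (Nat.ceil_lt_add_one (by linarith)).le
  have hn0 : 0 < n := by
    have : (0 : ℝ) < n := by linarith
    exact_mod_cast this
  have hN1 : 1 ≤ N := by
    have h2 : Real.log (K / δ) ≤ Real.log ((K + (b * T : ℕ)) / δ) :=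
      Real.log_le_log (by positivity) (div_le_div_of_nonneg_right (by linarith) hδ.le)
    have : (0 : ℝ) < N := by linarith
    exact_mod_cast this
  have hexp := exponent_le_of_sampleScale_le hK hδ hδ2 hε hM
  have hm0 : 0 < m := by
    rcases Nat.eq_zero_or_pos m with h | h
    · rw [h] at hexp; simp at hexp; linarith
    · exact h
  have hγ : ∀ β t, γ β t ≤ 1 := fun β t => by
    have h1 := Finset.single_le_sum (fun t _ => h0 β t) (Finset.mem_univ t)
    have h2 := Finset.single_le_sum (f := fun β => ∑ t, γ β t)
      (fun β _ => Finset.sum_nonneg fun t _ => h0 β t) (Finset.mem_univ β)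
    have h3 : 0 ≤ ∑ α, ∑ t, θ α t ^ 2 :=
      Finset.sum_nonneg fun _ _ => Finset.sum_nonneg fun _ _ => sq_nonneg _
    linarith
  -- The error of the estimator is `8 η` plus the bias, and its stability needs `η ≤ 1/8`.
  set η := min ε 1 / 8 with hη
  have hη0 : 0 ≤ η := by positivity
  have hη8 : η ≤ 1 / 8 := by linarith [min_le_right ε 1]
  have hηε : 8 * η ≤ ε := by linarith [min_le_left ε 1]
  have htail := exp_le_of_five_log_le hK hδ hδ2 hexp
  rw [Nat.cast_mul] at htail
  refine le_trans ?_ (experimentProb_ge (δ₁ := δ / 2) (δ₂ := δ / 4) h0 hγ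
    (G := fun C => TypicalCircuits P θ Q γ C)
    (Bx := fun C s => ∃ p : Fin a × Fin T, n * m * η / 2 ≤
      |deviation (fun i => probX P θ Q γ (C i)) (fun i => resp (pullbacks (C i) p.2) (P p.1)) s|)
    (Bz := fun C s => n * m * η / 2 ≤ |deviation (fun i => probZ P θ Q γ (C i)) zeroIndicator s|)
    ?_ (by linarith) ?_ ?_)
  -- The budget is `δ/2` for the circuits and `δ/4` for the shots: `(1 - δ/2) (1 - δ/4) ≥ 1 - δ`.
  · nlinarith
  · intro C sx sz hC hx hz
    push Not at hx hz
    have hv := hC.visible_pos hn0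
    have hnR : (0 : ℝ) < n := by exact_mod_cast hn0
    have hest := fun α t => abs_thetaEst_sub_le hC hn0 hm0 h0 hγ hη8 α t (hx (α, t)).le hz.le
    refine ⟨isUnit_gram (designX_gram hC.coherent) ?_,
      isUnit_gram (designZ_gram hC.incoherent) fun _ => hnR.ne', ?_,
      (hest ⟨0, ha⟩ ⟨0, hT⟩).1, fun α t => ⟨?_, ?_⟩⟩
    · rintro (_ | p)
      · simp only [Option.elim_none]; positivity
      · have := hv p
        simp only [Option.elim_some]; positivity
    · linarith [half_le_fidelityMean hC hn0]
    · refine (abs_thetaBias_le hC hn0 h0 hγ α t).trans ?_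
      exact mul_le_mul_of_nonneg_right (by norm_num) (sq_nonneg _)
    · exact (hest α t).2.trans (by linarith)
  · refine (pr_not_typical_le n hN1 θ hP hP0 hQ hQ0 h0 hc).trans ?_
    have h1 := collision_bound hK hK' hδ hδ2 hN hn2
    have h2 := exp_le_of_five_log_le (x := n / 576) hK hδ hδ2 (by linarith)
    have h3 : Real.exp (-(n / 576 : ℝ)) ≤ K * Real.exp (-(n / 576)) :=
      le_mul_of_one_le_left (Real.exp_pos _).le hK
    linarith
  · intro C _
    have hx := (pr_exists_le (shotsWeight_nonneg fun i => probX_nonneg P θ Q (C i) h0 hγ) _).trans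
      (Finset.sum_le_sum fun (p : Fin a × Fin T) _ =>
        pr_abs_deviation_ge_le (m := m) (fun i => probX_nonneg P θ Q (C i) h0 hγ)
        (fun i => sum_probX P θ Q (C i) γ)
        (g := fun i => resp (pullbacks (C i) p.2) (P p.1))
        (fun i z => (abs_resp_le _ _ z).trans (by
          rcases ycoef_sq_eq_zero_or ((pullbacks (C i) p.2).1 (P p.1)).2 with h | h <;> rw [h]
          norm_num)) hη0 (by linarith))
    have hz := pr_abs_deviation_ge_le (m := m) (fun i => probZ_nonneg P θ Q (C i) h0 hγ)
      (fun i => sum_probZ P θ Q (C i) γ) (g := zeroIndicator)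
      (fun i z => by rw [zeroIndicator]; split_ifs <;> norm_num) hη0 (by linarith)
    rw [Finset.sum_const, Finset.card_univ, Fintype.card_prod, Fintype.card_fin, Fintype.card_fin,
      nsmul_eq_mul, ← hKdef] at hx
    have h3 : Real.exp (-(n * m * η ^ 2 / 64 : ℝ)) ≤ K * Real.exp (-(n * m * η ^ 2 / 64)) :=
      le_mul_of_one_le_left (Real.exp_pos _).le hK
    linarith
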